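/- Let $G=(V,E)$ be a connected, locally finite graph without loops, write $i\sim j$ if $\{i,j\}\in E$, and let $(W_{i,j})_{i\sim j}$ be symmetric positive conductances. Let $\beta=(\beta_i)_{i\in V}$ be the random field of positive variables whose law is determined by $$\mathbb E\Big(e^{-\sum_{i\in U}\lambda_i\beta_i}\Big)=\exp\Big(-\sum_{\{i,j\}\in E,\ i,j\in U}W_{i,j}\big(\sqrt{(1+\lambda_i)(1+\lambda_j)}-1\big)-\sum_{i\sim j,\ i\in U,\ j\notin U}W_{i,j}\big(\sqrt{1+\lambda_i}-1\big)\Big)\prod_{i\in U}\frac1{\sqrt{1+\lambda_i}}$$ for all finite $U\subset V$ and $\lambda\in\mathbb R_+^U$. For a path $\sigma=(\sigma_0,\dots,\sigma_m)$ in $G$ put $W_\sigma=\prod_{k<m}W_{\sigma_k,\sigma_{k+1}}$, $(2\beta)_\sigma=\prod_{k\le m}2\beta_{\sigma_k}$ and $(2\beta)^-_\sigma=\prod_{k<m}2\beta_{\sigma_k}$. Let $(V_n)$ be an increasing sequence of finite connected subsets of $V$ with union $V$. Let $\hat G^{(n)}(i,j)=\sum_\sigma W_\sigma/(2\beta)_\sigma$,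 over the paths in $V_n$ from $i$ to $j$, if $i,j\in V_n$, and $\hat G^{(n)}(i,j)=0$ otherwise; let $\psi^{(n)}(i)=\sum_\sigma W_\sigma/(2\beta)^-_\sigma$, over the paths from $i$ to a vertex outside $V_n$ all of whose previous vertices are in $V_n$, if $i\in V_n$, and $\psi^{(n)}(i)=1$ otherwise. Let $H_\beta$ act by $(H_\beta f)(i)=2\beta_if(i)-\sum_{j\sim i}W_{i,j}f(j)$; as an operator on $\ell^2(V)$ it has the domain $\{f\in\ell^2(V): H_\beta f\in\ell^2(V)\}$. Then, almost surely, the limits $\hat G(i,j)=\lim_n\hat G^{(n)}(i,j)$ and $\psi(i)=\lim_n\psi^{(n)}(i)$ exist and are finite for all $i,j\in V$, and: (i) Almost surely, the spectrum of $H_\beta$ is included in $[0,\infty)$. (ii) For all $i,j\in V$, almost surely, $\hat G(i,j)=\lim_{\epsilon\downarrow0}(H_\beta+\epsilon)^{-1}(i,j)$. (iii) Almost surely, $(H_\beta\psi)(i)=0$ for all $i\in V$. (iv) If $G$ is the grid $\mathbb Z^d$, $d\ge1$, with constant conductances $W_{i,j}=W>0$, then $(\hat G,\psi)$ is stationary and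 ergodic for the spatial shifts $(\tau_a\hat G)(i,j)=\hat G(i+a,j+a)$, $(\tau_a\psi)(i)=\psi(i+a)$, $a\in\mathbb Z^d$. If moreover the vertex reinforced jump process is transient, then $\psi$ is almost surely a positive generalized eigenfunction of $H_\beta$ with eigenvalue $0$ and at most polynomial growth: almost surely $\psi(i)>0$ for all $i$ and $H_\beta\psi=0$, and there is a deterministic $p\ge0$ such that, almost surely, there is a (random) $C>0$ with $|\psi(i)|\le C\|i\|^p$ for all $i\in\mathbb Z^d\setminus\{0\}$. Here the vertex reinforced jump process starts at some vertex $i_0$ and, given its past up to time $s$, jumps from its position $i$ to a neighbour $j$ at rate $W_{i,j}L_j(s)$, where $L_j(s)$ is $1$ plus the time spent at $j$ up to time $s$; it is transient if, almost surely, every vertex is visited finitely often. -/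

import Mathlib

open MeasureTheory ProbabilityTheory Filter Topology
open scoped ENNReal

noncomputable section

namespace VRJP

universe u

/-! ## Weighted graphs -/

/-- A set of positive symmetric conductances `W i j` on the edges of `G`.
(The values of `W i j` on pairs that are not edges are never used.) -/
structure Conductances {V : Type u} (G : SimpleGraph V) where
  /-- the conductance of the pair `i`, `j` -/
  val : V → V → ℝ
  symm : ∀ i j, G.Adj i j → val i j = val j i
  pos : ∀ i j, G.Adj i j → 0 < val i j

/-- The constant conductances `W i j = w`. -/
def Conductances.const {V : Type u} (G : SimpleGraph V) (w : ℝ) (hw : 0 < w) :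
    Conductances G where
  val := fun _ _ => w
  symm := fun _ _ _ => rfl
  pos := fun _ _ _ => hw

/-- An increasing sequence of finite connected subsets of `V` with union `V`. -/
structure IsExhaustion {V : Type u} (G : SimpleGraph V) (Λ : ℕ → Finset V) : Prop where
  mono : Monotone Λ
  connected : ∀ n, (G.induce (Λ n : Set V)).Connected
  exhausts : ∀ v, ∃ n, v ∈ Λ n

section Field

variable {V : Type u} {G : SimpleGraph V} [G.LocallyFinite]

/-! ## The random potential -/

open Classical in
/-- The Laplace transform of `(β i)_{i ∈ U}` at `l`. The first sum runs over ordered pairs, so each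
edge inside `U` is met twice, whence the factor `1 / 2`. -/
def laplaceFormula (W : Conductances G) (U : Finset V) (l : V → ℝ) : ℝ :=
  Real.exp
      (-(1 / 2 * ∑ i ∈ U, ∑ j ∈ U with G.Adj i j,
            W.val i j * (Real.sqrt ((1 + l i) * (1 + l j)) - 1))
        - ∑ i ∈ U, ∑ j ∈ G.neighborFinset i with j ∉ U,
            W.val i j * (Real.sqrt (1 + l i) - 1))
    * (1 / ∏ i ∈ U, Real.sqrt (1 + l i))

/-- `ν` is the law of the random potential associated with `W`: the probability measure on
`V → ℝ`, carried by positive fields, whose finite dimensional marginals have the Laplace transform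
given by `laplaceFormula` (which determines `ν`). -/
structure IsPotentialLaw (W : Conductances G) (ν : Measure (V → ℝ)) : Prop where
  isProbabilityMeasure : IsProbabilityMeasure ν
  pos : ∀ᵐ β ∂ν, ∀ i, 0 < β i
  laplace : ∀ (U : Finset V) (l : V → ℝ), (∀ i ∈ U, 0 ≤ l i) →
    ∫ β, Real.exp (-∑ i ∈ U, l i * β i) ∂ν = laplaceFormula W U l

/-! ## Sums over paths

A path `σ = (σ₀, …, σₘ)` from `i` to `j` is a walk `σ : G.Walk i j`, with vertices `σ.support`. -/

/-- `W_σ`, the product of the conductances of the steps of `σ`. -/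
def walkWeight (W : Conductances G) {i j : V} (σ : G.Walk i j) : ℝ :=
  (σ.darts.map fun e => W.val e.fst e.snd).prod

/-- `(2β)_σ`, the product of `2β` over all the vertices of `σ`. -/
def walkPotential (β : V → ℝ) {i j : V} (σ : G.Walk i j) : ℝ :=
  (σ.support.map fun v => 2 * β v).prod

/-- `(2β)⁻_σ`, the product of `2β` over all the vertices of `σ` but the last one. -/
def walkPotentialInit (β : V → ℝ) {i j : V} (σ : G.Walk i j) : ℝ :=
  (σ.support.dropLast.map fun v => 2 * β v).prod

open Classical in
/-- `Ĝ⁽ⁿ⁾(i, j)` for the finite set `S = Vₙ`: the sum of `W_σ / (2β)_σ` over the paths `σ` in `S`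
from `i` to `j` if `i, j ∈ S`, and `0` otherwise. -/
def greenFin (W : Conductances G) (S : Finset V) (β : V → ℝ) (i j : V) : ℝ≥0∞ :=
  if i ∈ S ∧ j ∈ S then
    ∑' σ : {σ : G.Walk i j // ∀ v ∈ σ.support, v ∈ S},
      ENNReal.ofReal (walkWeight W σ.1 / walkPotential β σ.1)
  else 0

open Classical in
/-- `ψ⁽ⁿ⁾(i)` for the finite set `S = Vₙ`: the sum of `W_σ / (2β)⁻_σ` over the paths `σ` from `i`
to a vertex outside `S` all of whose previous vertices are in `S` if `i ∈ S`, and `1` otherwise. -/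
def psiFin (W : Conductances G) (S : Finset V) (β : V → ℝ) (i : V) : ℝ≥0∞ :=
  if i ∈ S then
    ∑' σ : {σ : (Σ j : V, G.Walk i j) // σ.1 ∉ S ∧ ∀ v ∈ σ.2.support.dropLast, v ∈ S},
      ENNReal.ofReal (walkWeight W σ.1.2 / walkPotentialInit β σ.1.2)
  else 1

/-- `Ĝ(i, j) = lim Ĝ⁽ⁿ⁾(i, j)`, along the exhaustion `Λ`. -/
def green (W : Conductances G) (Λ : ℕ → Finset V) (β : V → ℝ) (i j : V) : ℝ :=
  (limUnder atTop fun n => greenFin W (Λ n) β i j).toReal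

/-- `ψ(i) = lim ψ⁽ⁿ⁾(i)`, along the exhaustion `Λ`. -/
def psi (W : Conductances G) (Λ : ℕ → Finset V) (β : V → ℝ) (i : V) : ℝ :=
  (limUnder atTop fun n => psiFin W (Λ n) β i).toReal

/-! ## The Schrödinger operator -/

/-- The action of `H_β = -P + 2β` on arbitrary (real, complex) functions on the vertices:
`(H_β f)(i) = 2 β_i f(i) - ∑_{j ∼ i} W_{i,j} f(j)`. -/
def schrodinger (W : Conductances G) (β : V → ℝ) {E : Type*} [AddCommGroup E] [Module ℝ E]
    (f : V → E) (i : V) : E :=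
  (2 * β i) • f i - ∑ j ∈ G.neighborFinset i, W.val i j • f j

/-- The Hilbert space `ℓ²(V)`. -/
abbrev L2 (V : Type u) : Type u := lp (fun _ : V => ℂ) 2

theorem schrodinger_add (W : Conductances G) (β : V → ℝ) (f g : V → ℂ) :
    schrodinger W β (f + g) = schrodinger W β f + schrodinger W β g := by
  funext i
  simp only [schrodinger, Pi.add_apply, smul_add, Finset.sum_add_distrib]
  abel

theorem schrodinger_smul (W : Conductances G) (β : V → ℝ) (c : ℂ) (f : V → ℂ) :
    schrodinger W β (c • f) = c • schrodinger W β f := by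
  funext i
  simp only [schrodinger, Pi.smul_apply, smul_sub, Finset.smul_sum, smul_comm c]

theorem schrodinger_zero (W : Conductances G) (β : V → ℝ) :
    schrodinger W β (0 : V → ℂ) = 0 := by
  funext i
  simp [schrodinger]

/-- `H_β` as an (in general unbounded) operator on `ℓ²(V)`, on its natural domain
`{f ∈ ℓ²(V) : H_β f ∈ ℓ²(V)}`. -/
def schrodingerOp (W : Conductances G) (β : V → ℝ) : L2 V →ₗ.[ℂ] L2 V where
  domain :=
    { carrier := {f | Memℓp (schrodinger W β (f : V → ℂ)) 2}
      add_mem' := fun {f g} hf hg => by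
        have h := Memℓp.add hf hg
        rw [← schrodinger_add] at h
        exact h
      zero_mem' := by
        have h : Memℓp (schrodinger W β (0 : V → ℂ)) 2 := by
          rw [schrodinger_zero]
          exact zero_memℓp
        exact h
      smul_mem' := fun c f hf => by
        have h := Memℓp.const_smul hf c
        rw [← schrodinger_smul] at h
        exact h }
  toFun :=
    { toFun := fun f => ⟨schrodinger W β (f.1 : V → ℂ), f.2⟩
      map_add' := fun f g => Subtype.ext (schrodinger_add W β (f.1 : V → ℂ) (g.1 : V → ℂ))
      map_smul' := fun c f => Subtype.ext (schrodinger_smul W β c (f.1 : V → ℂ)) }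

end Field

/-- `R` is the bounded inverse of `T - z`. -/
def IsResolventAt {E : Type*} [NormedAddCommGroup E] [NormedSpace ℂ E] (T : E →ₗ.[ℂ] E) (z : ℂ)
    (R : E →L[ℂ] E) : Prop :=
  (∀ g : E, ∃ h : R g ∈ T.domain, T ⟨R g, h⟩ - z • R g = g) ∧
    ∀ f : T.domain, R (T f - z • (f : E)) = f

/-- The spectrum of an unbounded operator: the `z` for which `T - z` has no bounded inverse. -/
def spectrumOf {E : Type*} [NormedAddCommGroup E] [NormedSpace ℂ E] (T : E →ₗ.[ℂ] E) : Set ℂ :=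
  {z | ¬ ∃ R : E →L[ℂ] E, IsResolventAt T z R}

open Classical in
/-- `(T - z)⁻¹` for `z` outside the spectrum of `T` (and `0` for `z` in the spectrum). -/
def resolventOf {E : Type*} [NormedAddCommGroup E] [NormedSpace ℂ E] (T : E →ₗ.[ℂ] E) (z : ℂ) :
    E →L[ℂ] E :=
  if h : ∃ R : E →L[ℂ] E, IsResolventAt T z R then h.choose else 0

open Classical in
/-- The matrix entry `A(i, j) = (A δ_j)(i)` of an operator on `ℓ²(V)`. -/
def entry {V : Type u} (A : L2 V →L[ℂ] L2 V) (i j : V) : ℂ :=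
  (A (lp.single 2 j (1 : ℂ)) : V → ℂ) i

/-! ## The vertex reinforced jump process

The process is described by the sequence `(X_n, T_n)`, where `X_n` is the position after `n` jumps
and `T_n` is the time spent at `X_{n-1}` before the `n`-th jump (with the convention `T_0 = 0`).
Between two jumps only the local time of the current position moves, and this position is not a
neighbour of itself: the jump rates `W_{i,j} L_j` are constant there. -/

section Walk

set_option linter.unusedSectionVars false

variable {V : Type u} {G : SimpleGraph V} [G.LocallyFinite]

/-- The initial `n + 1` terms of the sequence `(X_n, T_n)`. -/
abbrev History (V : Type u) (n : ℕ) : Type u := (_ : Finset.Iic n) → V × ℝ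

/-- The position `X_k`, for `k ≤ n`. -/
def History.pos {n : ℕ} (h : History V n) (k : ℕ) (hk : k ≤ n) : V :=
  (h ⟨k, Finset.mem_Iic.2 hk⟩).1

/-- The holding time `T_k`, for `k ≤ n`. (Holding times are almost surely positive; the positive
part only makes the formulas below meaningful for all histories.) -/
def History.time {n : ℕ} (h : History V n) (k : ℕ) (hk : k ≤ n) : ℝ :=
  max (h ⟨k, Finset.mem_Iic.2 hk⟩).2 0

open Classical in
/-- The local time `L_j` at the time of the `n`-th jump: `1` plus the time spent at `j`. -/
def localTime {n : ℕ} (h : History V n) (j : V) : ℝ :=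
  1 + ∑ k : Fin n, if h.pos k k.2.le = j then h.time (k + 1) k.2 else 0

open Classical in
/-- The rate of a jump from `i` to `j` after the history `h`: `W_{i,j} L_j` if `i ∼ j`. -/
def jumpRate (W : Conductances G) {n : ℕ} (h : History V n) (i j : V) : ℝ :=
  if G.Adj i j then W.val i j * localTime h j else 0

/-- The total jump rate from `i`. -/
def totalRate (W : Conductances G) {n : ℕ} (h : History V n) (i : V) : ℝ :=
  ∑ j ∈ G.neighborFinset i, jumpRate W h i j

/-- The density at `(j, t)` of the next position and of the holding time before the next jump,
after the history `h`. -/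
def stepDensity (W : Conductances G) {n : ℕ} (h : History V n) (p : V × ℝ) : ℝ≥0∞ :=
  if 0 ≤ p.2 then
    ENNReal.ofReal (jumpRate W h (h.pos n le_rfl) p.1 *
      Real.exp (-(totalRate W h (h.pos n le_rfl) * p.2)))
  else 0

theorem one_le_localTime {n : ℕ} (h : History V n) (j : V) : 1 ≤ localTime h j := by
  classical
  have : 0 ≤ ∑ k : Fin n, if h.pos k k.2.le = j then h.time (k + 1) k.2 else 0 := by
    refine Finset.sum_nonneg fun k _ => ?_
    split_ifs
    · exact le_max_right _ _
    · exact le_rfl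
  unfold localTime
  convert (le_add_iff_nonneg_right (1 : ℝ)).2 this

theorem jumpRate_pos (W : Conductances G) {n : ℕ} (h : History V n) {i j : V}
    (hij : G.Adj i j) : 0 < jumpRate W h i j := by
  rw [jumpRate, if_pos hij]
  exact mul_pos (W.pos i j hij) (lt_of_lt_of_le one_pos (one_le_localTime h j))

theorem jumpRate_nonneg (W : Conductances G) {n : ℕ} (h : History V n) (i j : V) :
    0 ≤ jumpRate W h i j := by
  by_cases hij : G.Adj i j
  · exact (jumpRate_pos W h hij).le
  · rw [jumpRate, if_neg hij]

theorem totalRate_pos (W : Conductances G) {n : ℕ} (h : History V n) {i : V}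
    (hi : (G.neighborFinset i).Nonempty) : 0 < totalRate W h i :=
  Finset.sum_pos (fun j hj => jumpRate_pos W h ((G.mem_neighborFinset i j).1 hj)) hi

variable [MeasurableSpace V] [DiscreteMeasurableSpace V] [Countable V]

theorem measurable_localTime {n : ℕ} (j : V) :
    Measurable fun h : History V n => localTime h j := by
  classical
  unfold localTime History.pos History.time
  refine measurable_const.add (Finset.measurable_sum _ fun k _ => ?_)
  refine Measurable.ite ?_ ?_ measurable_const
  · exact (measurable_fst.comp (measurable_pi_apply _)) (MeasurableSet.of_discrete (s := {j}))
  · exact (measurable_snd.comp (measurable_pi_apply _)).max measurable_const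

theorem measurable_jumpRate (W : Conductances G) {n : ℕ} (i j : V) :
    Measurable fun h : History V n => jumpRate W h i j := by
  unfold jumpRate
  split_ifs
  · exact (measurable_localTime j).const_mul _
  · exact measurable_const

theorem measurable_totalRate (W : Conductances G) {n : ℕ} (i : V) :
    Measurable fun h : History V n => totalRate W h i :=
  Finset.measurable_sum _ fun j _ => measurable_jumpRate W i j

theorem measurable_pos {n : ℕ} (k : ℕ) (hk : k ≤ n) :
    Measurable fun h : History V n => h.pos k hk :=
  measurable_fst.comp (measurable_pi_apply _)

theorem measurable_stepDensity (W : Conductances G) (n : ℕ) :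
    Measurable (Function.uncurry fun (h : History V n) (p : V × ℝ) => stepDensity W h p) := by
  have key : ∀ i j : V, Measurable fun q : History V n × ℝ =>
      jumpRate W q.1 i j * Real.exp (-(totalRate W q.1 i * q.2)) := fun i j =>
    ((measurable_jumpRate W i j).comp measurable_fst).mul
      ((((measurable_totalRate W i).comp measurable_fst).mul measurable_snd).neg.exp)
  have key2 : Measurable fun r : (V × V) × (History V n × ℝ) =>
      jumpRate W r.2.1 r.1.1 r.1.2 * Real.exp (-(totalRate W r.2.1 r.1.1 * r.2.2)) :=
    measurable_from_prod_countable_right fun p => key p.1 p.2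
  have hmap : Measurable fun q : History V n × (V × ℝ) =>
      ((((q.1.pos n le_rfl, q.2.1) : V × V), ((q.1, q.2.2) : History V n × ℝ)) :
        (V × V) × (History V n × ℝ)) :=
    (((measurable_pos n le_rfl).comp measurable_fst).prodMk
      (measurable_fst.comp measurable_snd)).prodMk
      (measurable_fst.prodMk (measurable_snd.comp measurable_snd))
  refine Measurable.ite (measurableSet_le measurable_const
    (measurable_snd.comp measurable_snd)) ?_ measurable_const
  exact (key2.comp hmap).ennreal_ofReal

/-- The conditional law of `(X_{n+1}, T_{n+1})` given the history up to the `n`-th jump: its density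
with respect to the product of the counting measure and the Lebesgue measure is `stepDensity`, that
is, each neighbour `j` of `X_n` is chosen at rate `W_{X_n,j} L_j`. -/
def stepKernel (W : Conductances G) (n : ℕ) : Kernel (History V n) (V × ℝ) :=
  Kernel.withDensity (Kernel.const _ ((Measure.count : Measure V).prod (volume : Measure ℝ)))
    fun h p => stepDensity W h p

theorem lintegral_stepDensity (W : Conductances G) (hG : ∀ i, (G.neighborFinset i).Nonempty)
    {n : ℕ} (h : History V n) :
    ∫⁻ p, stepDensity W h p ∂((Measure.count : Measure V).prod (volume : Measure ℝ)) = 1 := by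
  classical
  set i := h.pos n le_rfl with hi
  have hR : 0 < totalRate W h i := totalRate_pos W h (hG i)
  have hm : Measurable fun p : V × ℝ => stepDensity W h p :=
    (measurable_stepDensity W n).comp (measurable_const.prodMk measurable_id)
  have hfac : ∀ (j : V) (t : ℝ), stepDensity W h (j, t) =
      ENNReal.ofReal (jumpRate W h i j / totalRate W h i) *
        exponentialPDF (totalRate W h i) t := by
    intro j t
    rw [exponentialPDF_eq, ← ENNReal.ofReal_mul (div_nonneg (jumpRate_nonneg W h i j) hR.le)]
    by_cases ht : 0 ≤ t
    · simp only [stepDensity, ht, if_true, ← hi]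
      congr 1
      field_simp
    · simp [stepDensity, ht]
  rw [lintegral_prod _ hm.aemeasurable, lintegral_count]
  have hsum : ∀ j : V, ∫⁻ t, stepDensity W h (j, t) =
      ENNReal.ofReal (jumpRate W h i j / totalRate W h i) := by
    intro j
    simp_rw [hfac]
    rw [lintegral_const_mul' _ _ ENNReal.ofReal_ne_top, lintegral_exponentialPDF_eq_one hR,
      mul_one]
  simp_rw [hsum]
  rw [tsum_eq_sum (s := G.neighborFinset i), ← ENNReal.ofReal_sum_of_nonneg,
    ← Finset.sum_div]
  · have : ∑ j ∈ G.neighborFinset i, jumpRate W h i j = totalRate W h i := rfl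
    rw [this, div_self hR.ne', ENNReal.ofReal_one]
  · exact fun j _ => div_nonneg (jumpRate_nonneg W h i j) hR.le
  · intro j hj
    have : ¬ G.Adj i j := fun hij => hj ((G.mem_neighborFinset i j).2 hij)
    simp [jumpRate, this]

theorem isMarkovKernel_stepKernel (W : Conductances G)
    (hG : ∀ i, (G.neighborFinset i).Nonempty) (n : ℕ) : IsMarkovKernel (stepKernel W n) := by
  refine ⟨fun h => ⟨?_⟩⟩
  rw [stepKernel, Kernel.withDensity_apply' _ (measurable_stepDensity W n)]
  simpa using lintegral_stepDensity W hG h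

/-- The law of the sequence `(X_n, T_n)` of the vertex reinforced jump process started at `i₀`. -/
def processLaw (W : Conductances G) (hG : ∀ i, (G.neighborFinset i).Nonempty) (i₀ : V) :
    Measure (ℕ → V × ℝ) :=
  haveI := isMarkovKernel_stepKernel W hG
  Kernel.trajMeasure (X := fun _ => V × ℝ) (Measure.dirac ((i₀, 0) : V × ℝ))
    (fun n => stepKernel W n)

/-- The vertex reinforced jump process started at `i₀` is transient: almost surely, every vertex
is visited finitely often. -/
def IsTransient (W : Conductances G) (hG : ∀ i, (G.neighborFinset i).Nonempty) (i₀ : V) : Prop :=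
  ∀ᵐ x ∂(processLaw W hG i₀), ∀ v : V, {n : ℕ | (x n).1 = v}.Finite

end Walk

/-! ## The grid -/

/-- The nearest neighbour graph on `ℤ^d`. -/
def grid (d : ℕ) : SimpleGraph (Fin d → ℤ) where
  Adj x y := ∑ k, |x k - y k| = 1
  symm := ⟨fun x y h => by simpa only [abs_sub_comm] using h⟩
  loopless := ⟨fun x h => by simp at h⟩

theorem grid_neighborSet_finite (d : ℕ) (x : Fin d → ℤ) : ((grid d).neighborSet x).Finite := by
  refine (Set.finite_Icc (x - 1) (x + 1)).subset fun y hy => ?_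
  have h1 : ∑ k, |x k - y k| = 1 := hy
  have h2 : ∀ k, |x k - y k| ≤ 1 := fun k =>
    h1 ▸ Finset.single_le_sum (f := fun k => |x k - y k|) (fun _ _ => abs_nonneg _)
      (Finset.mem_univ k)
  refine ⟨fun k => ?_, fun k => ?_⟩
  · have := abs_le.1 (h2 k)
    simp only [Pi.sub_apply, Pi.one_apply]
    omega
  · have := abs_le.1 (h2 k)
    simp only [Pi.add_apply, Pi.one_apply]
    omega

instance gridLocallyFinite (d : ℕ) : (grid d).LocallyFinite :=
  fun x => (grid_neighborSet_finite d x).fintype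

theorem grid_neighborFinset_nonempty {d : ℕ} (hd : 0 < d) (x : Fin d → ℤ) :
    ((grid d).neighborFinset x).Nonempty := by
  refine ⟨x + (Pi.single (⟨0, hd⟩ : Fin d) (1 : ℤ) : Fin d → ℤ), ?_⟩
  rw [SimpleGraph.mem_neighborFinset]
  change ∑ k, |x k - (x + (Pi.single (⟨0, hd⟩ : Fin d) (1 : ℤ) : Fin d → ℤ)) k| = 1
  simp only [Pi.add_apply, sub_add_cancel_left, abs_neg]
  rw [Finset.sum_eq_single (⟨0, hd⟩ : Fin d)]
  · simp
  · intro k _ hk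
    simp [Pi.single_eq_of_ne hk]
  · simp

/-- The constant conductances `W i j = w` on the grid. -/
abbrev gridConst (d : ℕ) (w : ℝ) (hw : 0 < w) : Conductances (grid d) :=
  Conductances.const (grid d) w hw

/-- The action of the spatial shift by `a` on a pair formed by a kernel and a function:
`(τ_a g)(i, j) = g(i + a, j + a)` and `(τ_a f)(i) = f(i + a)`. -/
def shift {d : ℕ} (a : Fin d → ℤ)
    (p : ((Fin d → ℤ) → (Fin d → ℤ) → ℝ) × ((Fin d → ℤ) → ℝ)) :
    ((Fin d → ℤ) → (Fin d → ℤ) → ℝ) × ((Fin d → ℤ) → ℝ) :=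
  (fun i j => p.1 (i + a) (j + a), fun i => p.2 (i + a))

/-- The random variable `F` is stationary and ergodic for the family of transformations `τ`:
its law is invariant under every `τ a`, and gives probability `0` or `1` to every event that is
almost surely invariant under all of them. -/
structure IsStationaryErgodic {Ω S A : Type*} [MeasurableSpace Ω] [MeasurableSpace S]
    (μ : Measure Ω) (F : Ω → S) (τ : A → S → S) : Prop where
  aemeasurable : AEMeasurable F μ
  stationary : ∀ a, MeasurePreserving (τ a) (μ.map F) (μ.map F)
  ergodic : ∀ s, MeasurableSet s → (∀ a, τ a ⁻¹' s =ᵐ[μ.map F] s) →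
    μ.map F s = 0 ∨ μ.map F sᶜ = 0

end VRJP

end

/-! Everything is read off the restrictions H_S of H_β to finite sets S. If H_S has an inverse with
nonnegative entries (`IsGreen`), the sum over walks, being the least nonnegative supersolution of
the first-step equation, equals that inverse (`IsGreen.greenFin_eq`), and ψ^S = Ĝ^S η_S, where η_S
collects the conductances towards the complement (`IsGreen.psiFin_eq`).

The probabilistic input is one exponential identity (`IsTiltedGreen`): E exp(-⟨l,β⟩ - ⟨θ, Ĝ^S(η_S +
θ/2)⟩) equals the Laplace transform at l times exp(-⟨θ, √(1+l)⟩) for θ ≥ 0, and is at most that for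
signed θ. It is proved by adding vertices one at a time. Given β on S, the Schur complement at the
new vertex is given a reciprocal inverse Gaussian law; the integral is explicit, and uniqueness of
Laplace transforms identifies the law so built with the marginal of ν. There are three consequences.
The derivative at θ = 0 shows that ψ^{Λ n}(i) is a nonnegative martingale of mean 1, so it
converges. Taking θ = tδ_i gives E exp(-t²Ĝ^{Λ n}(i,i)/2) ≥ e^{-t}, so the increasing sequence Ĝ^{Λ
n}(i,i) stays bounded. Taking θ = -δ_i controls E exp(ψ - Ĝ/2).

For almost every β (`IsRegular`), parts (i)-(iii) are deterministic. The quadratic form is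
nonnegative because each H_S is. Since ψ^{Λ n}(i) is bounded in n, any f tending to 0 at infinity is
recovered from H_β f through the finite Green functions (`IsGreen.tendsto_sum_schrodinger`). Hence
H_β + ε has no kernel in ℓ², its resolvent is obtained by closing the inverse on finitely supported
functions, and the entries of the resolvent are limits of finite Green functions for the potential β
+ ε/2. Monotonicity in n and in ε permits the exchange of the two limits. The equation H_β ψ = 0 is
the limit of the first-step equations.

For (iv), the law of β is translation invariant and the potentials on non-adjacent sets are
independent, which gives ergodicity; Ĝ and ψ are equivariant because they do not depend on the
exhaustion. Polynomial growth follows from Eψ ≤ 1. By ergodicity ψ is either almost surely zero or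
almost surely positive everywhere, so it remains to exclude ψ = 0. Integrating out the holding time
in a jump of the reinforced process produces the weight W_{x,y}/(2β_x) of a walk in the potential β
(`setLIntegral_laplaceMean_succ`). This bounds the probability of a visit to i₀ after m jumps below
by E[ψ^{Λ n}(i₀) r_n^m], where r_n = 1 - 1/(2β_{i₀} Ĝ^{Λ n}(i₀,i₀)) is the return weight of that
walk. If ψ = 0, then E[ψ^{Λ n}(i₀)(1 - r_n)] tends to 0 (`eventually_lintegral_psi_mul_return_le`),
so arbitrarily late visits are almost sure, against transience. -/

noncomputable section

namespace VRJP

/-! ### Sums over walks and the first-step equation -/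

section Walks
variable {V : Type*} {G : SimpleGraph V}

/-- The sum over the walks started at `i` splits according to the first step. -/
theorem tsum_walk_firstStep [G.LocallyFinite] (i : V) (f : (Σ j, G.Walk i j) → ℝ≥0∞) :
    ∑' σ, f σ = f ⟨i, .nil⟩ +
      ∑ k : G.neighborSet i, ∑' σ : (Σ j, G.Walk (k : V) j), f ⟨σ.1, .cons ((G.mem_neighborSet i k).1 k.2) σ.2⟩ := by
  let e : (Unit ⊕ (Σ k : G.neighborSet i, Σ j, G.Walk (k : V) j)) ≃ (Σ j, G.Walk i j) :=
    { toFun := fun x => match x with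
        | .inl _ => ⟨i, .nil⟩
        | .inr ⟨k, σ⟩ => ⟨σ.1, .cons k.2 σ.2⟩
      invFun := fun σ => match σ with
        | ⟨_, .nil⟩ => .inl ()
        | ⟨j, .cons (v := k) h τ⟩ => .inr ⟨⟨k, h⟩, ⟨j, τ⟩⟩
      left_inv := by
        rintro (_ | ⟨⟨k, hk⟩, ⟨j, τ⟩⟩) <;> rfl
      right_inv := by
        rintro ⟨j, σ⟩
        cases σ <;> rfl }
  rw [← e.tsum_eq, ENNReal.summable.tsum_sum ENNReal.summable, ENNReal.tsum_sigma']
  simp only [tsum_fintype]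
  simp [e]

open Classical in
/-- The conductance of a pair, set to `0` on the pairs that are not edges. -/
def Conductances.weight (W : Conductances G) (i j : V) : ℝ := if G.Adj i j then W.val i j else 0

theorem Conductances.weight_of_adj (W : Conductances G) {i j : V} (h : G.Adj i j) :
    W.weight i j = W.val i j := if_pos h

theorem Conductances.weight_of_not_adj (W : Conductances G) {i j : V} (h : ¬ G.Adj i j) :
    W.weight i j = 0 := if_neg h

theorem Conductances.weight_symm (W : Conductances G) (i j : V) :
    W.weight i j = W.weight j i := by
  by_cases h : G.Adj i j
  · rw [W.weight_of_adj h, W.weight_of_adj h.symm, W.symm i j h]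
  · rw [W.weight_of_not_adj h, W.weight_of_not_adj fun h' => h h'.symm]

theorem Conductances.weight_pos (W : Conductances G) {i j : V} (h : G.Adj i j) :
    0 < W.weight i j := by
  rw [W.weight_of_adj h]; exact W.pos i j h

theorem Conductances.weight_nonneg (W : Conductances G) (i j : V) : 0 ≤ W.weight i j := by
  by_cases h : G.Adj i j
  · exact (W.weight_pos h).le
  · rw [W.weight_of_not_adj h]

theorem Conductances.weight_self (W : Conductances G) (i : V) : W.weight i i = 0 :=
  W.weight_of_not_adj (G.loopless.irrefl i)

open Classical in
/-- The contribution of a walk to `greenFin`. -/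
def greenTerm (W : Conductances G) (S : Finset V) (β : V → ℝ) (j : V) {i : V}
    (σ : Σ j, G.Walk i j) : ℝ≥0∞ :=
  if σ.1 = j ∧ ∀ v ∈ σ.2.support, v ∈ S then
    ENNReal.ofReal (walkWeight W σ.2 / walkPotential β σ.2) else 0

open Classical in
/-- The contribution of a walk to `psiFin`. -/
def psiTerm (W : Conductances G) (S : Finset V) (β : V → ℝ) {i : V}
    (σ : Σ j, G.Walk i j) : ℝ≥0∞ :=
  if σ.1 ∉ S ∧ ∀ v ∈ σ.2.support.dropLast, v ∈ S then
    ENNReal.ofReal (walkWeight W σ.2 / walkPotentialInit β σ.2) else 0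

open Classical in
-- The endpoint is left free and the constraints move into the summand, so that the decomposition by
-- the first step (`tsum_walk_firstStep`) applies to one and the same index type.
theorem greenFin_eq_tsum (W : Conductances G) (S : Finset V) (β : V → ℝ) (i j : V) :
    greenFin W S β i j = ∑' σ : (Σ k, G.Walk i k), greenTerm W S β j σ := by
  rw [ENNReal.tsum_sigma', tsum_eq_single j]
  · rw [greenFin]
    split_ifs with h
    · refine (tsum_subtype {σ : G.Walk i j | ∀ v ∈ σ.support, v ∈ S}
        fun σ => ENNReal.ofReal (walkWeight W σ / walkPotential β σ)).trans ?_
      refine tsum_congr fun σ => ?_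
      simp only [greenTerm, Set.indicator_apply, Set.mem_ofPred_eq, true_and]
    · symm
      refine ENNReal.tsum_eq_zero.2 fun σ => ?_
      rw [greenTerm, if_neg]
      rintro ⟨-, hσ⟩
      exact h ⟨hσ i σ.start_mem_support, hσ j σ.end_mem_support⟩
  · intro k hk
    refine ENNReal.tsum_eq_zero.2 fun σ => ?_
    rw [greenTerm, if_neg]
    exact fun h => hk h.1

/-- For a starting point outside S only the trivial walk meets the constraint, and its term is 1:
the convention for ψ outside S is the value of the sum itself. -/
theorem psiFin_eq_tsum (W : Conductances G) (S : Finset V) (β : V → ℝ) (i : V) :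
    psiFin W S β i = ∑' σ : (Σ k, G.Walk i k), psiTerm W S β σ := by
  classical
  rw [psiFin]
  split_ifs with h
  · refine (tsum_subtype {σ : (Σ j : V, G.Walk i j) | σ.1 ∉ S ∧ ∀ v ∈ σ.2.support.dropLast, v ∈ S}
        fun σ => ENNReal.ofReal (walkWeight W σ.2 / walkPotentialInit β σ.2)).trans ?_
    refine tsum_congr fun σ => ?_
    simp only [psiTerm, Set.indicator_apply, Set.mem_ofPred_eq]
  · rw [tsum_eq_single ⟨i, .nil⟩]
    · simp [psiTerm, h, walkWeight, walkPotentialInit]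
    · rintro ⟨j, σ⟩ hσ
      rw [psiTerm, if_neg]
      rintro ⟨-, h2⟩
      cases σ with
      | nil => exact hσ rfl
      | cons e τ =>
        refine h (h2 i ?_)
        simp [SimpleGraph.Walk.support_cons, List.dropLast_cons_of_ne_nil τ.support_ne_nil]

theorem greenTerm_nil (W : Conductances G) (S : Finset V) (β : V → ℝ) (i j : V) (hi : i ∈ S)
    [Decidable (i = j)] : greenTerm W S β j (⟨i, .nil⟩ : Σ k, G.Walk i k) =
      if i = j then ENNReal.ofReal (1 / (2 * β i)) else 0 := by
  simp [greenTerm, hi, walkWeight, walkPotential]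

theorem greenTerm_cons (W : Conductances G) (S : Finset V) {β : V → ℝ} (hβ : ∀ i, 0 < β i)
    {i k j : V} (hi : i ∈ S) (h : G.Adj i k) (σ : Σ j, G.Walk k j) :
    greenTerm W S β j ⟨σ.1, .cons h σ.2⟩ =
      ENNReal.ofReal (W.weight i k / (2 * β i)) * greenTerm W S β j σ := by
  classical
  simp only [greenTerm, SimpleGraph.Walk.support_cons, List.mem_cons, forall_eq_or_imp, hi,
    true_and]
  split_ifs
  · rw [← ENNReal.ofReal_mul (div_nonneg (W.weight_nonneg _ _) (by linarith [hβ i]))]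
    simp only [walkWeight, walkPotential, SimpleGraph.Walk.darts_cons, List.map_cons,
      List.prod_cons, SimpleGraph.Walk.support_cons, W.weight_of_adj h]
    rw [mul_div_mul_comm]
  · simp

theorem psiTerm_nil (W : Conductances G) (S : Finset V) (β : V → ℝ) (i : V) (hi : i ∈ S) :
    psiTerm W S β (⟨i, .nil⟩ : Σ k, G.Walk i k) = 0 := by
  simp [psiTerm, hi]

theorem psiTerm_cons (W : Conductances G) (S : Finset V) {β : V → ℝ} (hβ : ∀ i, 0 < β i)
    {i k : V} (hi : i ∈ S) (h : G.Adj i k) (σ : Σ j, G.Walk k j) :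
    psiTerm W S β ⟨σ.1, .cons h σ.2⟩ =
      ENNReal.ofReal (W.weight i k / (2 * β i)) * psiTerm W S β σ := by
  classical
  simp only [psiTerm, SimpleGraph.Walk.support_cons,
    List.dropLast_cons_of_ne_nil σ.2.support_ne_nil, List.mem_cons, forall_eq_or_imp, hi,
    true_and]
  split_ifs
  · rw [← ENNReal.ofReal_mul (div_nonneg (W.weight_nonneg _ _) (by linarith [hβ i]))]
    simp only [walkWeight, walkPotentialInit, SimpleGraph.Walk.darts_cons, List.map_cons,
      List.prod_cons, SimpleGraph.Walk.support_cons, W.weight_of_adj h,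
      List.dropLast_cons_of_ne_nil σ.2.support_ne_nil]
    rw [mul_div_mul_comm]
  · simp

set_option linter.unusedSectionVars false

variable [G.LocallyFinite]

theorem sum_neighborSet (i : V) {M : Type*} [AddCommMonoid M] (f : V → M) :
    ∑ k : G.neighborSet i, f k = ∑ k ∈ G.neighborFinset i, f k := by
  classical
  rw [SimpleGraph.neighborFinset, Set.toFinset, Finset.sum_map]
  rfl

theorem greenFin_firstStep (W : Conductances G) (S : Finset V) {β : V → ℝ} (hβ : ∀ i, 0 < β i)
    {i : V} (hi : i ∈ S) (j : V) [Decidable (i = j)] :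
    greenFin W S β i j = (if i = j then ENNReal.ofReal (1 / (2 * β i)) else 0) +
      ∑ k ∈ G.neighborFinset i, ENNReal.ofReal (W.weight i k / (2 * β i)) * greenFin W S β k j := by
  rw [greenFin_eq_tsum, tsum_walk_firstStep, greenTerm_nil W S β i j hi, ← sum_neighborSet]
  congr 1
  refine Finset.sum_congr rfl fun k _ => ?_
  rw [greenFin_eq_tsum, ← ENNReal.tsum_mul_left]
  exact tsum_congr fun σ => greenTerm_cons W S hβ hi k.2 σ

theorem psiFin_firstStep (W : Conductances G) (S : Finset V) {β : V → ℝ} (hβ : ∀ i, 0 < β i)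
    {i : V} (hi : i ∈ S) :
    psiFin W S β i =
      ∑ k ∈ G.neighborFinset i, ENNReal.ofReal (W.weight i k / (2 * β i)) * psiFin W S β k := by
  rw [psiFin_eq_tsum, tsum_walk_firstStep, psiTerm_nil W S β i hi, zero_add, ← sum_neighborSet]
  refine Finset.sum_congr rfl fun k _ => ?_
  rw [psiFin_eq_tsum, ← ENNReal.tsum_mul_left]
  exact tsum_congr fun σ => psiTerm_cons W S hβ hi k.2 σ

theorem psiFin_of_notMem (W : Conductances G) {S : Finset V} (β : V → ℝ) {i : V} (hi : i ∉ S) :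
    psiFin W S β i = 1 := if_neg hi

theorem greenFin_of_notMem (W : Conductances G) {S : Finset V} (β : V → ℝ) {i j : V}
    (h : ¬ (i ∈ S ∧ j ∈ S)) : greenFin W S β i j = 0 := if_neg h

open Classical in
/-- The sum of a weight over all walks is the smallest supersolution of the first step equation. -/
theorem tsum_walk_le (b : V → ℝ≥0∞) (p : V → V → ℝ≥0∞) (f : ∀ i, (Σ j, G.Walk i j) → ℝ≥0∞)
    (hnil : ∀ i, f i ⟨i, .nil⟩ ≤ b i)
    (hcons : ∀ i k (h : G.Adj i k) (σ : Σ j, G.Walk k j),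
      f i ⟨σ.1, .cons h σ.2⟩ ≤ p i k * f k σ)
    (X : V → ℝ≥0∞) (hX : ∀ i, b i + ∑ k ∈ G.neighborFinset i, p i k * X k ≤ X i) (i : V) :
    ∑' σ, f i σ ≤ X i := by
  -- Truncating at length m turns minimality into an induction: a walk of length at most m + 1 is a
  -- step followed by one of length at most m. A finite partial sum only involves bounded lengths.
  have key : ∀ m i, ∑' σ, (if σ.2.length ≤ m then f i σ else 0) ≤ X i := by
    intro m
    induction m with
    | zero =>
      intro i
      rw [tsum_walk_firstStep]
      refine le_trans ?_ (hX i)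
      simp only [SimpleGraph.Walk.length_nil, le_refl, if_true]
      refine add_le_add (hnil i) (le_of_eq_of_le (Finset.sum_eq_zero fun k _ => ?_) zero_le)
      refine ENNReal.tsum_eq_zero.2 fun σ => if_neg ?_
      rw [SimpleGraph.Walk.length_cons]
      omega
    | succ m ih =>
      intro i
      rw [tsum_walk_firstStep]
      refine le_trans ?_ (hX i)
      simp only [SimpleGraph.Walk.length_nil, zero_le, if_true]
      refine add_le_add (hnil i) ?_
      rw [← sum_neighborSet]
      refine Finset.sum_le_sum fun k _ => ?_
      refine le_trans ?_ (mul_le_mul_right (ih k) (p i k))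
      rw [← ENNReal.tsum_mul_left]
      refine ENNReal.tsum_le_tsum fun σ => ?_
      rw [SimpleGraph.Walk.length_cons]
      by_cases hm : σ.2.length ≤ m
      · rw [if_pos hm, if_pos (by omega)]
        exact hcons i k k.2 σ
      · rw [if_neg hm, if_neg (by omega)]
        exact zero_le
  rw [ENNReal.tsum_eq_iSup_sum]
  refine iSup_le fun F => ?_
  obtain ⟨m, hm⟩ : ∃ m, ∀ σ ∈ F, σ.2.length ≤ m :=
    ⟨F.sup fun σ => σ.2.length, fun σ hσ => Finset.le_sup (f := fun σ => σ.2.length) hσ⟩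
  calc ∑ σ ∈ F, f i σ = ∑ σ ∈ F, (if σ.2.length ≤ m then f i σ else 0) :=
        Finset.sum_congr rfl fun σ hσ => (if_pos (hm σ hσ)).symm
    _ ≤ ∑' σ, (if σ.2.length ≤ m then f i σ else 0) := ENNReal.sum_le_tsum F
    _ ≤ X i := key m i

/-- The rates are switched off outside S, so the supersolution inequality is needed only in S and
nothing is asked of X elsewhere. -/
theorem greenFin_le_of_supersolution (W : Conductances G) (S : Finset V) {β : V → ℝ}
    (hβ : ∀ i, 0 < β i) (j : V) (X : V → ℝ≥0∞)
    (hX : ∀ i ∈ S, (open Classical in if i = j then ENNReal.ofReal (1 / (2 * β i)) else 0) +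
      ∑ k ∈ G.neighborFinset i, ENNReal.ofReal (W.weight i k / (2 * β i)) * X k ≤ X i) (i : V) :
    greenFin W S β i j ≤ X i := by
  classical
  rw [greenFin_eq_tsum]
  refine tsum_walk_le (fun i => if i ∈ S then
      (if i = j then ENNReal.ofReal (1 / (2 * β i)) else 0) else 0)
    (fun i k => if i ∈ S then ENNReal.ofReal (W.weight i k / (2 * β i)) else 0)
    (fun i σ => greenTerm W S β j σ) ?_ ?_ X ?_ i
  · intro i
    by_cases hi : i ∈ S
    · rw [if_pos hi, greenTerm_nil W S β i j hi]
    · simp [greenTerm, hi]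
  · intro i k h σ
    by_cases hi : i ∈ S
    · simp only [if_pos hi]
      exact (greenTerm_cons W S hβ hi h σ).le
    · simp [greenTerm, hi]
  · intro i
    by_cases hi : i ∈ S
    · simpa only [if_pos hi] using (hX i hi)
    · simp [hi]

theorem greenFin_mono (W : Conductances G) {S S' : Finset V} (h : S ⊆ S') (β : V → ℝ) (i j : V) :
    greenFin W S β i j ≤ greenFin W S' β i j := by
  classical
  rw [greenFin_eq_tsum, greenFin_eq_tsum]
  refine ENNReal.tsum_le_tsum fun σ => ?_
  rw [greenTerm, greenTerm]
  split_ifs with h1 h2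
  · exact le_rfl
  · exact absurd ⟨h1.1, fun v hv => h (h1.2 v hv)⟩ h2
  · exact zero_le
  · exact le_rfl

theorem psiFin_le_of_supersolution (W : Conductances G) (S : Finset V) {β : V → ℝ}
    (hβ : ∀ i, 0 < β i) (X : V → ℝ≥0∞) (h1 : ∀ i ∉ S, 1 ≤ X i)
    (hX : ∀ i ∈ S,
      ∑ k ∈ G.neighborFinset i, ENNReal.ofReal (W.weight i k / (2 * β i)) * X k ≤ X i) (i : V) :
    psiFin W S β i ≤ X i := by
  classical
  rw [psiFin_eq_tsum]
  refine tsum_walk_le (fun i => if i ∈ S then 0 else 1)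
    (fun i k => if i ∈ S then ENNReal.ofReal (W.weight i k / (2 * β i)) else 0)
    (fun i σ => psiTerm W S β σ) ?_ ?_ X ?_ i
  · intro i
    by_cases hi : i ∈ S
    · rw [if_pos hi, psiTerm_nil W S β i hi]
    · simp [psiTerm, hi, walkWeight, walkPotentialInit]
  · intro i k h σ
    by_cases hi : i ∈ S
    · simp only [if_pos hi]
      exact (psiTerm_cons W S hβ hi h σ).le
    · simp [psiTerm, hi, List.dropLast_cons_of_ne_nil σ.2.support_ne_nil]
  · intro i
    by_cases hi : i ∈ S
    · simpa only [if_pos hi, zero_add] using (hX i hi)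
    · simpa [hi] using h1 i hi

end Walks

/-! ### Green functions of finite sets as inverse matrices -/

section GreenFunction
set_option linter.unusedSectionVars false
variable {V : Type*} {G : SimpleGraph V} [G.LocallyFinite]

theorem sum_neighborFinset_eq_of_support (W : Conductances G) (S : Finset V) {E : Type*}
    [AddCommGroup E] [Module ℝ E] (f : V → E) (i : V) (hf : ∀ k ∉ S, f k = 0) :
    ∑ k ∈ G.neighborFinset i, W.weight i k • f k = ∑ k ∈ S, W.weight i k • f k := by
  classical
  rw [← Finset.sum_subset (s₁ := G.neighborFinset i ∩ S) Finset.inter_subset_left,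
    ← Finset.sum_subset (s₁ := G.neighborFinset i ∩ S) Finset.inter_subset_right]
  · intro k hk hk'
    rw [W.weight_of_not_adj, zero_smul]
    exact fun h => hk' (Finset.mem_inter.2 ⟨(G.mem_neighborFinset i k).2 h, hk⟩)
  · intro k hk hk'
    rw [hf, smul_zero]
    exact fun h => hk' (Finset.mem_inter.2 ⟨hk, h⟩)

open Classical in
/-- The total conductance between `i` and the complement of `S`. -/
def boundaryWeight (W : Conductances G) (S : Finset V) (i : V) : ℝ :=
  ∑ k ∈ G.neighborFinset i with k ∉ S, W.weight i k

theorem boundaryWeight_nonneg (W : Conductances G) (S : Finset V) (i : V) :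
    0 ≤ boundaryWeight W S i :=
  Finset.sum_nonneg fun _ _ => W.weight_nonneg _ _

theorem boundaryWeight_pos (W : Conductances G) {S : Finset V} {i k : V} (h : G.Adj i k)
    (hk : k ∉ S) : 0 < boundaryWeight W S i := by
  classical
  exact Finset.sum_pos' (fun _ _ => W.weight_nonneg _ _)
    ⟨k, Finset.mem_filter.2 ⟨(G.mem_neighborFinset i k).2 h, hk⟩, W.weight_pos h⟩

open Classical in
theorem sum_neighborFinset_split (W : Conductances G) (S : Finset V) {E : Type*}
    [AddCommGroup E] [Module ℝ E] (f : V → E) (i : V) :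
    ∑ k ∈ G.neighborFinset i, W.weight i k • f k = ∑ k ∈ S, W.weight i k • f k +
      ∑ k ∈ G.neighborFinset i with k ∉ S, W.weight i k • f k := by
  have h := sum_neighborFinset_eq_of_support W S (fun k => if k ∈ S then f k else 0) i
    fun k hk => if_neg hk
  rw [← Finset.sum_filter_add_sum_filter_not (G.neighborFinset i) (· ∈ S)]
  congr 1
  rw [Finset.sum_filter]
  simp only [smul_ite, smul_zero] at h
  rw [h]
  exact Finset.sum_congr rfl fun k hk => if_pos hk

/-- `g`, extended by `0`, is the inverse of the restriction of `H_β` to `S`, and its entries are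
nonnegative. -/
structure IsGreen (W : Conductances G) (S : Finset V) (β : V → ℝ) (g : V → V → ℝ) : Prop where
  nonneg : ∀ i j, 0 ≤ g i j
  support : ∀ i j, ¬ (i ∈ S ∧ j ∈ S) → g i j = 0
  eqn : ∀ i ∈ S, ∀ j ∈ S, 2 * β i * g i j - ∑ k ∈ S, W.weight i k * g k j =
    open Classical in if i = j then 1 else 0

variable {W : Conductances G} {S : Finset V} {β : V → ℝ} {g g' : V → V → ℝ}

/-- Green's representation: by symmetry of the conductances the restricted operator moves from u to
the column of g at i, where it gives the unit mass at i. Vector values allow its use for real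
functions and for complex elements of ℓ². -/
theorem IsGreen.sum_smul (h : IsGreen W S β g) {E : Type*} [AddCommGroup E] [Module ℝ E]
    (u : V → E) {i : V} (hi : i ∈ S) :
    ∑ k ∈ S, g k i • ((2 * β k) • u k - ∑ l ∈ S, W.weight k l • u l) = u i := by
  classical
  have h1 : ∑ k ∈ S, g k i • ∑ l ∈ S, W.weight k l • u l =
      ∑ l ∈ S, (∑ k ∈ S, W.weight l k * g k i) • u l := by
    simp_rw [Finset.smul_sum, Finset.sum_smul]
    rw [Finset.sum_comm]
    refine Finset.sum_congr rfl fun l _ => Finset.sum_congr rfl fun k _ => ?_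
    rw [smul_smul, W.weight_symm l k, mul_comm]
  simp_rw [smul_sub]
  rw [Finset.sum_sub_distrib, h1, ← Finset.sum_sub_distrib]
  calc _ = ∑ k ∈ S, (if k = i then (1 : ℝ) else 0) • u k := by
        refine Finset.sum_congr rfl fun k hk => ?_
        have := h.eqn k hk i hi
        rw [smul_smul, ← sub_smul, mul_comm (g k i), this]
    _ = u i := by simp [hi]

theorem IsGreen.eq_zero (h : IsGreen W S β g) {u : V → ℝ}
    (hu : ∀ i ∈ S, 2 * β i * u i - ∑ k ∈ S, W.weight i k * u k = 0) {i : V} (hi : i ∈ S) :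
    u i = 0 := by
  have h1 := h.sum_smul u hi
  simp only [smul_eq_mul] at h1
  rw [← h1]
  exact Finset.sum_eq_zero fun k hk => by rw [hu k hk, mul_zero]

theorem IsGreen.symm (h : IsGreen W S β g) (i j : V) : g i j = g j i := by
  classical
  by_cases hij : i ∈ S ∧ j ∈ S
  · have h1 := h.sum_smul (fun k => g k j) hij.1
    simp only [smul_eq_mul] at h1
    rw [← h1]
    rw [Finset.sum_congr rfl fun k hk => by rw [h.eqn k hk j hij.2]]
    simp [hij.2]
  · rw [h.support i j hij, h.support j i fun h' => hij h'.symm]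

theorem IsGreen.unique (h : IsGreen W S β g) (h' : IsGreen W S β g') (i j : V) :
    g i j = g' i j := by
  by_cases hij : i ∈ S ∧ j ∈ S
  · refine sub_eq_zero.1 (h.eq_zero (u := fun k => g k j - g' k j) (fun k hk => ?_) hij.1)
    simp only [mul_sub, Finset.sum_sub_distrib]
    linear_combination h.eqn k hk j hij.2 - h'.eqn k hk j hij.2
  · rw [h.support i j hij, h'.support i j hij]

theorem IsGreen.empty : IsGreen W ∅ β (fun _ _ => 0) :=
  ⟨fun _ _ => le_rfl, fun _ _ _ => rfl, fun i hi => absurd hi (Finset.notMem_empty i)⟩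

theorem ofReal_weight_div_mul (hβ : ∀ i, 0 < β i) (i k : V) (x : ℝ) :
    ENNReal.ofReal (W.weight i k / (2 * β i)) * ENNReal.ofReal x =
      ENNReal.ofReal (W.weight i k * x / (2 * β i)) := by
  rw [← ENNReal.ofReal_mul (div_nonneg (W.weight_nonneg _ _) (by linarith [hβ i]))]
  congr 1
  ring

theorem sum_ofReal_weight_div_mul (hβ : ∀ i, 0 < β i) (i : V) {f : V → ℝ} (hf : ∀ k, 0 ≤ f k) :
    ∑ k ∈ G.neighborFinset i, ENNReal.ofReal (W.weight i k / (2 * β i)) * ENNReal.ofReal (f k) =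
      ENNReal.ofReal ((∑ k ∈ G.neighborFinset i, W.weight i k * f k) / (2 * β i)) := by
  simp_rw [ofReal_weight_div_mul hβ]
  rw [← ENNReal.ofReal_sum_of_nonneg, Finset.sum_div]
  exact fun k _ => div_nonneg (mul_nonneg (W.weight_nonneg _ _) (hf k)) (by linarith [hβ i])

theorem greenFin_toReal_eqn (hβ : ∀ i, 0 < β i) (j : V)
    (hfin : ∀ i, greenFin W S β i j ≠ ∞) {i : V} (hi : i ∈ S) :
    2 * β i * (greenFin W S β i j).toReal - ∑ k ∈ S, W.weight i k * (greenFin W S β k j).toReal =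
      open Classical in if i = j then 1 else 0 := by
  classical
  have h1 := greenFin_firstStep W S hβ hi j
  have h2 : ∑ k ∈ G.neighborFinset i,
      ENNReal.ofReal (W.weight i k / (2 * β i)) * greenFin W S β k j =
      ENNReal.ofReal ((∑ k ∈ S, W.weight i k * (greenFin W S β k j).toReal) / (2 * β i)) := by
    have h3 := sum_neighborFinset_eq_of_support W S (fun k => (greenFin W S β k j).toReal) i
      fun k hk => by simp [greenFin_of_notMem W β fun h' => hk h'.1]
    simp only [smul_eq_mul] at h3
    rw [← h3, ← sum_ofReal_weight_div_mul hβ _ fun _ => ENNReal.toReal_nonneg]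
    simp_rw [ENNReal.ofReal_toReal (hfin _)]
  rw [h2] at h1
  have hb := hβ i
  have h4 : 0 ≤ (∑ k ∈ S, W.weight i k * (greenFin W S β k j).toReal) / (2 * β i) :=
    div_nonneg (Finset.sum_nonneg fun k _ =>
      mul_nonneg (W.weight_nonneg _ _) ENNReal.toReal_nonneg) (by linarith)
  have h5 : (greenFin W S β i j).toReal = (if i = j then 1 / (2 * β i) else 0) +
      (∑ k ∈ S, W.weight i k * (greenFin W S β k j).toReal) / (2 * β i) := by
    rw [h1, ENNReal.toReal_add _ ENNReal.ofReal_ne_top, ENNReal.toReal_ofReal h4]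
    · congr 1
      split_ifs
      · exact ENNReal.toReal_ofReal (by positivity)
      · rfl
    · split_ifs <;> simp
  rw [h5]
  split_ifs <;> field_simp <;> ring

theorem isGreen_toReal_greenFin (hβ : ∀ i, 0 < β i) (hfin : ∀ i j, greenFin W S β i j ≠ ∞) :
    IsGreen W S β fun i j => (greenFin W S β i j).toReal where
  nonneg _ _ := ENNReal.toReal_nonneg
  support i j h := by rw [greenFin_of_notMem W β h]; rfl
  eqn i hi j _ := greenFin_toReal_eqn hβ j (fun i => hfin i j) hi

/-- An inverse with nonnegative entries is a supersolution, so it dominates the walk sum. The walk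
sum is therefore finite, hence itself such an inverse, and inverses are unique. In particular
finiteness of `greenFin` is a conclusion here. -/
theorem IsGreen.greenFin_eq (h : IsGreen W S β g) (hβ : ∀ i, 0 < β i) (i j : V) :
    greenFin W S β i j = ENNReal.ofReal (g i j) := by
  classical
  have hle : ∀ i j, greenFin W S β i j ≤ ENNReal.ofReal (g i j) := by
    intro i j
    by_cases hj : j ∈ S
    · refine greenFin_le_of_supersolution W S hβ j (fun i => ENNReal.ofReal (g i j)) ?_ i
      intro i hi
      have h3 := sum_neighborFinset_eq_of_support W S (fun k => g k j) i
        fun k hk => h.support k j fun h' => hk h'.1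
      simp only [smul_eq_mul] at h3
      rw [sum_ofReal_weight_div_mul hβ i fun k => h.nonneg k j, h3]
      have h4 := h.eqn i hi j hj
      have hb := hβ i
      have h5 : 0 ≤ (∑ k ∈ S, W.weight i k * g k j) / (2 * β i) :=
        div_nonneg (Finset.sum_nonneg fun k _ => mul_nonneg (W.weight_nonneg _ _) (h.nonneg k j))
          (by linarith)
      have h6 : g i j = (if i = j then 1 / (2 * β i) else 0) +
          (∑ k ∈ S, W.weight i k * g k j) / (2 * β i) := by
        have : ∑ k ∈ S, W.weight i k * g k j = 2 * β i * g i j - if i = j then 1 else 0 := by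
          rw [← h4]; ring
        rw [this]
        split_ifs <;> field_simp <;> ring
      rw [h6]
      split_ifs
      · rw [ENNReal.ofReal_add (by positivity) h5]
      · simp
    · rw [greenFin_of_notMem W β fun h' => hj h'.2]
      exact zero_le
  have hfin : ∀ i j, greenFin W S β i j ≠ ∞ := fun i j =>
    ne_top_of_le_ne_top ENNReal.ofReal_ne_top (hle i j)
  rw [← h.unique (isGreen_toReal_greenFin hβ hfin) i j |>.symm, ENNReal.ofReal_toReal (hfin i j)]

open Classical in
/-- The function which is harmonic in `S` and equal to `1` outside `S`, in terms of the Green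
function of `S`. -/
def psiOf (W : Conductances G) (S : Finset V) (g : V → V → ℝ) (i : V) : ℝ :=
  if i ∈ S then ∑ j ∈ S, g i j * boundaryWeight W S j else 1

theorem IsGreen.psiOf_nonneg (h : IsGreen W S β g) (i : V) : 0 ≤ psiOf W S g i := by
  rw [psiOf]
  split_ifs
  · exact Finset.sum_nonneg fun j _ => mul_nonneg (h.nonneg i j) (boundaryWeight_nonneg W S j)
  · exact zero_le_one

theorem sum_weight_eq_of_eq_one (W : Conductances G) (S : Finset V) (f : V → ℝ) (i : V)
    (hf : ∀ k ∉ S, f k = 1) :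
    ∑ k ∈ G.neighborFinset i, W.weight i k * f k =
      ∑ k ∈ S, W.weight i k * f k + boundaryWeight W S i := by
  classical
  have h := sum_neighborFinset_split W S f i
  simp only [smul_eq_mul] at h
  rw [h, boundaryWeight]
  congr 1
  exact Finset.sum_congr rfl fun k hk => by rw [hf k (Finset.mem_filter.1 hk).2, mul_one]

theorem IsGreen.psiOf_eqn (h : IsGreen W S β g) {i : V} (hi : i ∈ S) :
    2 * β i * psiOf W S g i - ∑ k ∈ S, W.weight i k * psiOf W S g k = boundaryWeight W S i := by
  classical
  have h1 : ∀ k ∈ S, psiOf W S g k = ∑ j ∈ S, g k j * boundaryWeight W S j :=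
    fun k hk => if_pos hk
  have h2 : ∑ k ∈ S, W.weight i k * psiOf W S g k =
      ∑ k ∈ S, W.weight i k * ∑ j ∈ S, g k j * boundaryWeight W S j :=
    Finset.sum_congr rfl fun k hk => by rw [h1 k hk]
  rw [h1 i hi, h2]
  simp_rw [Finset.mul_sum]
  rw [Finset.sum_comm, ← Finset.sum_sub_distrib]
  calc _ = ∑ j ∈ S, (if i = j then 1 else 0) * boundaryWeight W S j := by
        refine Finset.sum_congr rfl fun j hj => ?_
        rw [← h.eqn i hi j hj, sub_mul, Finset.sum_mul]
        congr 1
        · ring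
        · exact Finset.sum_congr rfl fun k _ => by ring
    _ = boundaryWeight W S i := by simp [hi]

/-- Same scheme as for the Green function: domination by minimality, then uniqueness of the solution
of the Dirichlet problem with value 1 outside S. -/
theorem IsGreen.psiFin_eq (h : IsGreen W S β g) (hβ : ∀ i, 0 < β i) (i : V) :
    psiFin W S β i = ENNReal.ofReal (psiOf W S g i) := by
  classical
  have hoff : ∀ k ∉ S, psiOf W S g k = 1 := fun k hk => if_neg hk
  have hle : ∀ i, psiFin W S β i ≤ ENNReal.ofReal (psiOf W S g i) := by
    refine psiFin_le_of_supersolution W S hβ _ (fun k hk => by simp [hoff k hk]) fun i hi => ?_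
    rw [sum_ofReal_weight_div_mul hβ i h.psiOf_nonneg, sum_weight_eq_of_eq_one W S _ i hoff]
    refine ENNReal.ofReal_le_ofReal (le_of_eq ?_)
    have hb := hβ i
    rw [div_eq_iff (by positivity), ← h.psiOf_eqn hi]
    ring
  have hfin : ∀ i, psiFin W S β i ≠ ∞ := fun i =>
    ne_top_of_le_ne_top ENNReal.ofReal_ne_top (hle i)
  by_cases hi : i ∈ S
  · have hsol : ∀ k ∈ S, 2 * β k * (psiFin W S β k).toReal -
        ∑ l ∈ S, W.weight k l * (psiFin W S β l).toReal = boundaryWeight W S k := by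
      intro k hk
      have h1 := psiFin_firstStep W S hβ hk
      have h2 := sum_ofReal_weight_div_mul (W := W) hβ k
        (f := fun l => (psiFin W S β l).toReal) fun _ => ENNReal.toReal_nonneg
      simp_rw [ENNReal.ofReal_toReal (hfin _)] at h2
      rw [h2, sum_weight_eq_of_eq_one W S _ k fun l hl => by simp [psiFin_of_notMem W β hl]] at h1
      have hb := hβ k
      have h3 : 0 ≤ (∑ l ∈ S, W.weight k l * (psiFin W S β l).toReal + boundaryWeight W S k) /
          (2 * β k) :=
        div_nonneg (add_nonneg (Finset.sum_nonneg fun k _ =>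
          mul_nonneg (W.weight_nonneg _ _) ENNReal.toReal_nonneg) (boundaryWeight_nonneg W S k))
          (by linarith)
      have h4 := congrArg ENNReal.toReal h1
      rw [ENNReal.toReal_ofReal h3, eq_div_iff (by positivity)] at h4
      linarith
    have h0 := h.eq_zero (u := fun k => (psiFin W S β k).toReal - psiOf W S g k)
      (fun k hk => by
        simp only [mul_sub, Finset.sum_sub_distrib]
        linear_combination hsol k hk - h.psiOf_eqn hk) hi
    rw [← sub_eq_zero.1 h0, ENNReal.ofReal_toReal (hfin i)]
  · rw [psiFin_of_notMem W β hi, hoff i hi, ENNReal.ofReal_one]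

open Classical in
/-- The column that is added to the Green function of `S` when `i` is added to `S`. -/
def schurColumn (W : Conductances G) (S : Finset V) (g : V → V → ℝ) (i a : V) : ℝ :=
  (if a = i then 1 else 0) + ∑ k ∈ S, g a k * W.weight k i

/-- The Schur complement of `S` in `S ∪ {i}`. -/
def schurComplement (W : Conductances G) (S : Finset V) (β : V → ℝ) (g : V → V → ℝ) (i : V) : ℝ :=
  2 * β i - ∑ j ∈ S, ∑ k ∈ S, g j k * W.weight j i * W.weight k i

open Classical in
-- Inversion by blocks. The column e equals 1 at i and extends into S so that H e is supported at i,
-- where it equals the Schur complement Y; the new inverse is the old one plus the rank-one term e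
-- eᵀ / Y. Its entries are nonnegative because those of g, e and Y are.
theorem IsGreen.insert_vertex (h : IsGreen W S β g) {i : V} (hi : i ∉ S)
    (hY : 0 < schurComplement W S β g i) :
    IsGreen W (insert i S) β fun a b =>
      g a b + schurColumn W S g i a * schurColumn W S g i b / schurComplement W S β g i := by
  have he : ∀ a, 0 ≤ schurColumn W S g i a := fun a => by
    refine add_nonneg (by split_ifs <;> norm_num) ?_
    exact Finset.sum_nonneg fun k _ => mul_nonneg (h.nonneg _ _) (W.weight_nonneg _ _)
  have hgi : ∀ b, g i b = 0 := fun b => h.support i b fun h' => hi h'.1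
  have hgi' : ∀ b, g b i = 0 := fun b => h.support b i fun h' => hi h'.2
  have hei : schurColumn W S g i i = 1 := by simp [schurColumn, hgi]
  have heS : ∀ a ∈ S, schurColumn W S g i a = ∑ k ∈ S, g a k * W.weight k i := fun a ha => by
    rw [schurColumn, if_neg (fun h' : a = i => hi (h' ▸ ha)), zero_add]
  have hsupp : ∀ a ∉ insert i S, schurColumn W S g i a = 0 := fun a ha => by
    rw [schurColumn, if_neg fun h' : a = i => ha (h' ▸ Finset.mem_insert_self a S), zero_add]
    refine Finset.sum_eq_zero fun k _ => ?_
    rw [h.support a k fun h' => ha (Finset.mem_insert_of_mem h'.1), zero_mul]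
  refine ⟨fun a b => add_nonneg (h.nonneg a b)
    (div_nonneg (mul_nonneg (he a) (he b)) hY.le), fun a b hab => ?_, fun a ha b hb => ?_⟩
  · rw [h.support a b fun h' => hab ⟨Finset.mem_insert_of_mem h'.1, Finset.mem_insert_of_mem h'.2⟩]
    rcases not_and_or.1 hab with h' | h' <;> simp [hsupp _ h']
  · set Y := schurComplement W S β g i with hYdef
    set e := schurColumn W S g i with hedef
    -- `H e` on `insert i S`
    have hHe : 2 * β a * e a - ∑ k ∈ insert i S, W.weight a k * e k = if a = i then Y else 0 := by
      rw [Finset.sum_insert hi, hei]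
      by_cases hai : a = i
      · subst hai
        rw [if_pos rfl, hei, W.weight_self, hYdef, schurComplement]
        rw [Finset.sum_congr rfl fun k hk => by rw [heS k hk, Finset.mul_sum]]
        simp only [zero_add, mul_one]
        congr 1
        refine Finset.sum_congr rfl fun j _ => Finset.sum_congr rfl fun k _ => ?_
        rw [W.weight_symm a j]; ring
      · have haS : a ∈ S := (Finset.mem_insert.1 ha).resolve_left hai
        rw [if_neg hai, heS a haS]
        have h0 : ∑ k ∈ S, W.weight a k * e k =
            ∑ k ∈ S, W.weight a k * ∑ l ∈ S, g k l * W.weight l i :=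
          Finset.sum_congr rfl fun k hk => by rw [heS k hk]
        rw [h0]
        have : ∑ k ∈ S, W.weight a k * ∑ l ∈ S, g k l * W.weight l i =
            ∑ l ∈ S, (∑ k ∈ S, W.weight a k * g k l) * W.weight l i := by
          simp_rw [Finset.mul_sum, Finset.sum_mul]
          rw [Finset.sum_comm]
          exact Finset.sum_congr rfl fun l _ => Finset.sum_congr rfl fun k _ => by ring
        rw [this]
        have h2 : ∑ l ∈ S, (2 * β a * g a l - ∑ k ∈ S, W.weight a k * g k l) * W.weight l i =
            W.weight a i := by
          rw [Finset.sum_congr rfl fun l hl => by rw [h.eqn a haS l hl]]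
          simp [haS]
        simp only [sub_mul, Finset.sum_sub_distrib] at h2
        rw [Finset.mul_sum]
        simp_rw [← mul_assoc]
        linarith
    -- The old kernel fails to be an inverse only in row i, and the rank-one term compensates
    -- exactly that row.
    have hHg : 2 * β a * g a b - ∑ k ∈ insert i S, W.weight a k * g k b =
        (if a = b then 1 else 0) - if a = i then e b else 0 := by
      rw [Finset.sum_insert hi, hgi, mul_zero, zero_add]
      by_cases hai : a = i
      · subst hai
        rw [hgi, if_pos rfl]
        by_cases hab : a = b
        · subst hab
          simp [hgi', hei]
        · have hbS : b ∈ S := (Finset.mem_insert.1 hb).resolve_left (Ne.symm hab)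
          rw [if_neg hab, heS b hbS, mul_zero]
          congr 1
          refine Finset.sum_congr rfl fun k _ => ?_
          rw [h.symm b k, W.weight_symm a k, mul_comm]
      · have haS : a ∈ S := (Finset.mem_insert.1 ha).resolve_left hai
        rw [if_neg hai, sub_zero]
        by_cases hbi : b = i
        · subst hbi
          simp [hgi', hai]
        · rw [h.eqn a haS b ((Finset.mem_insert.1 hb).resolve_left hbi)]
    simp_rw [mul_add, Finset.sum_add_distrib]
    have h3 : ∑ k ∈ insert i S, W.weight a k * (e k * e b / Y) =
        (∑ k ∈ insert i S, W.weight a k * e k) * (e b / Y) := by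
      rw [Finset.sum_mul]
      exact Finset.sum_congr rfl fun k _ => by ring
    have h4 : (if a = i then Y else 0) * (e b / Y) = if a = i then e b else 0 := by
      split_ifs
      · field_simp
      · ring
    rw [h3]
    linear_combination hHg + e b / Y * hHe + h4

/-- A Harnack inequality between neighbouring rows, at the price of one factor 2β. It transports
integrability of the Green function along a path. -/
theorem IsGreen.weight_mul_le (h : IsGreen W S β g) {m n : V} (hm : m ∈ S) (k : V) (hk : k ∈ S) :
    W.weight m n * g n k ≤ 2 * β m * g m k := by
  classical
  by_cases hn : n ∈ S
  · have h1 := h.eqn m hm k hk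
    have h2 : W.weight m n * g n k ≤ ∑ l ∈ S, W.weight m l * g l k :=
      Finset.single_le_sum (f := fun l => W.weight m l * g l k)
        (fun l _ => mul_nonneg (W.weight_nonneg _ _) (h.nonneg _ _)) hn
    have h3 : (0 : ℝ) ≤ if m = k then 1 else 0 := by split_ifs <;> norm_num
    linarith
  · have h1 := h.eqn m hm k hk
    have h2 : 0 ≤ ∑ l ∈ S, W.weight m l * g l k :=
      Finset.sum_nonneg (fun l _ => mul_nonneg (W.weight_nonneg _ _) (h.nonneg _ _))
    have h3 : (0 : ℝ) ≤ if m = k then 1 else 0 := by split_ifs <;> norm_num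
    rw [h.support n k fun h' => hn h'.1]
    linarith

theorem IsGreen.diag_pos (h : IsGreen W S β g) {i : V} (hi : i ∈ S) :
    1 ≤ 2 * β i * g i i := by
  classical
  have h1 := h.eqn i hi i hi
  rw [if_pos rfl] at h1
  have h2 : 0 ≤ ∑ l ∈ S, W.weight i l * g l i :=
    Finset.sum_nonneg (fun l _ => mul_nonneg (W.weight_nonneg _ _) (h.nonneg _ _))
  linarith

/-- The restriction of `H_β` to `S` is positive, as it has a positive supersolution. -/
theorem IsGreen.form_nonneg (h : IsGreen W S β g) (x : V → ℝ) :
    ∑ a ∈ S, ∑ b ∈ S, W.weight a b * (x a * x b) ≤ ∑ a ∈ S, 2 * β a * x a ^ 2 := by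
  classical
  set φ : V → ℝ := fun a => ∑ j ∈ S, g a j with hφ
  have hφ0 : ∀ a, 0 ≤ φ a := fun a => Finset.sum_nonneg fun j _ => h.nonneg a j
  -- φ = G1 solves H φ = 1 on S, so it is a strictly positive supersolution there.
  have hH : ∀ a ∈ S, ∑ b ∈ S, W.weight a b * φ b = 2 * β a * φ a - 1 := by
    intro a ha
    have : ∑ j ∈ S, (2 * β a * g a j - ∑ k ∈ S, W.weight a k * g k j) = 1 := by
      rw [Finset.sum_congr rfl fun j hj => h.eqn a ha j hj]
      simp [ha]
    rw [Finset.sum_sub_distrib, ← Finset.mul_sum, Finset.sum_comm] at this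
    simp_rw [hφ, Finset.mul_sum]
    simp_rw [Finset.mul_sum] at this
    linarith
  have hpos : ∀ a ∈ S, 0 < φ a := by
    intro a ha
    have h1 : 0 ≤ ∑ b ∈ S, W.weight a b * φ b :=
      Finset.sum_nonneg fun b _ => mul_nonneg (W.weight_nonneg _ _) (hφ0 b)
    rw [hH a ha] at h1
    by_contra hcon
    have : φ a = 0 := le_antisymm (not_lt.1 hcon) (hφ0 a)
    rw [this] at h1
    linarith
  -- The product x_a x_b is split by the arithmetic-geometric inequality with weights φ_b/φ_a; the
  -- two halves are exchanged by the symmetry of the double sum.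
  have key : ∀ a ∈ S, ∀ b ∈ S, W.weight a b * (x a * x b) ≤
      (W.weight a b * φ b * (x a ^ 2 / φ a) + W.weight b a * φ a * (x b ^ 2 / φ b)) / 2 := by
    intro a ha b hb
    have h1 := hpos a ha
    have h2 := hpos b hb
    have h3 : x a * x b ≤ (φ b * (x a ^ 2 / φ a) + φ a * (x b ^ 2 / φ b)) / 2 := by
      rw [show (φ b * (x a ^ 2 / φ a) + φ a * (x b ^ 2 / φ b)) / 2 =
        ((φ b * x a) ^ 2 + (φ a * x b) ^ 2) / (2 * (φ a * φ b)) by field_simp,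
        le_div_iff₀ (by positivity)]
      nlinarith [sq_nonneg (φ b * x a - φ a * x b)]
    rw [W.weight_symm b a]
    nlinarith [W.weight_nonneg a b]
  have hsum : ∑ a ∈ S, ∑ b ∈ S, W.weight a b * φ b * (x a ^ 2 / φ a) ≤
      ∑ a ∈ S, 2 * β a * x a ^ 2 := by
    refine Finset.sum_le_sum fun a ha => ?_
    rw [← Finset.sum_mul, hH a ha]
    have h1 := hpos a ha
    rw [sub_mul, one_mul, mul_assoc, mul_div_cancel₀ _ h1.ne']
    have : 0 ≤ x a ^ 2 / φ a := by positivity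
    linarith
  calc _ ≤ ∑ a ∈ S, ∑ b ∈ S, (W.weight a b * φ b * (x a ^ 2 / φ a) +
        W.weight b a * φ a * (x b ^ 2 / φ b)) / 2 :=
        Finset.sum_le_sum fun a ha => Finset.sum_le_sum fun b hb => key a ha b hb
    _ = ∑ a ∈ S, ∑ b ∈ S, W.weight a b * φ b * (x a ^ 2 / φ a) := by
        simp_rw [add_div, Finset.sum_add_distrib]
        rw [Finset.sum_comm (f := fun a b => W.weight b a * φ a * (x b ^ 2 / φ b) / 2)]
        simp_rw [← Finset.sum_add_distrib, add_halves]
    _ ≤ _ := hsum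

end GreenFunction

/-! ### The reciprocal inverse Gaussian integral -/

section Integrals

theorem lintegral_exp_neg_half_sq :
    ∫⁻ v : ℝ, ENNReal.ofReal (Real.exp (-(v ^ 2 / 2))) = ENNReal.ofReal √(2 * Real.pi) := by
  have h := integral_gaussian (1 / 2)
  rw [← ofReal_integral_eq_lintegral_ofReal]
  · rw [show 2 * Real.pi = Real.pi / (1 / 2) by ring, ← h]
    congr 2
    ext v
    congr 1
    ring
  · have := integrable_exp_neg_mul_sq (b := 1 / 2) (by norm_num)
    refine this.congr (ae_of_all _ fun v => ?_)
    dsimp only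
    congr 1
    ring
  · exact ae_of_all _ fun v => (Real.exp_pos _).le

theorem image_sub_div_Ioi {a c : ℝ} (ha : 0 < a) (hc : 0 < c) :
    (fun u : ℝ => a * u - c / u) '' Set.Ioi 0 = Set.univ := by
  refine Set.eq_univ_of_forall fun v => ?_
  set s := √(v ^ 2 + 4 * a * c) with hs
  have hs2 : s ^ 2 = v ^ 2 + 4 * a * c := Real.sq_sqrt (by positivity)
  have hac : 0 < a * c := mul_pos ha hc
  have hvs : 0 < v + s := by
    have : |v| < s := by
      rw [hs]
      apply Real.lt_sqrt_of_sq_lt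
      rw [sq_abs]; linarith
    linarith [neg_abs_le v]
  refine ⟨(v + s) / (2 * a), div_pos hvs (by positivity), ?_⟩
  dsimp only
  field_simp
  nlinarith

theorem injOn_sub_div {a c : ℝ} (ha : 0 < a) (hc : 0 < c) :
    Set.InjOn (fun u : ℝ => a * u - c / u) (Set.Ioi 0) := by
  have : StrictMonoOn (fun u : ℝ => a * u - c / u) (Set.Ioi 0) := by
    intro x hx y hy hxy
    have h1 : a * x < a * y := by gcongr
    have h2 : c / y < c / x := div_lt_div_of_pos_left hc hx hxy
    dsimp only
    linarith
  exact this.injOn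

/-- The Cauchy–Schlömilch substitution: u ↦ c/(au) only changes the sign of au - c/u, while v = au -
c/u, with derivative a + c/u², sends the half line onto the real line and leads to a Gaussian
integral. -/
theorem lintegral_exp_neg_sub_div_sq {a c : ℝ} (ha : 0 < a) (hc : 0 < c) :
    ∫⁻ u in Set.Ioi (0 : ℝ), ENNReal.ofReal (Real.exp (-((a * u - c / u) ^ 2 / 2))) =
      ENNReal.ofReal (√(2 * Real.pi) / (2 * a)) := by
  set E : ℝ → ℝ≥0∞ := fun u => ENNReal.ofReal (Real.exp (-((a * u - c / u) ^ 2 / 2))) with hE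
  have hmE : Measurable E := by
    have : Measurable fun u : ℝ => c / u := measurable_const.div measurable_id
    fun_prop
  have h1 : ∫⁻ u in Set.Ioi (0 : ℝ), E u = ∫⁻ u in Set.Ioi (0 : ℝ),
      ENNReal.ofReal (c / (a * u ^ 2)) * E u := by
    have him : (fun u : ℝ => c / (a * u)) '' Set.Ioi 0 = Set.Ioi 0 := by
      ext x
      constructor
      · rintro ⟨u, hu, rfl⟩
        exact div_pos hc (mul_pos ha hu)
      · intro hx
        have hx' : 0 < x := hx
        refine ⟨c / (a * x), div_pos hc (mul_pos ha hx), ?_⟩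
        dsimp only
        field_simp
    have hinj : Set.InjOn (fun u : ℝ => c / (a * u)) (Set.Ioi 0) := by
      intro x hx y hy hxy
      have hx' : 0 < x := hx
      have hy' : 0 < y := hy
      dsimp only at hxy
      rw [div_eq_div_iff (by positivity) (by positivity)] at hxy
      have : c * a * (y - x) = 0 := by linarith
      have := (mul_eq_zero.1 this).resolve_left (by positivity)
      linarith
    have hder : ∀ u ∈ Set.Ioi (0 : ℝ), HasDerivWithinAt (fun u : ℝ => c / (a * u))
        (-(c / (a * u ^ 2))) (Set.Ioi 0) u := by
      intro u hu
      have hu' : 0 < u := hu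
      have := ((hasDerivAt_inv hu'.ne').const_mul (c / a)).hasDerivWithinAt (s := Set.Ioi 0)
      refine (this.congr_deriv (by field_simp)).congr (fun x hx => ?_) ?_
      · have : 0 < x := hx
        field_simp
      · field_simp
    have := lintegral_image_eq_lintegral_abs_deriv_mul measurableSet_Ioi hder hinj E
    rw [him] at this
    rw [this]
    refine setLIntegral_congr_fun measurableSet_Ioi fun u hu => ?_
    have hu' : 0 < u := hu
    simp only [hE]
    rw [abs_neg, abs_of_pos (by positivity)]
    congr 4
    field_simp
    ring
  have h2 : ∫⁻ u in Set.Ioi (0 : ℝ), ENNReal.ofReal (a + c / u ^ 2) * E u =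
      ENNReal.ofReal √(2 * Real.pi) := by
    have hder : ∀ u ∈ Set.Ioi (0 : ℝ), HasDerivWithinAt (fun u : ℝ => a * u - c / u)
        (a + c / u ^ 2) (Set.Ioi 0) u := by
      intro u hu
      have hu' : 0 < u := hu
      have h1 := ((hasDerivAt_inv hu'.ne').const_mul c)
      have h2 := ((hasDerivAt_id u).const_mul a).sub h1
      refine (h2.congr_deriv (by simp; field_simp)).hasDerivWithinAt.congr (fun x hx => ?_) ?_ <;>
      simp [div_eq_mul_inv]
    have := lintegral_image_eq_lintegral_abs_deriv_mul measurableSet_Ioi hder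
      (injOn_sub_div ha hc) fun v => ENNReal.ofReal (Real.exp (-(v ^ 2 / 2)))
    rw [image_sub_div_Ioi ha hc, setLIntegral_univ, lintegral_exp_neg_half_sq] at this
    rw [this]
    refine setLIntegral_congr_fun measurableSet_Ioi fun u hu => ?_
    have hu' : 0 < u := hu
    rw [abs_of_pos (by positivity)]
  -- One of the two copies of aE is replaced by (c/u²)E through `h1`; the sum is then the integrand
  -- of `h2`.
  have h3 : ENNReal.ofReal (2 * a) * ∫⁻ u in Set.Ioi (0 : ℝ), E u =
      ENNReal.ofReal √(2 * Real.pi) := by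
    rw [two_mul, ENNReal.ofReal_add ha.le ha.le, add_mul, ← h2]
    conv_lhs => rw [h1]
    nth_rewrite 1 [← h1]
    rw [← lintegral_const_mul _ hmE, ← lintegral_const_mul _ (by
      have : Measurable fun u : ℝ => c / (a * u ^ 2) := by
        exact measurable_const.div (by fun_prop)
      exact this.ennreal_ofReal.mul hmE), ← lintegral_add_left (hmE.const_mul _)]
    refine setLIntegral_congr_fun measurableSet_Ioi fun u hu => ?_
    have hu' : 0 < u := hu
    rw [← mul_assoc, ← ENNReal.ofReal_mul (q := c / (a * u ^ 2)) ha.le, ← add_mul, ← ENNReal.ofReal_add ha.le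
      (by positivity)]
    congr 2
    field_simp
  rw [ENNReal.ofReal_div_of_pos (by positivity), ← h3, mul_comm, ENNReal.mul_div_cancel_right]
  · simpa using ha
  · exact ENNReal.ofReal_ne_top

/-- Complete the square: a²u² + c²/u² = (au - |c|/u)² + 2a|c|. For c = 0 the substitution
degenerates and the integral is a half Gaussian. -/
theorem lintegral_exp_neg_sq_add_inv_sq {a : ℝ} (ha : 0 < a) (c : ℝ) :
    ∫⁻ u in Set.Ioi (0 : ℝ), ENNReal.ofReal
      (Real.exp (-(a ^ 2 * u ^ 2 / 2) - c ^ 2 / (2 * u ^ 2))) =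
      ENNReal.ofReal (√(2 * Real.pi) / (2 * a) * Real.exp (-(|c| * a))) := by
  rcases eq_or_ne c 0 with rfl | hc
  · have h1 := integral_gaussian_Ioi (a ^ 2 / 2)
    have h2 := (integrable_exp_neg_mul_sq (b := a ^ 2 / 2) (by positivity)).integrableOn
      (s := Set.Ioi 0)
    have h3 : ∀ u : ℝ, Real.exp (-(a ^ 2 * u ^ 2 / 2) - 0 ^ 2 / (2 * u ^ 2)) =
        Real.exp (-(a ^ 2 / 2) * u ^ 2) := fun u => by
      congr 1
      simp
      ring
    simp_rw [h3]
    rw [← ofReal_integral_eq_lintegral_ofReal h2 (ae_of_all _ fun v => (Real.exp_pos _).le), h1]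
    congr 1
    rw [show Real.pi / (a ^ 2 / 2) = 2 * Real.pi / a ^ 2 by field_simp, Real.sqrt_div (by positivity),
      Real.sqrt_sq ha.le]
    simp
    field_simp
  · have h1 := lintegral_exp_neg_sub_div_sq ha (abs_pos.2 hc)
    rw [mul_comm (√(2 * Real.pi) / (2 * a)), ENNReal.ofReal_mul (Real.exp_pos _).le, ← h1,
      ← lintegral_const_mul']
    · refine setLIntegral_congr_fun measurableSet_Ioi fun u hu => ?_
      have hu' : 0 < u := hu
      rw [← ENNReal.ofReal_mul (Real.exp_pos _).le, ← Real.exp_add]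
      congr 2
      rw [← sq_abs c]
      field_simp
      ring
    · exact ENNReal.ofReal_ne_top

/-- The Laplace transform of the reciprocal inverse Gaussian distribution. -/
theorem lintegral_reciprocalInverseGaussian {a : ℝ} (ha : 0 < a) (c : ℝ) :
    ∫⁻ y in Set.Ioi (0 : ℝ), ENNReal.ofReal
      ((√(2 * Real.pi * y))⁻¹ * Real.exp (-(a ^ 2 * y / 2) - c ^ 2 / (2 * y))) =
      ENNReal.ofReal (Real.exp (-(|c| * a)) / a) := by
  have him : (fun u : ℝ => u ^ 2) '' Set.Ioi 0 = Set.Ioi 0 := by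
    ext x
    constructor
    · rintro ⟨u, hu, rfl⟩
      exact pow_pos (Set.mem_Ioi.1 hu) 2
    · intro hx
      exact ⟨√x, Real.sqrt_pos.2 hx, Real.sq_sqrt (le_of_lt hx)⟩
  have hinj : Set.InjOn (fun u : ℝ => u ^ 2) (Set.Ioi 0) := by
    intro x hx y hy hxy
    exact (pow_left_inj₀ (le_of_lt hx) (le_of_lt hy) two_ne_zero).1 hxy
  have hder : ∀ u ∈ Set.Ioi (0 : ℝ), HasDerivWithinAt (fun u : ℝ => u ^ 2)
      (2 * u) (Set.Ioi 0) u := by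
    intro u _
    simpa using (hasDerivAt_pow 2 u).hasDerivWithinAt
  have := lintegral_image_eq_lintegral_abs_deriv_mul measurableSet_Ioi hder hinj
    fun y => ENNReal.ofReal
      ((√(2 * Real.pi * y))⁻¹ * Real.exp (-(a ^ 2 * y / 2) - c ^ 2 / (2 * y)))
  rw [him] at this
  have hpi : (0 : ℝ) < √(2 * Real.pi) := Real.sqrt_pos.2 (by positivity)
  have h2 : Real.exp (-(|c| * a)) / a = 2 / √(2 * Real.pi) *
      (√(2 * Real.pi) / (2 * a) * Real.exp (-(|c| * a))) := by
    field_simp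
  rw [this, h2, ENNReal.ofReal_mul (by positivity), ← lintegral_exp_neg_sq_add_inv_sq ha c,
    ← lintegral_const_mul' _ _ ENNReal.ofReal_ne_top]
  refine setLIntegral_congr_fun measurableSet_Ioi fun u hu => ?_
  have hu' : 0 < u := hu
  rw [abs_of_pos (by positivity), ← ENNReal.ofReal_mul (by positivity),
    ← ENNReal.ofReal_mul (by positivity)]
  congr 1
  rw [Real.sqrt_mul (by positivity), Real.sqrt_sq hu'.le]
  field_simp

end Integrals

/-! ### Uniqueness of Laplace transforms on the orthant -/

section LaplaceUniqueness

variable {ι : Type*} [Fintype ι]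

/-- The bounded continuous function `x ↦ exp (-∑ l i * x i)` on the nonnegative orthant. -/
def laplaceExp (l : ι → NNReal) : BoundedContinuousFunction (ι → NNReal) ℝ :=
  BoundedContinuousFunction.ofNormedAddCommGroup
    (fun x => Real.exp (-∑ i, (l i : ℝ) * (x i : ℝ))) (by fun_prop) 1 fun x => by
      rw [Real.norm_eq_abs, abs_of_pos (Real.exp_pos _), Real.exp_le_one_iff]
      have : 0 ≤ ∑ i, (l i : ℝ) * (x i : ℝ) := Finset.sum_nonneg fun i _ => by positivity
      linarith

theorem laplaceExp_apply (l : ι → NNReal) (x : ι → NNReal) :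
    laplaceExp l x = Real.exp (-∑ i, (l i : ℝ) * (x i : ℝ)) := rfl

theorem laplaceExp_mul (l m : ι → NNReal) : laplaceExp l * laplaceExp m = laplaceExp (l + m) := by
  ext x
  simp only [BoundedContinuousFunction.coe_mul, Pi.mul_apply, laplaceExp_apply, ← Real.exp_add,
    Pi.add_apply, NNReal.coe_add, add_mul, Finset.sum_add_distrib, neg_add]

/-- Products of exponentials are exponentials, so their span is an algebra; it separates points, and
such an algebra of bounded continuous functions determines a finite measure on a Polish space. The
restriction to the orthant makes the exponentials bounded. -/
theorem ext_of_laplace_nnreal {μ ν : Measure (ι → NNReal)} [IsFiniteMeasure μ] [IsFiniteMeasure ν]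
    (h : ∀ l : ι → NNReal, ∫ x, laplaceExp l x ∂μ = ∫ x, laplaceExp l x ∂ν) : μ = ν := by
  let M : Submonoid (BoundedContinuousFunction (ι → NNReal) ℝ) :=
    { carrier := Set.range laplaceExp
      mul_mem' := by
        rintro _ _ ⟨l, rfl⟩ ⟨m, rfl⟩
        exact ⟨l + m, (laplaceExp_mul l m).symm⟩
      one_mem' := ⟨0, by ext x; simp [laplaceExp_apply]⟩ }
  let A : StarSubalgebra ℝ (BoundedContinuousFunction (ι → NNReal) ℝ) :=
    { Algebra.adjoin ℝ (M : Set (BoundedContinuousFunction (ι → NNReal) ℝ)) with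
      star_mem' := fun {a} ha => by
        have : star a = a := by ext x; simp
        rw [this]; exact ha }
  refine ext_of_forall_mem_subalgebra_integral_eq_of_polish (𝕜 := ℝ) (A := A) ?_ ?_
  · intro x y hxy
    obtain ⟨i, hi⟩ := Function.ne_iff.1 hxy
    classical
    refine ⟨laplaceExp (Pi.single i 1), ?_, ?_⟩
    · refine ⟨(laplaceExp (Pi.single i 1)).toContinuousMap,
        ⟨laplaceExp (Pi.single i 1), Algebra.subset_adjoin ⟨_, rfl⟩, rfl⟩, rfl⟩
    · have key : ∀ z : ι → NNReal, laplaceExp (Pi.single i 1) z = Real.exp (-(z i : ℝ)) := by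
        intro z
        rw [laplaceExp_apply]
        congr 2
        rw [Finset.sum_eq_single i]
        · simp
        · intro j _ hj
          simp [Pi.single_eq_of_ne hj]
        · simp
      rw [key, key]
      intro hcon
      exact hi (by exact_mod_cast neg_injective (Real.exp_injective hcon))
  · intro f hf
    have hf' : f ∈ Submodule.span ℝ (M : Set (BoundedContinuousFunction (ι → NNReal) ℝ)) := by
      have h1 : f ∈ Subalgebra.toSubmodule (Algebra.adjoin ℝ
        (M : Set (BoundedContinuousFunction (ι → NNReal) ℝ))) := hf
      rwa [Algebra.adjoin_eq_span, Submonoid.closure_eq] at h1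
    induction hf' using Submodule.span_induction with
    | mem x hx =>
      obtain ⟨l, rfl⟩ := hx
      exact h l
    | zero => simp
    | add x y _ _ hx hy =>
      simp only [BoundedContinuousFunction.coe_add, Pi.add_apply]
      rw [integral_add (x.integrable _) (y.integrable _),
        integral_add (x.integrable _) (y.integrable _), hx, hy]
      all_goals
        first
        | (rename_i h1 h2
           change _ ∈ Subalgebra.toSubmodule (Algebra.adjoin ℝ
            (M : Set (BoundedContinuousFunction (ι → NNReal) ℝ)))
           rw [Algebra.adjoin_eq_span, Submonoid.closure_eq]
           assumption)
    | smul a x _ hx =>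
      simp only [BoundedContinuousFunction.coe_smul]
      rw [integral_smul, integral_smul, hx]
      change _ ∈ Subalgebra.toSubmodule (Algebra.adjoin ℝ
        (M : Set (BoundedContinuousFunction (ι → NNReal) ℝ)))
      rw [Algebra.adjoin_eq_span, Submonoid.closure_eq]
      assumption

variable {V : Type*}

/-- Two finite measures carried by nonnegative functions have the same image on `U` if they have the
same Laplace transform on `U`. -/
theorem map_restrict_eq_of_laplace {μ ν : Measure (V → ℝ)} [IsFiniteMeasure μ] [IsFiniteMeasure ν]
    (U : Finset V) (hμ : ∀ᵐ β ∂μ, ∀ i ∈ U, 0 ≤ β i) (hν : ∀ᵐ β ∂ν, ∀ i ∈ U, 0 ≤ β i)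
    (h : ∀ l : V → ℝ, (∀ i, 0 ≤ l i) →
      ∫⁻ β, ENNReal.ofReal (Real.exp (-∑ i ∈ U, l i * β i)) ∂μ =
      ∫⁻ β, ENNReal.ofReal (Real.exp (-∑ i ∈ U, l i * β i)) ∂ν) :
    μ.map U.restrict = ν.map U.restrict := by
  classical
  have hmr : Measurable (U.restrict : (V → ℝ) → (U → ℝ)) := Finset.measurable_restrict U
  have hmn : Measurable fun x : U → ℝ => fun i => Real.toNNReal (x i) :=
    measurable_pi_lambda _ fun i => (measurable_pi_apply i).real_toNNReal
  have hmc : Measurable fun x : U → NNReal => fun i => (x i : ℝ) :=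
    measurable_pi_lambda _ fun i => (measurable_pi_apply i).coe_nnreal_real
  -- A measure carried by nonnegative fields is recovered from its image in the orthant, so
  -- uniqueness there suffices.
  have key : ∀ (ρ : Measure (V → ℝ)), (∀ᵐ β ∂ρ, ∀ i ∈ U, 0 ≤ β i) →
      ρ.map U.restrict = ((ρ.map U.restrict).map fun x i => Real.toNNReal (x i)).map
        fun x i => (x i : ℝ) := by
    intro ρ hρ
    rw [Measure.map_map hmc hmn, Measure.map_map (hmc.comp hmn) hmr]
    refine Measure.map_congr ?_
    filter_upwards [hρ] with β hβ
    ext i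
    simp only [Finset.restrict, Function.comp_apply]
    rw [Real.coe_toNNReal _ (hβ i i.2)]
  have key2 : ∀ (ρ : Measure (V → ℝ)), (∀ᵐ β ∂ρ, ∀ i ∈ U, 0 ≤ β i) → ∀ l : U → NNReal,
      ∫ x, laplaceExp l x ∂((ρ.map U.restrict).map fun x i => Real.toNNReal (x i)) =
      (∫⁻ β, ENNReal.ofReal (Real.exp (-∑ i ∈ U,
        (if h : i ∈ U then (l ⟨i, h⟩ : ℝ) else 0) * β i)) ∂ρ).toReal := by
    intro ρ hρ l
    rw [Measure.map_map hmn hmr, integral_map (hmn.comp hmr).aemeasurable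
      (laplaceExp l).continuous.aestronglyMeasurable, integral_eq_lintegral_of_nonneg_ae]
    · congr 1
      refine lintegral_congr_ae ?_
      filter_upwards [hρ] with β hβ
      rw [laplaceExp_apply, ← Finset.sum_coe_sort U]
      congr 3
      refine Finset.sum_congr rfl fun i _ => ?_
      simp only [Function.comp_apply, Finset.restrict]
      rw [Real.coe_toNNReal _ (hβ i i.2), dif_pos i.2]
    · exact ae_of_all _ fun β => (Real.exp_pos _).le
    · exact ((laplaceExp l).continuous.measurable.comp (hmn.comp hmr)).aestronglyMeasurable
  rw [key μ hμ, key ν hν]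
  congr 1
  have : IsFiniteMeasure (μ.map U.restrict) := inferInstance
  refine ext_of_laplace_nnreal fun l => ?_
  rw [key2 μ hμ, key2 ν hν, h]
  intro i
  split_ifs <;> positivity

/-- A measurable function that depends only on the coordinates in `U` has the same integral for
measures with the same image on `U`. -/
theorem lintegral_eq_of_map_restrict_eq {μ ν : Measure (V → ℝ)} {U : Finset V}
    (h : μ.map U.restrict = ν.map U.restrict) {f : (V → ℝ) → ℝ≥0∞} (hf : Measurable f)
    (hdep : ∀ β β' : V → ℝ, (∀ i ∈ U, β i = β' i) → f β = f β') :
    ∫⁻ β, f β ∂μ = ∫⁻ β, f β ∂ν := by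
  classical
  have hm : Measurable fun x : U → ℝ => fun i : V => if h : i ∈ U then x ⟨i, h⟩ else 0 := by
    refine measurable_pi_lambda _ fun i => ?_
    by_cases hi : i ∈ U
    · simp only [hi, dif_pos]
      exact measurable_pi_apply _
    · simp only [hi, dif_neg, not_false_eq_true]
      exact measurable_const
  have h1 : ∀ β : V → ℝ, f β = f (fun i : V => if h : i ∈ U then U.restrict β ⟨i, h⟩ else 0) :=
    fun β => hdep _ _ fun i hi => by simp [hi]
  have h2 : ∀ ρ : Measure (V → ℝ), ∫⁻ β, f β ∂ρ =
      ∫⁻ x, f (fun i : V => if h : i ∈ U then x ⟨i, h⟩ else 0) ∂(ρ.map U.restrict) := by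
    intro ρ
    exact (lintegral_congr fun β => h1 β).trans
      (lintegral_map (hf.comp hm) (Finset.measurable_restrict U)).symm
  rw [h2 μ, h2 ν, h]

end LaplaceUniqueness

/-! ### Exponential functionals of the potential and of its Green function -/

section Tilted
set_option linter.unusedSectionVars false
variable {V : Type*} {G : SimpleGraph V} [G.LocallyFinite] {W : Conductances G}

/-- The Laplace transform of the potential on `S`, in terms of `a i = √(1 + l i)`. -/
def lap (W : Conductances G) (S : Finset V) (a : V → ℝ) : ℝ :=
  Real.exp (-(1 / 2 * ∑ i ∈ S, ∑ j ∈ S, W.weight i j * (a i * a j - 1)) -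
    ∑ i ∈ S, boundaryWeight W S i * (a i - 1)) / ∏ i ∈ S, a i

theorem laplaceFormula_eq_lap (W : Conductances G) (S : Finset V) (l : V → ℝ)
    (hl : ∀ i ∈ S, 0 ≤ l i) : laplaceFormula W S l = lap W S fun i => √(1 + l i) := by
  classical
  rw [laplaceFormula, lap, mul_one_div]
  congr 3
  · congr 2
    refine Finset.sum_congr rfl fun i hi => ?_
    rw [Finset.sum_filter]
    refine Finset.sum_congr rfl fun j _ => ?_
    rw [Real.sqrt_mul (by linarith [hl i hi])]
    split_ifs with h
    · rw [W.weight_of_adj h]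
    · rw [W.weight_of_not_adj h, zero_mul]
  · refine Finset.sum_congr rfl fun i _ => ?_
    rw [boundaryWeight, Finset.sum_mul]
    refine Finset.sum_congr ?_ fun j hj => ?_
    · congr
    · rw [W.weight_of_adj ((G.mem_neighborFinset i j).1 (Finset.mem_filter.1 hj).1)]

theorem boundaryWeight_insert [DecidableEq V] {S : Finset V} {i : V} (hi : i ∉ S) (j : V) :
    boundaryWeight W S j = boundaryWeight W (insert i S) j + W.weight j i := by
  have h1 : W.weight j i = ∑ k ∈ G.neighborFinset j, if k = i then W.weight j k else 0 := by
    rw [Finset.sum_ite_eq']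
    split_ifs with h
    · rfl
    · exact W.weight_of_not_adj fun h' => h ((G.mem_neighborFinset j i).2 h')
  rw [h1]
  simp only [boundaryWeight, Finset.sum_filter]
  rw [← Finset.sum_add_distrib]
  refine Finset.sum_congr rfl fun k _ => ?_
  by_cases hk : k = i
  · subst hk; simp [hi]
  · simp [hk]

/-- When i joins S, its edge to j changes from the boundary term a_j - 1 to the interior term a_i
a_j - 1; the difference is (a_i - 1) a_j. Read backwards, this is the shift of θ by (a_i - 1)W_{·,i}
that drives the induction. -/
theorem lap_insert [DecidableEq V] {S : Finset V} {i : V} (hi : i ∉ S) (a : V → ℝ) :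
    lap W (insert i S) a = lap W S a * (Real.exp (-((a i - 1) * ∑ j ∈ S, W.weight j i * a j) -
      boundaryWeight W (insert i S) i * (a i - 1)) / a i) := by
  rw [lap, lap, div_mul_div_comm, ← Real.exp_add, Finset.prod_insert hi, mul_comm (a i)]
  congr 2
  rw [Finset.sum_insert hi, Finset.sum_insert hi, Finset.sum_insert hi, W.weight_self]
  simp_rw [Finset.sum_insert hi]
  rw [Finset.sum_add_distrib, Finset.sum_congr rfl fun j (_ : j ∈ S) =>
    show W.weight i j * (a i * a j - 1) = W.weight j i * (a j * a i - 1) by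
      rw [W.weight_symm, mul_comm (a i)]]
  rw [Finset.sum_congr rfl fun j (_ : j ∈ S) =>
    show boundaryWeight W S j * (a j - 1) = boundaryWeight W (insert i S) j * (a j - 1) +
      W.weight j i * (a j - 1) by rw [boundaryWeight_insert hi]; ring, Finset.sum_add_distrib]
  have : ∑ j ∈ S, W.weight j i * (a j * a i - 1) =
      (a i - 1) * ∑ j ∈ S, W.weight j i * a j + ∑ j ∈ S, W.weight j i * (a j - 1) := by
    rw [Finset.mul_sum, ← Finset.sum_add_distrib]
    exact Finset.sum_congr rfl fun j _ => by ring
  rw [this]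
  ring

/-- The bilinear form of a kernel on `S`. -/
def bilin (S : Finset V) (g : V → V → ℝ) (x y : V → ℝ) : ℝ :=
  ∑ a ∈ S, ∑ b ∈ S, g a b * x a * y b

theorem bilin_add_left (S : Finset V) (g : V → V → ℝ) (x x' y : V → ℝ) (s : ℝ) :
    bilin S g (fun a => x a + s * x' a) y = bilin S g x y + s * bilin S g x' y := by
  simp only [bilin, Finset.mul_sum, ← Finset.sum_add_distrib]
  exact Finset.sum_congr rfl fun a _ => Finset.sum_congr rfl fun b _ => by ring

theorem bilin_add_right (S : Finset V) (g : V → V → ℝ) (x y y' : V → ℝ) (s : ℝ) :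
    bilin S g x (fun a => y a + s * y' a) = bilin S g x y + s * bilin S g x y' := by
  simp only [bilin, Finset.mul_sum, ← Finset.sum_add_distrib]
  exact Finset.sum_congr rfl fun a _ => Finset.sum_congr rfl fun b _ => by ring

theorem bilin_symm {S : Finset V} {g : V → V → ℝ} (hg : ∀ a b, g a b = g b a) (x y : V → ℝ) :
    bilin S g x y = bilin S g y x := by
  rw [bilin, Finset.sum_comm, bilin]
  exact Finset.sum_congr rfl fun a _ => Finset.sum_congr rfl fun b _ => by rw [hg b a]; ring

theorem bilin_nonneg {S : Finset V} {g : V → V → ℝ} (hg : ∀ a b, 0 ≤ g a b) {x y : V → ℝ}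
    (hx : ∀ a, 0 ≤ x a) (hy : ∀ a, 0 ≤ y a) : 0 ≤ bilin S g x y :=
  Finset.sum_nonneg fun a _ => Finset.sum_nonneg fun b _ =>
    mul_nonneg (mul_nonneg (hg a b) (hx a)) (hy b)

theorem bilin_insert [DecidableEq V] {S : Finset V} {i : V} (hi : i ∉ S) {g : V → V → ℝ}
    (hg : ∀ a b, ¬ (a ∈ S ∧ b ∈ S) → g a b = 0) (e : V → ℝ) (Y : ℝ) (x y : V → ℝ) :
    bilin (insert i S) (fun a b => g a b + e a * e b / Y) x y =
      bilin S g x y + (∑ a ∈ insert i S, e a * x a) * (∑ a ∈ insert i S, e a * y a) / Y := by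
  have h1 : bilin (insert i S) g x y = bilin S g x y := by
    simp only [bilin]
    rw [Finset.sum_insert hi, Finset.sum_eq_zero, zero_add]
    · refine Finset.sum_congr rfl fun a _ => ?_
      rw [Finset.sum_insert hi, hg a i fun h => hi h.2]
      ring
    · intro b _
      rw [hg i b fun h => hi h.1]
      ring
  rw [← h1, Finset.sum_mul_sum, Finset.sum_div, bilin, bilin, ← Finset.sum_add_distrib]
  refine Finset.sum_congr rfl fun a _ => ?_
  rw [Finset.sum_div, ← Finset.sum_add_distrib]
  exact Finset.sum_congr rfl fun b _ => by ring

theorem sum_schurColumn [DecidableEq V] {S : Finset V} {i : V} (hi : i ∉ S) {g : V → V → ℝ}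
    (hg : ∀ a b, ¬ (a ∈ S ∧ b ∈ S) → g a b = 0) (x : V → ℝ) :
    ∑ a ∈ insert i S, schurColumn W S g i a * x a =
      x i + bilin S g x fun k => W.weight k i := by
  rw [Finset.sum_insert hi]
  congr 1
  · rw [schurColumn, if_pos rfl, Finset.sum_eq_zero]
    · ring
    · intro k _
      rw [hg i k fun h => hi h.1, zero_mul]
  · refine Finset.sum_congr rfl fun a ha => ?_
    rw [schurColumn, if_neg fun h : a = i => hi (h ▸ ha), zero_add, Finset.sum_mul]
    exact Finset.sum_congr rfl fun b _ => by ring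

/-- The exponent of the exponential functional of the field and of its Green function. -/
def tiltExponent (W : Conductances G) (S : Finset V) (g : V → V → ℝ) (l θ β : V → ℝ) : ℝ :=
  -∑ i ∈ S, l i * β i - bilin S g θ fun b => boundaryWeight W S b + 1 / 2 * θ b

/-- `g` is a version of the Green function of `S` that depends only on the potential in `S`, and
whose exponential functionals have the expected integrals. -/
structure IsTiltedGreen (W : Conductances G) (ν : Measure (V → ℝ)) (S : Finset V)
    (g : (V → ℝ) → V → V → ℝ) : Prop where
  measurable : ∀ a b, Measurable fun β => g β a b
  local_dep : ∀ β β' : V → ℝ, (∀ i ∈ S, β i = β' i) → g β = g β'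
  isGreen : ∀ᵐ β ∂ν, IsGreen W S β (g β)
  -- For signed θ an absolute value arises at each added vertex and only an inequality survives.
  -- Negative θ is what later controls large values of ψ.
  tilt_le : ∀ l θ : V → ℝ, (∀ i, 0 ≤ l i) →
    ∫⁻ β, ENNReal.ofReal (Real.exp (tiltExponent W S (g β) l θ β)) ∂ν ≤
      ENNReal.ofReal (lap W S (fun i => √(1 + l i)) * Real.exp (-∑ i ∈ S, θ i * √(1 + l i)))
  tilt_eq : ∀ l θ : V → ℝ, (∀ i, 0 ≤ l i) → (∀ i, 0 ≤ θ i) →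
    ∫⁻ β, ENNReal.ofReal (Real.exp (tiltExponent W S (g β) l θ β)) ∂ν =
      ENNReal.ofReal (lap W S (fun i => √(1 + l i)) * Real.exp (-∑ i ∈ S, θ i * √(1 + l i)))

theorem IsPotentialLaw.lintegral_exp {ν : Measure (V → ℝ)} (hν : IsPotentialLaw W ν) (S : Finset V)
    {l : V → ℝ} (hl : ∀ i, 0 ≤ l i) :
    ∫⁻ β, ENNReal.ofReal (Real.exp (-∑ i ∈ S, l i * β i)) ∂ν =
      ENNReal.ofReal (lap W S fun i => √(1 + l i)) := by
  have := hν.isProbabilityMeasure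
  rw [← laplaceFormula_eq_lap W S l fun i _ => hl i, ← hν.laplace S l fun i _ => hl i,
    ofReal_integral_eq_lintegral_ofReal]
  · have hm : Measurable fun β : V → ℝ => Real.exp (-∑ i ∈ S, l i * β i) := by fun_prop
    refine Integrable.of_bound (C := 1) hm.aestronglyMeasurable ?_
    filter_upwards [hν.pos] with β hβ
    rw [Real.norm_eq_abs, abs_of_pos (Real.exp_pos _), Real.exp_le_one_iff]
    have : 0 ≤ ∑ i ∈ S, l i * β i :=
      Finset.sum_nonneg fun i _ => mul_nonneg (hl i) (hβ i).le
    linarith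
  · exact ae_of_all _ fun β => (Real.exp_pos _).le

theorem IsTiltedGreen.empty {ν : Measure (V → ℝ)} [IsProbabilityMeasure ν] :
    IsTiltedGreen W ν ∅ fun _ _ _ => 0 where
  measurable _ _ := measurable_const
  local_dep _ _ _ := rfl
  isGreen := ae_of_all _ fun _ => IsGreen.empty
  tilt_le l θ _ := by simp [tiltExponent, bilin, lap]
  tilt_eq l θ _ _ := by simp [tiltExponent, bilin, lap]

/-- The density of the Schur complement, given the potential in `S`. -/
def schurDensity (c y : ℝ) : ℝ :=
  (√(2 * Real.pi * y))⁻¹ * Real.exp (|c| - y / 2 - c ^ 2 / (2 * y))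

/-- Since c²/2 + t(c + t/2) = (c + t)²/2, the tilt turns the density with parameters (1, c) into an
unnormalised one with parameters (√(1+l), c + t). The integral sees only |c + t|. -/
theorem lintegral_schurDensity_mul_exp {l : ℝ} (hl : 0 ≤ l) {c t : ℝ} (hc : 0 ≤ c) (K : ℝ) :
    ∫⁻ y in Set.Ioi (0 : ℝ), ENNReal.ofReal (schurDensity c y) *
      ENNReal.ofReal (Real.exp (K - l * y / 2 - t * (c + 1 / 2 * t) / y)) =
    ENNReal.ofReal (Real.exp (K + c - |c + t| * √(1 + l)) / √(1 + l)) := by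
  have ha : 0 < √(1 + l) := Real.sqrt_pos.2 (by linarith)
  have h1 : Real.exp (K + c - |c + t| * √(1 + l)) / √(1 + l) =
      Real.exp (K + c) * (Real.exp (-(|c + t| * √(1 + l))) / √(1 + l)) := by
    rw [sub_eq_add_neg, Real.exp_add]; ring
  rw [h1, ENNReal.ofReal_mul (Real.exp_pos _).le, ← lintegral_reciprocalInverseGaussian ha,
    ← lintegral_const_mul' _ _ ENNReal.ofReal_ne_top]
  refine setLIntegral_congr_fun measurableSet_Ioi fun y hy => ?_
  have hy' : 0 < y := hy
  rw [← ENNReal.ofReal_mul (Real.exp_pos _).le, schurDensity,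
    ← ENNReal.ofReal_mul (by positivity), Real.sq_sqrt (by linarith), abs_of_nonneg hc]
  congr 1
  rw [mul_assoc, ← Real.exp_add, mul_left_comm, ← Real.exp_add]
  congr 2
  field_simp
  ring

/-- The algebra of the induction step: once the Schur complement at i is integrated out, the
exponent is that of S with η replaced by η + w and θ by θ + (a - 1)w. The coefficient of ⟨w, Gw⟩
matches because l_i = (a - 1)(a + 1). -/
theorem tilt_step_exponent {S : Finset V} {g : V → V → ℝ} (hg : ∀ a b, g a b = g b a) (η θ w : V → ℝ)
    (ηi θi li a s : ℝ) (ha : a ^ 2 = 1 + li) :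
    (-s - li * (bilin S g w w) / 2 - bilin S g θ (fun b => η b + 1 / 2 * θ b)) +
      (ηi + bilin S g η w) - ((ηi + bilin S g η w) + (θi + bilin S g θ w)) * a =
    (-s - bilin S g (fun b => θ b + (a - 1) * w b) (fun b => (η b + w b) +
      1 / 2 * (θ b + (a - 1) * w b))) + (-(ηi * (a - 1)) - θi * a) := by
  have e1 : bilin S g θ (fun b => η b + 1 / 2 * θ b) =
      bilin S g θ η + 1 / 2 * bilin S g θ θ := bilin_add_right ..
  have e2 : (fun b => (η b + w b) + 1 / 2 * (θ b + (a - 1) * w b)) =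
      fun b => (fun b => η b + 1 / 2 * θ b) b + ((a + 1) / 2) * w b := by
    funext b; ring
  rw [e2, bilin_add_left, bilin_add_right S g θ (fun b => η b + 1 / 2 * θ b) w,
    bilin_add_right S g w (fun b => η b + 1 / 2 * θ b) w, e1, bilin_add_right S g w η θ,
    bilin_symm hg w η, bilin_symm hg w θ, show li = a ^ 2 - 1 by linarith]
  ring

end Tilted

/-! ### Adding a vertex: the conditional law of the Schur complement -/

section Tilted
set_option linter.unusedSectionVars false
variable {V : Type*} {G : SimpleGraph V} [G.LocallyFinite] {W : Conductances G}

section Step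
variable {ν : Measure (V → ℝ)} {S : Finset V} {g : (V → ℝ) → V → V → ℝ}

/-- The sum of a function against the column added to the Green function. -/
def schurSum (W : Conductances G) (S : Finset V) (g : V → V → ℝ) (i : V) (x : V → ℝ) : ℝ :=
  x i + bilin S g x fun k => W.weight k i

open Classical in
/-- The field with the potential at `i` determined by the Schur complement `y`. -/
def schurField (W : Conductances G) (S : Finset V) (g : (V → ℝ) → V → V → ℝ) (i : V)
    (p : (V → ℝ) × ℝ) : V → ℝ :=
  Function.update p.1 i ((bilin S (g p.1) (fun k => W.weight k i) (fun k => W.weight k i) + p.2) / 2)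

open Classical in
/-- The weight of the boundary of `insert i S`. -/
def schurBoundary (W : Conductances G) (S : Finset V) (i : V) : V → ℝ :=
  boundaryWeight W (insert i S)

/-- The law of the potential in `insert i S`, built from the law of the potential in `S`. -/
def schurLaw (W : Conductances G) (ν : Measure (V → ℝ)) (S : Finset V)
    (g : (V → ℝ) → V → V → ℝ) (i : V) : Measure (V → ℝ) :=
  ((ν.prod (volume.restrict (Set.Ioi 0))).withDensity fun p => ENNReal.ofReal
    (schurDensity (schurSum W S (g p.1) i (schurBoundary W S i)) p.2)).map (schurField W S g i)

theorem measurable_bilin (hg : ∀ a b, Measurable fun β => g β a b) (x y : V → ℝ) :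
    Measurable fun β => bilin S (g β) x y := by
  unfold bilin
  exact Finset.measurable_sum _ fun a _ => Finset.measurable_sum _ fun b _ =>
    ((hg a b).mul_const _).mul_const _

theorem measurable_schurField (hg : ∀ a b, Measurable fun β => g β a b) (i : V) :
    Measurable (schurField W S g i) := by
  classical
  refine measurable_pi_lambda _ fun k => ?_
  unfold schurField
  by_cases hk : k = i
  · subst hk
    simp only [Function.update_self]
    exact (((measurable_bilin hg _ _).comp measurable_fst).add measurable_snd).div_const _
  · simp only [Function.update_of_ne hk]
    exact (measurable_pi_apply k).comp measurable_fst

theorem measurable_schurDensity (hg : ∀ a b, Measurable fun β => g β a b) (i : V) :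
    Measurable fun p : (V → ℝ) × ℝ => ENNReal.ofReal
    (schurDensity (schurSum W S (g p.1) i (schurBoundary W S i)) p.2) := by
  have h1 : Measurable fun p : (V → ℝ) × ℝ => schurSum W S (g p.1) i (schurBoundary W S i) :=
    measurable_const.add ((measurable_bilin hg _ _).comp measurable_fst)
  unfold schurDensity
  refine Measurable.ennreal_ofReal ?_
  refine Measurable.mul (by fun_prop) (Real.measurable_exp.comp ?_)
  refine ((h1.abs).sub (by fun_prop)).sub ?_
  exact (h1.pow_const 2).div (by fun_prop)

theorem lintegral_schurLaw [SFinite ν] (hg : ∀ a b, Measurable fun β => g β a b) (i : V)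
    {f : (V → ℝ) → ℝ≥0∞} (hf : Measurable f) :
    ∫⁻ β, f β ∂(schurLaw W ν S g i) = ∫⁻ β, (∫⁻ y in Set.Ioi (0 : ℝ), ENNReal.ofReal
      (schurDensity (schurSum W S (g β) i (schurBoundary W S i)) y) *
        f (schurField W S g i (β, y))) ∂ν := by
  have hd := measurable_schurDensity (W := W) (S := S) hg i
  have hΦ := measurable_schurField (W := W) (S := S) hg i
  rw [schurLaw, lintegral_map hf hΦ]
  refine (lintegral_withDensity_eq_lintegral_mul _ hd (hf.comp hΦ)).trans ?_
  rw [lintegral_prod _ (hd.mul (hf.comp hΦ)).aemeasurable]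
  rfl

open Classical in
/-- The Green function of `insert i S`. -/
def schurGreen (W : Conductances G) (S : Finset V) (g : (V → ℝ) → V → V → ℝ) (i : V) (β : V → ℝ)
    (a b : V) : ℝ :=
  g β a b + schurColumn W S (g β) i a * schurColumn W S (g β) i b / schurComplement W S β (g β) i

theorem schurComplement_eq (β : V → ℝ) (g : V → V → ℝ) (i : V) : schurComplement W S β g i =
    2 * β i - bilin S g (fun k => W.weight k i) fun k => W.weight k i := rfl

theorem IsTiltedGreen.schurField_eq (h : IsTiltedGreen W ν S g) {i : V} (hi : i ∉ S)
    (p : (V → ℝ) × ℝ) : g (schurField W S g i p) = g p.1 := by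
  classical
  refine h.local_dep _ _ fun j hj => ?_
  exact Function.update_of_ne (fun h : j = i => hi (h ▸ hj)) _ _

theorem IsTiltedGreen.schurComplement_schurField (h : IsTiltedGreen W ν S g) {i : V} (hi : i ∉ S)
    (p : (V → ℝ) × ℝ) :
    schurComplement W S (schurField W S g i p) (g (schurField W S g i p)) i = p.2 := by
  classical
  rw [h.schurField_eq hi, schurComplement_eq, schurField, Function.update_self]
  ring

theorem measurable_schurGreen (hg : ∀ a b, Measurable fun β => g β a b) (i a b : V) :
    Measurable fun β => schurGreen W S g i β a b := by
  have hc : ∀ a, Measurable fun β => schurColumn W S (g β) i a := fun a =>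
    measurable_const.add (Finset.measurable_sum _ fun k _ => (hg a k).mul_const _)
  refine (hg a b).add (((hc a).mul (hc b)).div ?_)
  simp_rw [schurComplement_eq]
  exact ((measurable_pi_apply i).const_mul _).sub (measurable_bilin hg _ _)

open Classical in
theorem measurable_tiltExponent (hg : ∀ a b, Measurable fun β => g β a b) (l θ : V → ℝ) :
    Measurable fun β => tiltExponent W S (g β) l θ β :=
  (Finset.measurable_sum _ fun i _ => (measurable_pi_apply i).const_mul _).neg.sub
    (measurable_bilin hg _ _)

theorem schurSum_nonneg {g : V → V → ℝ} (hg : ∀ a b, 0 ≤ g a b) (i : V) {x : V → ℝ}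
    (hx : ∀ a, 0 ≤ x a) : 0 ≤ schurSum W S g i x :=
  add_nonneg (hx i) (bilin_nonneg hg hx fun k => W.weight_nonneg k i)

open Classical in
-- With the potential in S frozen, only the Schur complement y varies. By the rank-one update, the
-- exponent has the form K - l_i y/2 - t(c + t/2)/y, where c and t are the sums of the new column
-- against the boundary weights and against θ.
theorem IsTiltedGreen.inner_integral (h : IsTiltedGreen W ν S g) {i : V} (hi : i ∉ S)
    {l : V → ℝ} (hl : ∀ i, 0 ≤ l i) (θ : V → ℝ) {β : V → ℝ} (hβ : IsGreen W S β (g β)) :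
    ∫⁻ y in Set.Ioi (0 : ℝ), ENNReal.ofReal
      (schurDensity (schurSum W S (g β) i (schurBoundary W S i)) y) * ENNReal.ofReal (Real.exp
        (tiltExponent W (insert i S) (schurGreen W S g i (schurField W S g i (β, y))) l θ
          (schurField W S g i (β, y)))) =
    ENNReal.ofReal (Real.exp (-∑ j ∈ S, l j * β j -
      l i * bilin S (g β) (fun k => W.weight k i) (fun k => W.weight k i) / 2 -
      bilin S (g β) θ (fun b => schurBoundary W S i b + 1 / 2 * θ b) +
      schurSum W S (g β) i (schurBoundary W S i) -
      |schurSum W S (g β) i (schurBoundary W S i) + schurSum W S (g β) i θ| * √(1 + l i)) /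
        √(1 + l i)) := by
  have hc : 0 ≤ schurSum W S (g β) i (schurBoundary W S i) :=
    schurSum_nonneg hβ.nonneg i fun a => boundaryWeight_nonneg W _ a
  rw [← lintegral_schurDensity_mul_exp (hl i) hc]
  refine setLIntegral_congr_fun measurableSet_Ioi fun y hy => ?_
  congr 3
  have h1 : schurGreen W S g i (schurField W S g i (β, y)) = fun a b =>
      g β a b + schurColumn W S (g β) i a * schurColumn W S (g β) i b / y := by
    funext a b
    rw [schurGreen, h.schurComplement_schurField hi, h.schurField_eq hi]
  rw [tiltExponent, h1, bilin_insert hi hβ.support, sum_schurColumn hi hβ.support,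
    sum_schurColumn hi hβ.support, Finset.sum_insert hi]
  have h2 : ∑ j ∈ S, l j * schurField W S g i (β, y) j = ∑ j ∈ S, l j * β j := by
    refine Finset.sum_congr rfl fun j hj => ?_
    rw [schurField, Function.update_of_ne fun h : j = i => hi (h ▸ hj)]
  have h3 : schurField W S g i (β, y) i =
    (bilin S (g β) (fun k => W.weight k i) (fun k => W.weight k i) + y) / 2 := by
    rw [schurField, Function.update_self]
  have h4 : (bilin S (g β) (fun b => boundaryWeight W (insert i S) b + 1 / 2 * θ b) fun k =>
      W.weight k i) = bilin S (g β) (boundaryWeight W (insert i S)) (fun k => W.weight k i) +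
        1 / 2 * bilin S (g β) θ fun k => W.weight k i := bilin_add_left ..
  rw [h2, h3, h4]
  simp only [schurSum, schurBoundary]
  ring

open Classical in
/-- The right-hand side of the tilted identity for `insert i S`. -/
theorem lap_insert_mul {i : V} (hi : i ∉ S) (a θ : V → ℝ) :
    lap W (insert i S) a * Real.exp (-∑ j ∈ insert i S, θ j * a j) =
      Real.exp (-(schurBoundary W S i i * (a i - 1)) - θ i * a i) / a i *
      (lap W S a * Real.exp (-∑ j ∈ S, (θ j + (a i - 1) * W.weight j i) * a j)) := by
  have h : ∀ A X Y Z c T : ℝ, A * (Real.exp X / c) * Real.exp Y = Real.exp Z / c * (A * Real.exp T) ↔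
      A * Real.exp (X + Y) / c = A * Real.exp (Z + T) / c := fun A X Y Z c T => by
    rw [Real.exp_add, Real.exp_add]
    constructor <;> intro h <;> [skip; skip] <;> calc _ = _ := by ring
      _ = _ := h
      _ = _ := by ring
  rw [lap_insert hi, h]
  congr 3
  rw [Finset.sum_insert hi, schurBoundary]
  simp_rw [add_mul, Finset.sum_add_distrib]
  rw [show ∑ j ∈ S, (a i - 1) * W.weight j i * a j = (a i - 1) * ∑ j ∈ S, W.weight j i * a j by
    rw [Finset.mul_sum]; exact Finset.sum_congr rfl fun _ _ => by ring]
  ring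

open Classical in
theorem IsTiltedGreen.exponent_eq {i : V} (hi : i ∉ S)
    {l : V → ℝ} (hl : ∀ i, 0 ≤ l i) (θ : V → ℝ) {β : V → ℝ} (hβ : IsGreen W S β (g β)) :
    -∑ j ∈ S, l j * β j -
      l i * bilin S (g β) (fun k => W.weight k i) (fun k => W.weight k i) / 2 -
      bilin S (g β) θ (fun b => schurBoundary W S i b + 1 / 2 * θ b) +
      schurSum W S (g β) i (schurBoundary W S i) -
      (schurSum W S (g β) i (schurBoundary W S i) + schurSum W S (g β) i θ) * √(1 + l i) =
    tiltExponent W S (g β) l (fun j => θ j + (√(1 + l i) - 1) * W.weight j i) β +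
      (-(schurBoundary W S i i * (√(1 + l i) - 1)) - θ i * √(1 + l i)) := by
  have h1 := tilt_step_exponent (S := S) hβ.symm (schurBoundary W S i) θ (fun k => W.weight k i)
    (schurBoundary W S i i) (θ i) (l i) (√(1 + l i)) (∑ j ∈ S, l j * β j)
    (Real.sq_sqrt (by linarith [hl i]))
  simp only [schurSum]
  rw [h1, tiltExponent]
  congr 3
  funext b
  rw [boundaryWeight_insert hi b]
  rfl

open Classical in
-- The absolute value |c + t| left by the inner integral is bounded below by c + t, after which the
-- hypothesis on S applies to the shifted θ, whatever its sign.
theorem IsTiltedGreen.lintegral_schurLaw_le [IsProbabilityMeasure ν] (h : IsTiltedGreen W ν S g)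
    {i : V} (hi : i ∉ S) {l : V → ℝ} (hl : ∀ i, 0 ≤ l i) (θ : V → ℝ) :
    ∫⁻ β, ENNReal.ofReal (Real.exp (tiltExponent W (insert i S) (schurGreen W S g i β) l θ β))
      ∂(schurLaw W ν S g i) ≤
    ENNReal.ofReal (lap W (insert i S) (fun i => √(1 + l i)) *
      Real.exp (-∑ i ∈ insert i S, θ i * √(1 + l i))) := by
  have hm := measurable_tiltExponent (W := W) (S := insert i S)
    (measurable_schurGreen (W := W) (S := S) h.measurable i) l θ
  rw [lintegral_schurLaw h.measurable i hm.exp.ennreal_ofReal, lap_insert_mul hi,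
    ENNReal.ofReal_mul (by positivity)]
  refine le_trans ?_ (mul_le_mul_right (h.tilt_le l
    (fun j => θ j + (√(1 + l i) - 1) * W.weight j i) hl) _)
  rw [← lintegral_const_mul' _ _ ENNReal.ofReal_ne_top]
  refine lintegral_mono_ae ?_
  filter_upwards [h.isGreen] with β hβ
  rw [h.inner_integral hi hl θ hβ, ← ENNReal.ofReal_mul (by positivity), div_mul_eq_mul_div,
    ← Real.exp_add]
  refine ENNReal.ofReal_le_ofReal ?_
  refine div_le_div_of_nonneg_right (Real.exp_le_exp.2 ?_) (Real.sqrt_nonneg _)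
  rw [add_comm _ (tiltExponent _ _ _ _ _ _), ← IsTiltedGreen.exponent_eq hi hl θ hβ]
  gcongr
  exact le_abs_self _

open Classical in
-- For θ ≥ 0 the quantity c + t is nonnegative, so the absolute value disappears; the shifted θ
-- stays nonnegative because √(1 + l_i) ≥ 1.
theorem IsTiltedGreen.lintegral_schurLaw_eq [IsProbabilityMeasure ν] (h : IsTiltedGreen W ν S g)
    {i : V} (hi : i ∉ S) {l : V → ℝ} (hl : ∀ i, 0 ≤ l i) {θ : V → ℝ} (hθ : ∀ i, 0 ≤ θ i) :
    ∫⁻ β, ENNReal.ofReal (Real.exp (tiltExponent W (insert i S) (schurGreen W S g i β) l θ β))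
      ∂(schurLaw W ν S g i) =
    ENNReal.ofReal (lap W (insert i S) (fun i => √(1 + l i)) *
      Real.exp (-∑ i ∈ insert i S, θ i * √(1 + l i))) := by
  have hm := measurable_tiltExponent (W := W) (S := insert i S)
    (measurable_schurGreen (W := W) (S := S) h.measurable i) l θ
  have ha : 1 ≤ √(1 + l i) := Real.one_le_sqrt.2 (by linarith [hl i])
  rw [lintegral_schurLaw h.measurable i hm.exp.ennreal_ofReal, lap_insert_mul hi,
    ENNReal.ofReal_mul (by positivity), ← h.tilt_eq l
    (fun j => θ j + (√(1 + l i) - 1) * W.weight j i) hl fun j => add_nonneg (hθ j)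
      (mul_nonneg (by linarith) (W.weight_nonneg _ _)),
    ← lintegral_const_mul' _ _ ENNReal.ofReal_ne_top]
  refine lintegral_congr_ae ?_
  filter_upwards [h.isGreen] with β hβ
  rw [h.inner_integral hi hl θ hβ, ← ENNReal.ofReal_mul (by positivity), div_mul_eq_mul_div,
    ← Real.exp_add, add_comm _ (tiltExponent _ _ _ _ _ _), ← IsTiltedGreen.exponent_eq hi hl θ hβ,
    abs_of_nonneg]
  exact add_nonneg (schurSum_nonneg hβ.nonneg i fun a => boundaryWeight_nonneg W _ a)
    (schurSum_nonneg hβ.nonneg i hθ)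

open Classical in
theorem tiltExponent_zero (S : Finset V) (g : V → V → ℝ) (l β : V → ℝ) :
    tiltExponent W S g l (fun _ => 0) β = -∑ i ∈ S, l i * β i := by
  simp [tiltExponent, bilin]

open Classical in
-- At θ = 0 the tilted identity is the Laplace transform of the constructed law, and it coincides
-- with that of ν. Nonnegativity of the new coordinate comes from nonnegativity of the bilinear form
-- and of y.
theorem IsTiltedGreen.map_schurLaw (hν : IsPotentialLaw W ν) (h : IsTiltedGreen W ν S g)
    {i : V} (hi : i ∉ S) :
    (schurLaw W ν S g i).map (insert i S).restrict = ν.map (insert i S).restrict := by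
  have := hν.isProbabilityMeasure
  have hL : ∀ l : V → ℝ, (∀ i, 0 ≤ l i) → ∫⁻ β, ENNReal.ofReal
      (Real.exp (-∑ j ∈ insert i S, l j * β j)) ∂(schurLaw W ν S g i) =
      ENNReal.ofReal (lap W (insert i S) fun i => √(1 + l i)) := by
    intro l hl
    have := h.lintegral_schurLaw_eq hi hl (θ := fun _ => 0) fun _ => le_rfl
    simp_rw [tiltExponent_zero] at this
    simpa using this
  have hfin : IsFiniteMeasure (schurLaw W ν S g i) := by
    have h0 := hL (fun _ => 0) fun _ => le_rfl
    simp only [zero_mul, Finset.sum_const_zero, neg_zero, Real.exp_zero, ENNReal.ofReal_one,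
      lintegral_one] at h0
    exact ⟨by rw [h0]; exact ENNReal.ofReal_lt_top⟩
  refine map_restrict_eq_of_laplace _ ?_ ?_ fun l hl => ?_
  · have hms : MeasurableSet {β : V → ℝ | ¬ ∀ j ∈ insert i S, 0 ≤ β j} := by
      have : {β : V → ℝ | ¬ ∀ j ∈ insert i S, 0 ≤ β j} =
          (⋂ j ∈ insert i S, {β : V → ℝ | 0 ≤ β j})ᶜ := by
        ext; simp
      rw [this]
      exact (Finset.measurableSet_biInter _ fun j _ =>
        measurableSet_le measurable_const (measurable_pi_apply j)).compl
    rw [ae_iff, ← lintegral_indicator_one hms,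
      lintegral_schurLaw h.measurable i (measurable_one.indicator hms)]
    refine lintegral_eq_zero_of_ae_eq_zero ?_
    filter_upwards [h.isGreen, hν.pos] with β hβ hpos
    rw [Pi.zero_apply, setLIntegral_congr_fun (g := fun _ => 0) measurableSet_Ioi]
    · simp
    · intro y hy
      have hy' : 0 < y := hy
      dsimp only
      rw [Set.indicator_of_notMem, mul_zero]
      simp only [Set.mem_ofPred_eq, not_not]
      intro j hj
      by_cases hji : j = i
      · subst hji
        rw [schurField, Function.update_self]
        have := bilin_nonneg (S := S) hβ.nonneg (fun k => W.weight_nonneg k j)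
          fun k => W.weight_nonneg k j
        positivity
      · rw [schurField, Function.update_of_ne hji]
        exact (hpos j).le
  · filter_upwards [hν.pos] with β hβ j _ using (hβ j).le
  · rw [hL l hl, hν.lintegral_exp _ hl]

open Classical in
-- For functions of the potential in the enlarged set, ν may be replaced by the constructed law.
-- There the Schur complement is the coordinate y > 0, so inversion by blocks is available almost
-- surely and the two tilted integrals are already computed.
theorem IsTiltedGreen.insert_vertex (hν : IsPotentialLaw W ν) (h : IsTiltedGreen W ν S g)
    {i : V} (hi : i ∉ S) : IsTiltedGreen W ν (insert i S) (schurGreen W S g i) := by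
  have := hν.isProbabilityMeasure
  have hmap := h.map_schurLaw hν hi
  have hdepY : ∀ β β' : V → ℝ, (∀ j ∈ insert i S, β j = β' j) →
      schurComplement W S β (g β) i = schurComplement W S β' (g β') i := fun β β' hββ' => by
    rw [schurComplement_eq, schurComplement_eq, hββ' i (Finset.mem_insert_self _ _),
      h.local_dep β β' fun j hj => hββ' j (Finset.mem_insert_of_mem hj)]
  have hdep : ∀ β β' : V → ℝ, (∀ j ∈ insert i S, β j = β' j) →
      schurGreen W S g i β = schurGreen W S g i β' := fun β β' hββ' => by
    funext a b
    rw [schurGreen, schurGreen, hdepY β β' hββ',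
      h.local_dep β β' fun j hj => hββ' j (Finset.mem_insert_of_mem hj)]
  have hmY : Measurable fun β => schurComplement W S β (g β) i := by
    simp_rw [schurComplement_eq]
    exact ((measurable_pi_apply i).const_mul _).sub (measurable_bilin h.measurable _ _)
  have htr : ∀ l θ : V → ℝ, ∫⁻ β, ENNReal.ofReal (Real.exp
      (tiltExponent W (insert i S) (schurGreen W S g i β) l θ β)) ∂ν = ∫⁻ β, ENNReal.ofReal
      (Real.exp (tiltExponent W (insert i S) (schurGreen W S g i β) l θ β))
        ∂(schurLaw W ν S g i) := fun l θ => by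
    refine (lintegral_eq_of_map_restrict_eq hmap ?_ ?_).symm
    · exact (measurable_tiltExponent (measurable_schurGreen h.measurable i) l θ).exp.ennreal_ofReal
    · intro β β' hββ'
      rw [hdep β β' hββ', tiltExponent, tiltExponent,
        Finset.sum_congr rfl fun j hj => by rw [hββ' j hj]]
  refine ⟨measurable_schurGreen h.measurable i, hdep, ?_, ?_, ?_⟩
  · have hY : ∀ᵐ β ∂ν, 0 < schurComplement W S β (g β) i := by
      have hms : MeasurableSet {β : V → ℝ | ¬ 0 < schurComplement W S β (g β) i} :=
        (measurableSet_lt measurable_const hmY).compl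
      rw [ae_iff, ← lintegral_indicator_one hms, ← lintegral_eq_of_map_restrict_eq hmap
        (measurable_one.indicator hms), lintegral_schurLaw h.measurable i
        (measurable_one.indicator hms)]
      · refine lintegral_eq_zero_of_ae_eq_zero (ae_of_all _ fun β => ?_)
        dsimp only
        rw [Pi.zero_apply, setLIntegral_congr_fun (g := fun _ => 0) measurableSet_Ioi]
        · simp
        · intro y hy
          dsimp only
          rw [Set.indicator_of_notMem, mul_zero]
          simp only [Set.mem_ofPred_eq, not_not]
          rw [h.schurComplement_schurField hi]
          exact hy
      · intro β β' hββ'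
        simp only [Set.indicator_apply, Set.mem_ofPred_eq, hdepY β β' hββ', Pi.one_apply]
    filter_upwards [h.isGreen, hY] with β hβ hYβ
    exact hβ.insert_vertex hi hYβ
  · intro l θ hl
    rw [htr]
    exact h.lintegral_schurLaw_le hi hl θ
  · intro l θ hl hθ
    rw [htr]
    exact h.lintegral_schurLaw_eq hi hl hθ

end Step

theorem exists_isTiltedGreen {ν : Measure (V → ℝ)} (hν : IsPotentialLaw W ν) (S : Finset V) :
    ∃ g, IsTiltedGreen W ν S g := by
  classical
  have := hν.isProbabilityMeasure
  induction S using Finset.induction_on with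
  | empty => exact ⟨_, IsTiltedGreen.empty⟩
  | insert i S hi ih =>
    obtain ⟨g, hg⟩ := ih
    exact ⟨_, hg.insert_vertex hν hi⟩

end Tilted

/-! ### The mean of ψ: differentiation of the tilted identity at zero -/

section Mean
set_option linter.unusedSectionVars false
variable {V : Type*} {G : SimpleGraph V} [G.LocallyFinite] {W : Conductances G}
  {ν : Measure (V → ℝ)} {S : Finset V} {g : (V → ℝ) → V → V → ℝ}

open Classical in
-- This is the link with ψ: a point mass θ = sδ_k has linear term ψ(k), while the Green function
-- enters only at second order.
theorem tiltExponent_single (g : V → V → ℝ) (l β : V → ℝ) {k : V} (hk : k ∈ S) (s : ℝ) :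
    tiltExponent W S g l (Pi.single k s) β =
      -∑ i ∈ S, l i * β i - s * psiOf W S g k - s ^ 2 / 2 * g k k := by
  rw [tiltExponent, bilin_add_right, sub_sub]
  have h1 : ∀ y : V → ℝ, bilin S g (Pi.single k s) y = s * ∑ b ∈ S, g k b * y b := by
    intro y
    rw [bilin, Finset.sum_eq_single k]
    · rw [Pi.single_eq_same, Finset.mul_sum]
      exact Finset.sum_congr rfl fun b _ => by ring
    · intro a _ ha
      simp [Pi.single_eq_of_ne ha]
    · exact fun h => absurd hk h
  rw [h1, h1, psiOf, if_pos hk]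
  have h2 : ∑ b ∈ S, g k b * (Pi.single k s : V → ℝ) b = g k k * s := by
    rw [Finset.sum_eq_single k]
    · rw [Pi.single_eq_same]
    · intro a _ ha
      simp [Pi.single_eq_of_ne ha]
    · exact fun h => absurd hk h
  rw [h2]
  ring

open Classical in
theorem sum_single_mul {k : V} (hk : k ∈ S) (s : ℝ) (a : V → ℝ) :
    ∑ i ∈ S, (Pi.single k s : V → ℝ) i * a i = s * a k := by
  rw [Finset.sum_eq_single k]
  · rw [Pi.single_eq_same]
  · intro b _ hb
    simp [Pi.single_eq_of_ne hb]
  · exact fun h => absurd hk h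

theorem lap_pos (W : Conductances G) (S : Finset V) {a : V → ℝ} (ha : ∀ i, 0 < a i) :
    0 < lap W S a :=
  div_pos (Real.exp_pos _) (Finset.prod_pos fun i _ => ha i)

theorem sqrt_one_add_pos {l : V → ℝ} (hl : ∀ i, 0 ≤ l i) (i : V) : 0 < √(1 + l i) :=
  Real.sqrt_pos.2 (by linarith [hl i])

theorem IsTiltedGreen.measurable_psiOf (h : IsTiltedGreen W ν S g) (k : V) :
    Measurable fun β => psiOf W S (g β) k := by
  unfold psiOf
  split_ifs
  · exact Finset.measurable_sum _ fun j _ => (h.measurable k j).mul_const _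
  · exact measurable_const

theorem IsTiltedGreen.psiOf_local (h : IsTiltedGreen W ν S g) (k : V) (β β' : V → ℝ)
    (hββ' : ∀ i ∈ S, β i = β' i) : psiOf W S (g β) k = psiOf W S (g β') k := by
  rw [h.local_dep β β' hββ']

theorem measurable_exp_neg_sum (S : Finset V) (l : V → ℝ) :
    Measurable fun β : V → ℝ => Real.exp (-∑ i ∈ S, l i * β i) := by fun_prop

theorem tendsto_one_sub_exp_div (a b : ℝ) :
    Tendsto (fun n : ℕ => (1 - Real.exp (-(1 / (n + 1 : ℝ)) * a - (1 / (n + 1 : ℝ)) ^ 2 / 2 * b)) /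
      (1 / (n + 1 : ℝ))) atTop (𝓝 a) := by
  have h1 : HasDerivAt (fun t : ℝ => 1 - Real.exp (-t * a - t ^ 2 / 2 * b)) a 0 := by
    have h2 : HasDerivAt (fun t : ℝ => -t * a - t ^ 2 / 2 * b) (-a) 0 := by
      have h3 := ((hasDerivAt_id (0 : ℝ)).neg.mul_const a).sub
        (((hasDerivAt_pow 2 (0 : ℝ)).div_const 2).mul_const b)
      exact h3.congr_deriv (by simp)
    have h4 := (h2.exp).const_sub 1
    simpa using h4
  have h5 := h1.tendsto_slope_zero
  have h6 : Tendsto (fun n : ℕ => 1 / (n + 1 : ℝ)) atTop (𝓝[≠] 0) :=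
    tendsto_nhdsWithin_iff.2 ⟨tendsto_one_div_add_atTop_nhds_zero_nat,
      Eventually.of_forall fun n => (by positivity : (1 / (n + 1 : ℝ)) ≠ 0)⟩
  refine (h5.comp h6).congr fun n => ?_
  simp [div_eq_inv_mul]

/-- The difference quotient at `0` of the exponential functional in the direction of `k`. -/
def tiltQuotient (W : Conductances G) (S : Finset V) (g : V → V → ℝ) (l : V → ℝ) (k : V) (n : ℕ)
    (β : V → ℝ) : ℝ :=
  Real.exp (-∑ i ∈ S, l i * β i) * ((1 - Real.exp (-(1 / (n + 1 : ℝ)) * psiOf W S g k -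
    (1 / (n + 1 : ℝ)) ^ 2 / 2 * g k k)) / (1 / (n + 1 : ℝ)))

theorem tendsto_tiltQuotient (g : V → V → ℝ) (l β : V → ℝ) (k : V) :
    Tendsto (fun n => ENNReal.ofReal (tiltQuotient W S g l k n β)) atTop
      (𝓝 (ENNReal.ofReal (psiOf W S g k * Real.exp (-∑ i ∈ S, l i * β i)))) := by
  refine ENNReal.tendsto_ofReal ?_
  rw [mul_comm]
  exact (tendsto_one_sub_exp_div _ _).const_mul _

theorem IsTiltedGreen.measurable_tiltQuotient (h : IsTiltedGreen W ν S g) (l : V → ℝ) (k : V)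
    (n : ℕ) : Measurable fun β => tiltQuotient W S (g β) l k n β := by
  have h1 := h.measurable_psiOf k
  have h2 := h.measurable k k
  have h3 := measurable_exp_neg_sum S l
  unfold tiltQuotient
  fun_prop

theorem IsTiltedGreen.lintegral_tiltQuotient (hν : IsPotentialLaw W ν) (h : IsTiltedGreen W ν S g)
    {l : V → ℝ} (hl : ∀ i, 0 ≤ l i) {k : V} (hk : k ∈ S) (n : ℕ) :
    ∫⁻ β, ENNReal.ofReal (tiltQuotient W S (g β) l k n β) ∂ν =
      ENNReal.ofReal (lap W S (fun i => √(1 + l i)) *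
        ((1 - Real.exp (-(1 / (n + 1 : ℝ)) * √(1 + l k) - (1 / (n + 1 : ℝ)) ^ 2 / 2 * 0)) /
          (1 / (n + 1 : ℝ)))) := by
  classical
  have := hν.isProbabilityMeasure
  set s : ℝ := 1 / (n + 1 : ℝ) with hs
  have hs0 : 0 < s := by positivity
  set L := lap W S (fun i => √(1 + l i)) with hL
  have hL0 : 0 < L := lap_pos W S (sqrt_one_add_pos hl)
  have hm2 : Measurable fun β => Real.exp (-∑ i ∈ S, l i * β i - s * psiOf W S (g β) k -
      s ^ 2 / 2 * g β k k) := by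
    have h1 := h.measurable_psiOf k
    have h2 := h.measurable k k
    fun_prop
  have h1 := hν.lintegral_exp S hl
  have h2 := h.tilt_eq l (Pi.single k s) hl fun i => by
    by_cases hi : i = k
    · subst hi; simp [hs0.le]
    · simp [Pi.single_eq_of_ne hi]
  simp_rw [tiltExponent_single _ _ _ hk] at h2
  rw [sum_single_mul hk] at h2
  have h3 : ∀ᵐ β ∂ν, ENNReal.ofReal (tiltQuotient W S (g β) l k n β) =
      ENNReal.ofReal s⁻¹ * (ENNReal.ofReal (Real.exp (-∑ i ∈ S, l i * β i)) -
        ENNReal.ofReal (Real.exp (-∑ i ∈ S, l i * β i - s * psiOf W S (g β) k -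
          s ^ 2 / 2 * g β k k))) := by
    refine ae_of_all _ fun β => ?_
    rw [← ENNReal.ofReal_sub _ (Real.exp_pos _).le, ← ENNReal.ofReal_mul (by positivity),
      tiltQuotient, ← hs]
    congr 1
    rw [show -∑ i ∈ S, l i * β i - s * psiOf W S (g β) k - s ^ 2 / 2 * g β k k =
      -∑ i ∈ S, l i * β i + (-s * psiOf W S (g β) k - s ^ 2 / 2 * g β k k) by ring, Real.exp_add]
    field_simp
  rw [lintegral_congr_ae h3, lintegral_const_mul' _ _ ENNReal.ofReal_ne_top, lintegral_sub, h1, h2,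
    ← ENNReal.ofReal_sub _ (by positivity), ← ENNReal.ofReal_mul (by positivity)]
  · congr 1
    rw [show -s * √(1 + l k) - s ^ 2 / 2 * 0 = -(s * √(1 + l k)) by ring, hL]
    field_simp
  · exact hm2.ennreal_ofReal
  · rw [h2]; exact ENNReal.ofReal_ne_top
  · filter_upwards [h.isGreen] with β hβ
    refine ENNReal.ofReal_le_ofReal (Real.exp_le_exp.2 ?_)
    have := mul_nonneg hs0.le (hβ.psiOf_nonneg k)
    have := mul_nonneg (by positivity : 0 ≤ s ^ 2 / 2) (hβ.nonneg k k)
    linarith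

theorem tendsto_lap_quotient (L a : ℝ) :
    Tendsto (fun n : ℕ => ENNReal.ofReal (L *
        ((1 - Real.exp (-(1 / (n + 1 : ℝ)) * a - (1 / (n + 1 : ℝ)) ^ 2 / 2 * 0)) /
          (1 / (n + 1 : ℝ))))) atTop (𝓝 (ENNReal.ofReal (L * a))) :=
  ENNReal.tendsto_ofReal ((tendsto_one_sub_exp_div a 0).const_mul L)

/-- Fatou's lemma for the difference quotients. This inequality provides the integrability from
which the equality is then derived. -/
theorem IsTiltedGreen.lintegral_psiOf_le (hν : IsPotentialLaw W ν) (h : IsTiltedGreen W ν S g)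
    {l : V → ℝ} (hl : ∀ i, 0 ≤ l i) {k : V} (hk : k ∈ S) :
    ∫⁻ β, ENNReal.ofReal (psiOf W S (g β) k * Real.exp (-∑ i ∈ S, l i * β i)) ∂ν ≤
      ENNReal.ofReal (lap W S (fun i => √(1 + l i)) * √(1 + l k)) := by
  have h1 := lintegral_liminf_le (μ := ν) (u := (atTop : Filter ℕ)) (f := fun n β =>
    ENNReal.ofReal (tiltQuotient W S (g β) l k n β))
    fun n => (h.measurable_tiltQuotient l k n).ennreal_ofReal
  have h2 := tendsto_lap_quotient (lap W S (fun i => √(1 + l i))) (√(1 + l k))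
  simp_rw [h.lintegral_tiltQuotient hν hl hk] at h1
  rw [h2.liminf_eq] at h1
  refine le_trans (le_of_eq (lintegral_congr fun β => ?_)) h1
  exact (tendsto_tiltQuotient (g β) l β k).liminf_eq.symm

theorem mul_exp_neg_le {x s : ℝ} (hs : 0 < s) : x * Real.exp (-(s * x)) ≤ 1 / s := by
  rw [Real.exp_neg, ← div_eq_mul_inv, div_le_div_iff₀ (Real.exp_pos _) hs]
  linarith [Real.add_one_le_exp (s * x)]

/-- The Green function is integrable against the exponentials. -/
theorem IsTiltedGreen.lintegral_green_lt_top (hν : IsPotentialLaw W ν) (h : IsTiltedGreen W ν S g)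
    (hS : (G.induce (S : Set V)).Preconnected) (hbd : ∃ j ∈ S, 0 < boundaryWeight W S j)
    {k : V} (hk : k ∈ S) (m : V) (hm : m ∈ S) (l : V → ℝ) (hl : ∀ i, 0 < l i) :
    ∫⁻ β, ENNReal.ofReal (g β m k * Real.exp (-∑ i ∈ S, l i * β i)) ∂ν < ∞ := by
  classical
  obtain ⟨j, hj, hjb⟩ := hbd
  obtain ⟨p⟩ := hS ⟨j, hj⟩ ⟨m, hm⟩
  -- Finiteness passes from a vertex to its neighbour: the comparison of rows costs a factor β_u,
  -- which half of the exponential weight at u absorbs. This is why l must be strictly positive and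
  -- arbitrary.
  have key : ∀ (x y : (S : Set V)) (p : (G.induce (S : Set V)).Walk x y),
      (∀ l : V → ℝ, (∀ i, 0 < l i) →
        ∫⁻ β, ENNReal.ofReal (g β x k * Real.exp (-∑ i ∈ S, l i * β i)) ∂ν < ∞) →
      ∀ l : V → ℝ, (∀ i, 0 < l i) →
        ∫⁻ β, ENNReal.ofReal (g β y k * Real.exp (-∑ i ∈ S, l i * β i)) ∂ν < ∞ := by
    intro x y p
    induction p with
    | nil => exact fun h => h
    | @cons u v w e p ih =>
      intro hu
      refine ih fun l hl => ?_
      have huS : (u : V) ∈ S := u.2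
      have hw : 0 < W.weight u v := W.weight_pos e
      set l' : V → ℝ := Function.update l u (l u / 2) with hl'
      have hl'pos : ∀ i, 0 < l' i := by
        intro i
        by_cases hi : i = u
        · rw [hi, hl', Function.update_self]; exact half_pos (hl u)
        · rw [hl', Function.update_of_ne hi]; exact hl i
      have hsum : ∀ β : V → ℝ, ∑ i ∈ S, l i * β i = ∑ i ∈ S, l' i * β i + l u / 2 * β u := by
        intro β
        rw [← Finset.add_sum_erase _ _ huS, ← Finset.add_sum_erase _ _ huS]
        rw [Finset.sum_congr rfl fun i hi => by
          rw [show l i = l' i by rw [hl', Function.update_of_ne (Finset.ne_of_mem_erase hi)]]]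
        rw [hl', Function.update_self]
        ring
      set C := 2 / W.weight u v * (1 / (l u / 2)) with hC
      have hC0 : 0 ≤ C := by have := hl u; positivity
      have hfin := hu l' hl'pos
      refine lt_of_le_of_lt ?_ (ENNReal.mul_lt_top (ENNReal.ofReal_lt_top (r := C)) hfin)
      rw [← lintegral_const_mul' _ _ ENNReal.ofReal_ne_top]
      refine lintegral_mono_ae ?_
      filter_upwards [h.isGreen, hν.pos] with β hβ hpos
      rw [← ENNReal.ofReal_mul hC0]
      refine ENNReal.ofReal_le_ofReal ?_
      have h1 := hβ.weight_mul_le huS (n := v) k hk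
      have h2 : g β v k ≤ 2 / W.weight u v * (β u * g β u k) := by
        rw [div_mul_eq_mul_div, le_div_iff₀ hw]
        linarith
      have h3 := mul_exp_neg_le (x := β u) (half_pos (hl u))
      rw [hsum, neg_add, Real.exp_add]
      have h4 := hβ.nonneg u k
      calc g β v k * (Real.exp (-∑ i ∈ S, l' i * β i) * Real.exp (-(l u / 2 * β u)))
          ≤ 2 / W.weight u v * (β u * g β u k) *
            (Real.exp (-∑ i ∈ S, l' i * β i) * Real.exp (-(l u / 2 * β u))) := by gcongr
        _ = 2 / W.weight u v * (β u * Real.exp (-(l u / 2 * β u))) *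
            (g β u k * Real.exp (-∑ i ∈ S, l' i * β i)) := by ring
        _ ≤ 2 / W.weight u v * (1 / (l u / 2)) *
            (g β u k * Real.exp (-∑ i ∈ S, l' i * β i)) := by gcongr
  -- The path starts at a vertex j joined to the complement, where g(j,k) times the boundary weight
  -- is one of the terms of ψ(k).
  refine key _ _ p (fun l hl => ?_) l hl
  have h1 := h.lintegral_psiOf_le hν (fun i => (hl i).le) hk
  refine lt_of_le_of_lt ?_ (lt_of_le_of_lt (mul_le_mul_right h1
    (ENNReal.ofReal (1 / boundaryWeight W S j))) (ENNReal.mul_lt_top ENNReal.ofReal_lt_top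
      ENNReal.ofReal_lt_top))
  rw [← lintegral_const_mul' _ _ ENNReal.ofReal_ne_top]
  refine lintegral_mono_ae ?_
  filter_upwards [h.isGreen] with β hβ
  rw [← ENNReal.ofReal_mul (by positivity), ← mul_assoc]
  refine ENNReal.ofReal_le_ofReal (mul_le_mul_of_nonneg_right ?_ (Real.exp_pos _).le)
  rw [one_div, ← div_eq_inv_mul, le_div_iff₀ hjb, psiOf, if_pos hk]
  change g β j k * _ ≤ _
  rw [hβ.symm j k]
  exact Finset.single_le_sum (f := fun b => g β k b * boundaryWeight W S b)
    (fun b _ => mul_nonneg (hβ.nonneg _ _) (boundaryWeight_nonneg W S b)) hj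

/-- The difference quotients are dominated by (ψ + g) times the exponential, since 1 - e^{-x} ≤ x
and the step is at most 1; strict positivity of l makes g integrable. -/
theorem IsTiltedGreen.lintegral_psiOf_of_pos (hν : IsPotentialLaw W ν) (h : IsTiltedGreen W ν S g)
    (hS : (G.induce (S : Set V)).Preconnected) (hbd : ∃ j ∈ S, 0 < boundaryWeight W S j)
    {l : V → ℝ} (hl : ∀ i, 0 < l i) {k : V} (hk : k ∈ S) :
    ∫⁻ β, ENNReal.ofReal (psiOf W S (g β) k * Real.exp (-∑ i ∈ S, l i * β i)) ∂ν =
      ENNReal.ofReal (lap W S (fun i => √(1 + l i)) * √(1 + l k)) := by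
  have hl' : ∀ i, 0 ≤ l i := fun i => (hl i).le
  refine tendsto_nhds_unique ?_ (tendsto_lap_quotient _ _)
  simp_rw [← h.lintegral_tiltQuotient hν hl' hk]
  refine tendsto_lintegral_of_dominated_convergence (fun β =>
    ENNReal.ofReal (psiOf W S (g β) k * Real.exp (-∑ i ∈ S, l i * β i)) +
      ENNReal.ofReal (g β k k * Real.exp (-∑ i ∈ S, l i * β i)))
    (fun n => (h.measurable_tiltQuotient l k n).ennreal_ofReal) (fun n => ?_) ?_
    (ae_of_all _ fun β => tendsto_tiltQuotient (g β) l β k)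
  · filter_upwards [h.isGreen] with β hβ
    have hX := hβ.psiOf_nonneg k
    have hY := hβ.nonneg k k
    rw [← ENNReal.ofReal_add (by positivity) (by positivity)]
    refine ENNReal.ofReal_le_ofReal ?_
    rw [tiltQuotient, mul_comm, ← add_mul]
    refine mul_le_mul_of_nonneg_right ?_ (Real.exp_pos _).le
    set s : ℝ := 1 / (n + 1 : ℝ) with hs
    have hs0 : 0 < s := by positivity
    have hs1 : s ≤ 1 := by rw [hs, div_le_one (by positivity)]; linarith [n.cast_nonneg (α := ℝ)]
    rw [div_le_iff₀ hs0]
    have := Real.add_one_le_exp (-s * psiOf W S (g β) k - s ^ 2 / 2 * g β k k)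
    have h5 : s ^ 2 / 2 * g β k k ≤ s * g β k k := by
      refine mul_le_mul_of_nonneg_right ?_ hY
      nlinarith
    linarith
  · have h1 := h.lintegral_psiOf_le hν hl' hk
    have h2 := h.lintegral_green_lt_top hν hS hbd hk k hk l hl
    rw [lintegral_add_left]
    · exact (ENNReal.add_lt_top.2 ⟨lt_of_le_of_lt h1 ENNReal.ofReal_lt_top, h2⟩).ne
    · have h3 := h.measurable_psiOf k
      have h4 := measurable_exp_neg_sum S l
      fun_prop

/-- Zeros of l are reached by letting l + 1/(n+1) decrease to l; the bound from Fatou's lemma is the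
dominating function. -/
theorem IsTiltedGreen.lintegral_psiOf (hν : IsPotentialLaw W ν) (h : IsTiltedGreen W ν S g)
    (hS : (G.induce (S : Set V)).Preconnected) (hbd : ∃ j ∈ S, 0 < boundaryWeight W S j)
    {l : V → ℝ} (hl : ∀ i, 0 ≤ l i) {k : V} (hk : k ∈ S) :
    ∫⁻ β, ENNReal.ofReal (psiOf W S (g β) k * Real.exp (-∑ i ∈ S, l i * β i)) ∂ν =
      ENNReal.ofReal (lap W S (fun i => √(1 + l i)) * √(1 + l k)) := by
  have hlim : Tendsto (fun n : ℕ => 1 / (n + 1 : ℝ)) atTop (𝓝 0) :=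
    tendsto_one_div_add_atTop_nhds_zero_nat
  have hcont : Continuous fun t : ℝ => lap W S (fun i => √(1 + (l i + |t|))) *
      √(1 + (l k + |t|)) := by
    unfold lap
    refine Continuous.mul (Continuous.div (by fun_prop) (by fun_prop) fun t => ?_) (by fun_prop)
    exact (Finset.prod_pos fun i _ => Real.sqrt_pos.2 (by have := hl i; positivity)).ne'
  have h1 : Tendsto (fun n : ℕ => ENNReal.ofReal (lap W S
      (fun i => √(1 + (l i + |1 / (n + 1 : ℝ)|))) * √(1 + (l k + |1 / (n + 1 : ℝ)|)))) atTop
      (𝓝 (ENNReal.ofReal (lap W S (fun i => √(1 + l i)) * √(1 + l k)))) := by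
    have := ENNReal.tendsto_ofReal ((hcont.tendsto 0).comp hlim)
    simpa using this
  refine tendsto_nhds_unique ?_ h1
  have h2 : ∀ n : ℕ, ∀ i, 0 < l i + |1 / (n + 1 : ℝ)| := fun n i => by
    have := hl i
    have : 0 < |1 / (n + 1 : ℝ)| := abs_pos.2 (by positivity)
    linarith
  simp_rw [← fun n : ℕ => h.lintegral_psiOf_of_pos hν hS hbd (h2 n) hk]
  refine tendsto_lintegral_of_dominated_convergence (fun β =>
    ENNReal.ofReal (psiOf W S (g β) k * Real.exp (-∑ i ∈ S, l i * β i))) (fun n => ?_)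
    (fun n => ?_) ?_ (ae_of_all _ fun β => ?_)
  · have h3 := h.measurable_psiOf k
    have h4 := measurable_exp_neg_sum S fun i => l i + |1 / (n + 1 : ℝ)|
    fun_prop
  · filter_upwards [h.isGreen, hν.pos] with β hβ hpos
    refine ENNReal.ofReal_le_ofReal (mul_le_mul_of_nonneg_left (Real.exp_le_exp.2
      (neg_le_neg ?_)) (hβ.psiOf_nonneg k))
    refine Finset.sum_le_sum fun i _ => mul_le_mul_of_nonneg_right ?_ (hpos i).le
    linarith [abs_nonneg (1 / (n + 1 : ℝ))]
  · exact (lt_of_le_of_lt (h.lintegral_psiOf_le hν hl hk) ENNReal.ofReal_lt_top).ne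
  · refine ENNReal.tendsto_ofReal (Tendsto.const_mul _ ?_)
    have : Continuous fun t : ℝ => Real.exp (-∑ i ∈ S, (l i + |t|) * β i) := by fun_prop
    have := (this.tendsto 0).comp hlim
    simpa [Function.comp_def] using this

open Classical in
theorem IsTiltedGreen.lintegral_psiOf_mul (hν : IsPotentialLaw W ν) (h : IsTiltedGreen W ν S g)
    (hS : (G.induce (S : Set V)).Preconnected) (hbd : ∃ j ∈ S, 0 < boundaryWeight W S j)
    {l : V → ℝ} (hl : ∀ i, 0 ≤ l i) (k : V) :
    ∫⁻ β, ENNReal.ofReal (psiOf W S (g β) k) * ENNReal.ofReal (Real.exp (-∑ i ∈ S, l i * β i)) ∂ν =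
      (∫⁻ β, ENNReal.ofReal (Real.exp (-∑ i ∈ S, l i * β i)) ∂ν) *
        ENNReal.ofReal √(1 + if k ∈ S then l k else 0) := by
  by_cases hk : k ∈ S
  · rw [if_pos hk, hν.lintegral_exp S hl, ← ENNReal.ofReal_mul
      (lap_pos W S (sqrt_one_add_pos hl)).le, ← h.lintegral_psiOf hν hS hbd hl hk]
    refine lintegral_congr fun β => ?_
    rw [ENNReal.ofReal_mul' (Real.exp_pos _).le]
  · simp [psiOf, hk]

/-- The function `ψ` of a larger set has the same conditional expectation. -/
theorem map_withDensity_psiOf_eq (hν : IsPotentialLaw W ν) {S' : Finset V}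
    {g' : (V → ℝ) → V → V → ℝ} (hSS' : S ⊆ S') (h : IsTiltedGreen W ν S g)
    (h' : IsTiltedGreen W ν S' g')
    (hS : (G.induce (S : Set V)).Preconnected) (hbd : ∃ j ∈ S, 0 < boundaryWeight W S j)
    (hS' : (G.induce (S' : Set V)).Preconnected) (hbd' : ∃ j ∈ S', 0 < boundaryWeight W S' j)
    (k : V) :
    (ν.withDensity fun β => ENNReal.ofReal (psiOf W S' (g' β) k)).map S.restrict =
      (ν.withDensity fun β => ENNReal.ofReal (psiOf W S (g β) k)).map S.restrict := by
  classical
  have := hν.isProbabilityMeasure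
  have hm := (h.measurable_psiOf k).ennreal_ofReal
  have hm' := (h'.measurable_psiOf k).ennreal_ofReal
  have hL : ∀ l : V → ℝ, (∀ i, 0 ≤ l i) → ∫⁻ β, ENNReal.ofReal (Real.exp (-∑ i ∈ S, l i * β i))
      ∂(ν.withDensity fun β => ENNReal.ofReal (psiOf W S (g β) k)) =
      (∫⁻ β, ENNReal.ofReal (Real.exp (-∑ i ∈ S, l i * β i)) ∂ν) *
        ENNReal.ofReal √(1 + if k ∈ S then l k else 0) := fun l hl => by
    refine (lintegral_withDensity_eq_lintegral_mul _ hm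
      (measurable_exp_neg_sum S l).ennreal_ofReal).trans ?_
    exact h.lintegral_psiOf_mul hν hS hbd hl k
  have hL' : ∀ l : V → ℝ, (∀ i, 0 ≤ l i) → ∫⁻ β, ENNReal.ofReal (Real.exp (-∑ i ∈ S, l i * β i))
      ∂(ν.withDensity fun β => ENNReal.ofReal (psiOf W S' (g' β) k)) =
      (∫⁻ β, ENNReal.ofReal (Real.exp (-∑ i ∈ S, l i * β i)) ∂ν) *
        ENNReal.ofReal √(1 + if k ∈ S then l k else 0) := fun l hl => by
    refine (lintegral_withDensity_eq_lintegral_mul _ hm'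
      (measurable_exp_neg_sum S l).ennreal_ofReal).trans ?_
    -- Extending l by 0 to the larger set puts both integrals in the same form. At vertices outside
    -- S the factor √(1 + l) becomes 1, which agrees with ψ = 1 there.
    have hsum : ∀ β : V → ℝ, ∑ i ∈ S, l i * β i =
        ∑ i ∈ S', (if i ∈ S then l i else 0) * β i := fun β => by
      rw [← Finset.sum_subset hSS' fun i _ hi => by rw [if_neg hi, zero_mul]]
      exact Finset.sum_congr rfl fun i hi => by rw [if_pos hi]
    have h1 := h'.lintegral_psiOf_mul hν hS' hbd' (l := fun i => if i ∈ S then l i else 0)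
      (fun i => by split_ifs <;> simp [hl]) k
    simp_rw [← hsum] at h1
    refine h1.trans ?_
    congr 4
    by_cases hkS : k ∈ S
    · simp [hkS, hSS' hkS]
    · simp [hkS]
  have fin_of : ∀ ρ : Measure (V → ℝ), (∀ l : V → ℝ, (∀ i, 0 ≤ l i) →
      ∫⁻ β, ENNReal.ofReal (Real.exp (-∑ i ∈ S, l i * β i)) ∂ρ =
      (∫⁻ β, ENNReal.ofReal (Real.exp (-∑ i ∈ S, l i * β i)) ∂ν) *
        ENNReal.ofReal √(1 + if k ∈ S then l k else 0)) → IsFiniteMeasure ρ := fun ρ hρ => by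
    have h0 := hρ (fun _ => 0) fun _ => le_rfl
    simp at h0
    exact ⟨by rw [h0]; exact ENNReal.one_lt_top⟩
  have i1 := fin_of _ hL
  have i2 := fin_of _ hL'
  refine map_restrict_eq_of_laplace S ?_ ?_ fun l hl => by rw [hL l hl, hL' l hl]
  · refine (withDensity_absolutelyContinuous ν _).ae_le ?_
    filter_upwards [hν.pos] with β hβ i _ using (hβ i).le
  · refine (withDensity_absolutelyContinuous ν _).ae_le ?_
    filter_upwards [hν.pos] with β hβ i _ using (hβ i).le

end Mean

/-! ### Almost sure convergence of ψ and boundedness of the Green functions -/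

section Convergence
set_option linter.unusedSectionVars false
variable {V : Type*} {G : SimpleGraph V} [G.LocallyFinite] {W : Conductances G}
  {ν : Measure (V → ℝ)}

/-- The form of H_S at the difference of the columns i and j equals g(i,i) - 2g(i,j) + g(j,j), and
it is nonnegative. Hence only the diagonal needs a bound. -/
theorem IsGreen.le_half_add {S : Finset V} {β : V → ℝ} {g : V → V → ℝ} (h : IsGreen W S β g)
    (i j : V) : g i j ≤ (g i i + g j j) / 2 := by
  by_cases hij : i ∈ S ∧ j ∈ S
  · obtain ⟨hi, hj⟩ := hij
    have h1 := h.form_nonneg fun a => g a i - g a j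
    have hx : ∑ k ∈ S, (g k i - g k j) * (2 * β k * (g k i - g k j) -
        ∑ l ∈ S, W.weight k l * (g l i - g l j)) = (g i i - g i j) - (g j i - g j j) := by
      have e1 := h.sum_smul (fun a => g a i - g a j) hi
      have e2 := h.sum_smul (fun a => g a i - g a j) hj
      simp only [smul_eq_mul] at e1 e2
      rw [← e1, ← e2, ← Finset.sum_sub_distrib]
      exact Finset.sum_congr rfl fun k _ => by ring
    have h2 : ∑ k ∈ S, (g k i - g k j) * (2 * β k * (g k i - g k j) -
        ∑ l ∈ S, W.weight k l * (g l i - g l j)) =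
        ∑ a ∈ S, 2 * β a * (g a i - g a j) ^ 2 - ∑ a ∈ S, ∑ b ∈ S,
          W.weight a b * ((g a i - g a j) * (g b i - g b j)) := by
      rw [← Finset.sum_sub_distrib]
      refine Finset.sum_congr rfl fun k _ => ?_
      rw [mul_sub, Finset.mul_sum]
      congr 1
      · ring
      · exact Finset.sum_congr rfl fun l _ => by ring
    rw [h.symm j i] at hx
    linarith
  · rw [h.support i j hij]
    have := h.nonneg i i
    have := h.nonneg j j
    linarith

/-- A version of the Green function of `S` that depends only on the potential in `S`. -/
def greenVersion (hν : IsPotentialLaw W ν) (S : Finset V) : (V → ℝ) → V → V → ℝ :=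
  (exists_isTiltedGreen hν S).choose

theorem isTiltedGreen_greenVersion (hν : IsPotentialLaw W ν) (S : Finset V) :
    IsTiltedGreen W ν S (greenVersion hν S) :=
  (exists_isTiltedGreen hν S).choose_spec

theorem ae_isGreen [Countable V] (hν : IsPotentialLaw W ν) :
    ∀ᵐ β ∂ν, ∀ S, IsGreen W S β (greenVersion hν S β) :=
  ae_all_iff.2 fun S => (isTiltedGreen_greenVersion hν S).isGreen

/-- A connected finite set which is joined to its complement. -/
structure IsWired (W : Conductances G) (S : Finset V) : Prop where
  preconnected : (G.induce (S : Set V)).Preconnected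
  boundary : ∃ j ∈ S, 0 < boundaryWeight W S j

theorem isWired_of_notMem (hG : G.Connected) {S : Finset V} (hS : (G.induce (S : Set V)).Connected)
    {v : V} (hv : v ∉ S) : IsWired W S := by
  refine ⟨hS.preconnected, ?_⟩
  obtain ⟨u, hu⟩ := hS.nonempty
  obtain ⟨p⟩ := hG.preconnected u v
  obtain ⟨d, -, hd1, hd2⟩ := p.exists_boundary_dart (S : Set V) hu hv
  exact ⟨d.fst, hd1, boundaryWeight_pos W d.adj hd2⟩

/-- The version of `ψ` that depends only on the potential in `S`. -/
def psiVersion (hν : IsPotentialLaw W ν) (S : Finset V) (k : V) (β : V → ℝ) : ℝ :=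
  psiOf W S (greenVersion hν S β) k

theorem measurable_psiVersion (hν : IsPotentialLaw W ν) (S : Finset V) (k : V) :
    Measurable (psiVersion hν S k) :=
  (isTiltedGreen_greenVersion hν S).measurable_psiOf k

theorem psiVersion_nonneg (hν : IsPotentialLaw W ν) (S : Finset V) (k : V) :
    ∀ᵐ β ∂ν, 0 ≤ psiVersion hν S k β := by
  filter_upwards [(isTiltedGreen_greenVersion hν S).isGreen] with β hβ using hβ.psiOf_nonneg k

theorem lintegral_psiVersion (hν : IsPotentialLaw W ν) {S : Finset V} (hS : IsWired W S) (k : V) :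
    ∫⁻ β, ENNReal.ofReal (psiVersion hν S k β) ∂ν = 1 := by
  have := hν.isProbabilityMeasure
  have h := (isTiltedGreen_greenVersion hν S).lintegral_psiOf_mul hν hS.1 hS.2
    (l := fun _ => 0) (fun _ => le_rfl) k
  simpa [psiVersion] using h

theorem integrable_psiVersion (hν : IsPotentialLaw W ν) {S : Finset V} (hS : IsWired W S) (k : V) :
    Integrable (psiVersion hν S k) ν := by
  refine ⟨(measurable_psiVersion hν S k).aestronglyMeasurable, ?_⟩
  rw [hasFiniteIntegral_iff_ofReal (psiVersion_nonneg hν S k), lintegral_psiVersion hν hS]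
  exact ENNReal.one_lt_top

theorem measurable_comap_restrict {S : Finset V} {f : (V → ℝ) → ℝ} (hf : Measurable f)
    (hdep : ∀ β β' : V → ℝ, (∀ i ∈ S, β i = β' i) → f β = f β') :
    Measurable[MeasurableSpace.comap S.restrict inferInstance] f := by
  classical
  have hm : Measurable fun x : S → ℝ => fun i : V => if h : i ∈ S then x ⟨i, h⟩ else 0 := by
    refine measurable_pi_lambda _ fun i => ?_
    by_cases hi : i ∈ S
    · simp only [hi, dif_pos]
      exact measurable_pi_apply _
    · simp only [hi, dif_neg, not_false_eq_true]
      exact measurable_const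
  have h1 : f = (fun x : S → ℝ => f fun i : V => if h : i ∈ S then x ⟨i, h⟩ else 0) ∘
      S.restrict := by
    funext β
    exact hdep _ _ fun i hi => by simp [hi]
  rw [h1]
  exact (hf.comp hm).comp (comap_measurable _)

/-- The information on the potential in the sets of an increasing sequence. -/
def potentialFiltration (Λ : ℕ → Finset V) (hΛ : Monotone Λ) :
    Filtration ℕ (inferInstance : MeasurableSpace (V → ℝ)) where
  seq n := MeasurableSpace.comap (Λ n).restrict inferInstance
  mono' m n hmn := by
    have h : ((Λ m).restrict : (V → ℝ) → (Λ m → ℝ)) =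
        Finset.restrict₂ (π := fun _ : V => ℝ) (hΛ hmn) ∘ (Λ n).restrict := rfl
    change MeasurableSpace.comap (Λ m).restrict _ ≤ MeasurableSpace.comap (Λ n).restrict _
    rw [h, ← MeasurableSpace.comap_comp]
    exact MeasurableSpace.comap_mono (Finset.measurable_restrict₂ (hΛ hmn)).comap_le
  le' n := (Finset.measurable_restrict (Λ n)).comap_le

theorem setIntegral_psiVersion (hν : IsPotentialLaw W ν) {S T : Finset V}
    {t : Set (S → ℝ)} (ht : MeasurableSet t) (k : V) :
    ∫ β in S.restrict ⁻¹' t, psiVersion hν T k β ∂ν =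
      (((ν.withDensity fun β => ENNReal.ofReal (psiVersion hν T k β)).map S.restrict) t).toReal := by
  rw [integral_eq_lintegral_of_nonneg_ae (ae_restrict_of_ae (psiVersion_nonneg hν T k))
    (measurable_psiVersion hν T k).aestronglyMeasurable,
    Measure.map_apply (Finset.measurable_restrict S) ht,
    withDensity_apply _ (Finset.measurable_restrict S ht)]

/-- The versions are used because they depend only on the potential in Λ n; equality of the biased
marginals on Λ n is the martingale property tested on events of the filtration. -/
theorem martingale_psiVersion (hν : IsPotentialLaw W ν) {Λ : ℕ → Finset V} (hΛ : Monotone Λ)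
    (hW : ∀ n, IsWired W (Λ n)) (k : V) :
    Martingale (fun n => psiVersion hν (Λ n) k) (potentialFiltration Λ hΛ) ν := by
  have := hν.isProbabilityMeasure
  refine martingale_of_setIntegral_eq_succ (fun n => ?_)
    (fun n => integrable_psiVersion hν (hW n) k) fun n s hs => ?_
  · refine Measurable.stronglyMeasurable ?_
    exact measurable_comap_restrict (measurable_psiVersion hν _ k)
      ((isTiltedGreen_greenVersion hν (Λ n)).psiOf_local k)
  · obtain ⟨t, ht, rfl⟩ := hs
    rw [setIntegral_psiVersion hν ht, setIntegral_psiVersion hν ht]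
    congr 2
    exact (map_withDensity_psiOf_eq hν (hΛ n.le_succ) (isTiltedGreen_greenVersion hν (Λ n))
      (isTiltedGreen_greenVersion hν (Λ (n + 1))) (hW n).1 (hW n).2 (hW (n + 1)).1
      (hW (n + 1)).2 k).symm

theorem ae_exists_tendsto_psiVersion (hν : IsPotentialLaw W ν) {Λ : ℕ → Finset V} (hΛ : Monotone Λ)
    (hW : ∀ n, IsWired W (Λ n)) (k : V) :
    ∀ᵐ β ∂ν, ∃ x : ℝ, Tendsto (fun n => psiVersion hν (Λ n) k β) atTop (𝓝 x) := by
  have := hν.isProbabilityMeasure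
  exact (martingale_psiVersion hν hΛ hW k).submartingale.exists_ae_tendsto_of_bdd (R := 1)
    fun n => by
      rw [eLpNorm_one_eq_lintegral_enorm]
      refine le_of_eq ((lintegral_congr_ae ?_).trans (lintegral_psiVersion hν (hW n) k))
      filter_upwards [psiVersion_nonneg hν (Λ n) k] with β hβ
      rw [Real.enorm_eq_ofReal hβ]

theorem lap_one (W : Conductances G) (S : Finset V) : lap W S (fun _ => 1) = 1 := by
  simp [lap]

/-- At l = 0 and θ = tδ_i the tilted identity reads E exp(-tψ(i) - t²g(i,i)/2) = e^{-t}; the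
nonnegative ψ is then dropped. -/
theorem exp_neg_le_lintegral_green (hν : IsPotentialLaw W ν) (S : Finset V) {i : V} (hi : i ∈ S)
    {t : ℝ} (ht : 0 ≤ t) : ENNReal.ofReal (Real.exp (-t)) ≤
      ∫⁻ β, ENNReal.ofReal (Real.exp (-(t ^ 2 / 2 * greenVersion hν S β i i))) ∂ν := by
  classical
  have h := isTiltedGreen_greenVersion hν S
  have h1 := h.tilt_eq (fun _ => 0) (Pi.single i t) (fun _ => le_rfl) fun j => by
    by_cases hj : j = i
    · subst hj; simpa using ht
    · simp [Pi.single_eq_of_ne hj]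
  rw [sum_single_mul hi] at h1
  simp only [add_zero, Real.sqrt_one, lap_one, one_mul, mul_one] at h1
  rw [← h1]
  refine lintegral_mono_ae ?_
  filter_upwards [h.isGreen] with β hβ
  rw [tiltExponent_single _ _ _ hi]
  refine ENNReal.ofReal_le_ofReal (Real.exp_le_exp.2 ?_)
  have := mul_nonneg ht (hβ.psiOf_nonneg i)
  simp only [zero_mul, Finset.sum_const_zero, neg_zero]
  linarith

theorem IsGreen.mono [Countable V] (hν : IsPotentialLaw W ν) :
    ∀ᵐ β ∂ν, ∀ S T : Finset V, S ⊆ T → ∀ i j,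
      greenVersion hν S β i j ≤ greenVersion hν T β i j := by
  filter_upwards [ae_isGreen hν, hν.pos] with β hβ hpos S T hST i j
  have := greenFin_mono W hST β i j
  rw [(hβ S).greenFin_eq hpos, (hβ T).greenFin_eq hpos] at this
  exact (ENNReal.ofReal_le_ofReal_iff ((hβ T).nonneg i j)).1 this

/-- On the event that the increasing diagonal is unbounded, exp(-t²g/2) tends to 0. By the reverse
Fatou lemma the event of boundedness has probability at least e^{-t} for every t > 0, hence 1. -/
theorem ae_bddAbove_green_diag [Countable V] (hν : IsPotentialLaw W ν) {Λ : ℕ → Finset V}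
    (hΛ : Monotone Λ) {i : V} (hi : ∃ n, i ∈ Λ n) :
    ∀ᵐ β ∂ν, ∃ C : ℝ, ∀ n, greenVersion hν (Λ n) β i i ≤ C := by
  have hprob := hν.isProbabilityMeasure
  obtain ⟨N, hN⟩ := hi
  set D : ℕ → (V → ℝ) → ℝ := fun n β => greenVersion hν (Λ n) β i i with hD
  have hDm : ∀ n, Measurable (D n) := fun n =>
    (isTiltedGreen_greenVersion hν (Λ n)).measurable i i
  set A : Set (V → ℝ) := {β | ∃ C : ℕ, ∀ n, D n β ≤ C} with hA
  have hAm : MeasurableSet A := by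
    have : A = ⋃ C : ℕ, ⋂ n, {β | D n β ≤ C} := by ext; simp [hA]
    rw [this]
    exact MeasurableSet.iUnion fun C => MeasurableSet.iInter fun n =>
      measurableSet_le (hDm n) measurable_const
  have hmono : ∀ᵐ β ∂ν, Monotone fun n => D n β := by
    filter_upwards [IsGreen.mono hν] with β hβ m n hmn using hβ _ _ (hΛ hmn) i i
  have hnn : ∀ᵐ β ∂ν, ∀ n, 0 ≤ D n β := by
    filter_upwards [ae_isGreen hν] with β hβ n using (hβ _).nonneg i i
  have key : ∀ t : ℝ, 0 < t → ENNReal.ofReal (Real.exp (-t)) ≤ ν A := by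
    intro t ht
    have h1 : ENNReal.ofReal (Real.exp (-t)) ≤ limsup (fun n => ∫⁻ β, ENNReal.ofReal
        (Real.exp (-(t ^ 2 / 2 * D n β))) ∂ν) atTop := by
      refine le_trans ?_ (liminf_le_limsup)
      refine le_liminf_of_le (by isBoundedDefault) ?_
      filter_upwards [eventually_ge_atTop N] with n hn
      exact exp_neg_le_lintegral_green hν (Λ n) (hΛ hn hN) ht.le
    refine h1.trans ?_
    have hle1 : ∀ n, ∀ᵐ β ∂ν, ENNReal.ofReal (Real.exp (-(t ^ 2 / 2 * D n β))) ≤ 1 := by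
      intro n
      filter_upwards [hnn] with β hβ
      rw [ENNReal.ofReal_le_one, Real.exp_le_one_iff]
      have := mul_nonneg (by positivity : 0 ≤ t ^ 2 / 2) (hβ n)
      linarith
    refine (limsup_lintegral_le (g := fun _ => 1) (fun n => ?_) hle1 (by simp)).trans ?_
    · have := hDm n
      fun_prop
    · rw [← lintegral_indicator_one hAm]
      refine lintegral_mono_ae ?_
      filter_upwards [hmono, ae_all_iff.2 hle1] with β hβ hβ1
      by_cases hβA : β ∈ A
      · rw [Set.indicator_of_mem hβA]
        refine limsup_le_of_le (by isBoundedDefault) (Eventually.of_forall fun n => hβ1 n)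
      · rw [Set.indicator_of_notMem hβA]
        have htop : Tendsto (fun n => D n β) atTop atTop := by
          refine tendsto_atTop_atTop_of_monotone hβ fun b => ?_
          by_contra! hcon
          obtain ⟨C, hC⟩ := exists_nat_ge b
          exact hβA ⟨C, fun n => (hcon n).le.trans hC⟩
        have h3 : Tendsto (fun n => ENNReal.ofReal (Real.exp (-(t ^ 2 / 2 * D n β)))) atTop
            (𝓝 0) := by
          rw [← ENNReal.ofReal_zero]
          refine ENNReal.tendsto_ofReal (Real.tendsto_exp_atBot.comp ?_)
          exact tendsto_neg_atTop_atBot.comp (htop.const_mul_atTop (by positivity))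
        rw [h3.limsup_eq]
  have h1 : 1 ≤ ν A := by
    have h2 : Tendsto (fun n : ℕ => ENNReal.ofReal (Real.exp (-(1 / (n + 1 : ℝ))))) atTop
        (𝓝 1) := by
      have h3 := (Real.continuous_exp.tendsto (-0)).comp
        (tendsto_one_div_add_atTop_nhds_zero_nat (𝕜 := ℝ)).neg
      have := ENNReal.tendsto_ofReal h3
      simpa using this
    exact le_of_tendsto h2 (Eventually.of_forall fun n => key _ (by positivity))
  have h2 : ∀ᵐ β ∂ν, β ∈ A := (mem_ae_iff_prob_eq_one hAm).2 (le_antisymm prob_le_one h1)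
  filter_upwards [h2] with β hβ
  obtain ⟨C, hC⟩ := hβ
  exact ⟨C, hC⟩

/-- The properties of almost every potential that are used in the analysis of `H_β`. -/
structure IsRegular (W : Conductances G) (Λ : ℕ → Finset V) (β : V → ℝ) : Prop where
  pos : ∀ i, 0 < β i
  ne_top : ∀ S i j, greenFin W S β i j ≠ ∞
  green_le : ∀ i j, ∃ C : ℝ, ∀ n, greenFin W (Λ n) β i j ≤ ENNReal.ofReal C
  psi_tendsto : ∀ i, ∃ x : ℝ, 0 ≤ x ∧
    Tendsto (fun n => psiFin W (Λ n) β i) atTop (𝓝 (ENNReal.ofReal x))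

theorem IsExhaustion.countable {Λ : ℕ → Finset V} (hΛ : IsExhaustion G Λ) : Countable V := by
  rw [← Set.countable_univ_iff]
  have : (Set.univ : Set V) = ⋃ n, (Λ n : Set V) := by
    ext v
    simpa using hΛ.exhausts v
  rw [this]
  exact Set.countable_iUnion fun n => (Λ n).countable_toSet

theorem IsExhaustion.isWired (hG : G.Connected) {Λ : ℕ → Finset V} (hΛ : IsExhaustion G Λ)
    (h : ∀ n, ∃ v, v ∉ Λ n) (n : ℕ) : IsWired W (Λ n) :=
  isWired_of_notMem hG (hΛ.connected n) (h n).choose_spec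

theorem ae_isRegular (hG : G.Connected) (hν : IsPotentialLaw W ν) {Λ : ℕ → Finset V}
    (hΛ : IsExhaustion G Λ) : ∀ᵐ β ∂ν, IsRegular W Λ β := by
  have := hΛ.countable
  have hψ : ∀ᵐ β ∂ν, ∀ i, ∃ x : ℝ, 0 ≤ x ∧
      Tendsto (fun n => psiFin W (Λ n) β i) atTop (𝓝 (ENNReal.ofReal x)) := by
    by_cases h : ∀ n, ∃ v, v ∉ Λ n
    · have h1 := ae_all_iff.2 fun k =>
        ae_exists_tendsto_psiVersion hν hΛ.mono (hΛ.isWired hG h) k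
      filter_upwards [h1, ae_isGreen hν, hν.pos] with β hβ hg hpos i
      obtain ⟨x, hx⟩ := hβ i
      refine ⟨x, ge_of_tendsto' hx fun n => (hg _).psiOf_nonneg i, ?_⟩
      refine (ENNReal.tendsto_ofReal hx).congr fun n => ?_
      exact ((hg (Λ n)).psiFin_eq hpos i).symm
    -- If the exhaustion reaches all of V, which happens for a finite graph, the sequence is
    -- eventually constant and no martingale is needed.
    · push Not at h
      obtain ⟨N, hN⟩ := h
      filter_upwards [ae_isGreen hν, hν.pos] with β hg hpos i
      refine ⟨_, (hg (Λ N)).psiOf_nonneg i, ?_⟩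
      refine tendsto_const_nhds.congr' ?_
      filter_upwards [eventually_ge_atTop N] with n hn
      have : Λ n = Λ N := Finset.Subset.antisymm (fun v _ => hN v) (hΛ.mono hn)
      rw [this, (hg (Λ N)).psiFin_eq hpos i]
  have hd := ae_all_iff.2 fun i => ae_bddAbove_green_diag hν hΛ.mono (hΛ.exhausts i)
  filter_upwards [hψ, hd, ae_isGreen hν, hν.pos] with β h1 h2 hg hpos
  refine ⟨hpos, fun S i j => ?_, fun i j => ?_, h1⟩
  · rw [(hg S).greenFin_eq hpos]
    exact ENNReal.ofReal_ne_top
  · obtain ⟨C, hC⟩ := h2 i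
    obtain ⟨C', hC'⟩ := h2 j
    refine ⟨(C + C') / 2, fun n => ?_⟩
    rw [(hg (Λ n)).greenFin_eq hpos]
    refine ENNReal.ofReal_le_ofReal (((hg (Λ n)).le_half_add i j).trans ?_)
    linarith [hC n, hC' n]

variable {Λ : ℕ → Finset V} {β : V → ℝ}

theorem IsRegular.isGreen (h : IsRegular W Λ β) (S : Finset V) :
    IsGreen W S β fun i j => (greenFin W S β i j).toReal :=
  isGreen_toReal_greenFin h.pos fun i j => h.ne_top S i j

theorem IsRegular.tendsto_green (h : IsRegular W Λ β) (hΛ : Monotone Λ) (i j : V) :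
    Tendsto (fun n => greenFin W (Λ n) β i j) atTop (𝓝 (ENNReal.ofReal (green W Λ β i j))) := by
  have h1 : Tendsto (fun n => greenFin W (Λ n) β i j) atTop
      (𝓝 (⨆ n, greenFin W (Λ n) β i j)) :=
    tendsto_atTop_iSup fun m n hmn => greenFin_mono W (hΛ hmn) β i j
  have h2 : (⨆ n, greenFin W (Λ n) β i j) ≠ ∞ := by
    obtain ⟨C, hC⟩ := h.green_le i j
    exact ne_top_of_le_ne_top ENNReal.ofReal_ne_top (iSup_le hC)
  rw [green, h1.limUnder_eq, ENNReal.ofReal_toReal h2]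
  exact h1

theorem IsRegular.tendsto_psi (h : IsRegular W Λ β) (i : V) :
    Tendsto (fun n => psiFin W (Λ n) β i) atTop (𝓝 (ENNReal.ofReal (psi W Λ β i))) := by
  obtain ⟨x, hx, h1⟩ := h.psi_tendsto i
  rw [psi, h1.limUnder_eq, ENNReal.toReal_ofReal hx]
  exact h1

theorem psi_nonneg (W : Conductances G) (Λ : ℕ → Finset V) (β : V → ℝ) (i : V) :
    0 ≤ psi W Λ β i := ENNReal.toReal_nonneg

theorem green_nonneg (W : Conductances G) (Λ : ℕ → Finset V) (β : V → ℝ) (i j : V) :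
    0 ≤ green W Λ β i j := ENNReal.toReal_nonneg

/-- Limit of the first-step equation, which holds at i as soon as i belongs to Λ n. Local finiteness
makes the sum finite, so the limit passes inside. -/
theorem IsRegular.schrodinger_psi (h : IsRegular W Λ β) (hΛ : IsExhaustion G Λ) (i : V) :
    schrodinger W β (psi W Λ β) i = 0 := by
  have hb := h.pos i
  obtain ⟨N, hN⟩ := hΛ.exhausts i
  have h1 : Tendsto (fun n => ∑ k ∈ G.neighborFinset i,
      ENNReal.ofReal (W.weight i k / (2 * β i)) * psiFin W (Λ n) β k) atTop
      (𝓝 (∑ k ∈ G.neighborFinset i,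
        ENNReal.ofReal (W.weight i k / (2 * β i)) * ENNReal.ofReal (psi W Λ β k))) :=
    tendsto_finsetSum _ fun k _ => ENNReal.Tendsto.const_mul (h.tendsto_psi k)
      (Or.inr ENNReal.ofReal_ne_top)
  have h2 := tendsto_nhds_unique_of_eventuallyEq (h.tendsto_psi i) h1 (by
    filter_upwards [eventually_ge_atTop N] with n hn
    exact psiFin_firstStep W (Λ n) h.pos (hΛ.mono hn hN))
  rw [sum_ofReal_weight_div_mul h.pos i fun k => psi_nonneg W Λ β k] at h2
  have h3 : 0 ≤ ∑ k ∈ G.neighborFinset i, W.weight i k * psi W Λ β k :=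
    Finset.sum_nonneg fun k _ => mul_nonneg (W.weight_nonneg _ _) (psi_nonneg W Λ β k)
  rw [ENNReal.ofReal_eq_ofReal_iff (psi_nonneg W Λ β i) (by positivity),
    eq_div_iff (by positivity)] at h2
  rw [schrodinger, sub_eq_zero, smul_eq_mul, mul_comm, h2]
  refine Finset.sum_congr rfl fun k hk => ?_
  rw [W.weight_of_adj ((G.mem_neighborFinset i k).1 hk), smul_eq_mul]

end Convergence

/-! ### Positivity and recovery of decaying functions from H_β -/

section Spectrum
set_option linter.unusedSectionVars false
variable {V : Type*} {G : SimpleGraph V} [G.LocallyFinite] {W : Conductances G}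

/-- The walk sum for the smaller potential satisfies its own first-step equation, hence is a
supersolution for the larger one. -/
theorem greenFin_anti (W : Conductances G) (S : Finset V) {β β' : V → ℝ} (hβ : ∀ i, 0 < β i)
    (h : ∀ i, β i ≤ β' i) (i j : V) : greenFin W S β' i j ≤ greenFin W S β i j := by
  classical
  refine greenFin_le_of_supersolution W S (fun i => (hβ i).trans_le (h i)) j
    (fun i => greenFin W S β i j) (fun i hi => ?_) i
  rw [greenFin_firstStep W S hβ hi j]
  have h2 : ∀ i, 0 < 2 * β i := fun i => by linarith [hβ i]
  refine add_le_add ?_ (Finset.sum_le_sum fun k _ => ?_)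
  · split_ifs
    · exact ENNReal.ofReal_le_ofReal
        (one_div_le_one_div_of_le (h2 i) (by linarith [h i]))
    · exact le_rfl
  · gcongr
    · exact W.weight_nonneg i k
    · exact h2 i
    · exact h i

theorem psiFin_anti (W : Conductances G) (S : Finset V) {β β' : V → ℝ} (hβ : ∀ i, 0 < β i)
    (h : ∀ i, β i ≤ β' i) (i : V) : psiFin W S β' i ≤ psiFin W S β i := by
  refine psiFin_le_of_supersolution W S (fun i => (hβ i).trans_le (h i)) (fun i => psiFin W S β i)
    (fun i hi => (psiFin_of_notMem W β hi).ge) (fun i hi => ?_) i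
  rw [psiFin_firstStep W S hβ hi]
  have h2 : ∀ i, 0 < 2 * β i := fun i => by linarith [hβ i]
  refine Finset.sum_le_sum fun k _ => ?_
  gcongr
  · exact W.weight_nonneg i k
  · exact h2 i
  · exact h i

theorem schrodinger_eq_weight (W : Conductances G) (β : V → ℝ) {E : Type*} [AddCommGroup E]
    [Module ℝ E] (f : V → E) (i : V) :
    schrodinger W β f i = (2 * β i) • f i - ∑ j ∈ G.neighborFinset i, W.weight i j • f j := by
  rw [schrodinger]
  congr 1
  refine Finset.sum_congr rfl fun j hj => ?_
  rw [W.weight_of_adj ((G.mem_neighborFinset i j).1 hj)]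

/-- The diagonal of H_β is 2β, so adding ε to the operator means adding ε/2 to the potential; this
explains the recurrent β + ε/2. -/
theorem schrodinger_shift (W : Conductances G) (β : V → ℝ) (ε : ℝ) {E : Type*} [AddCommGroup E]
    [Module ℝ E] (f : V → E) :
    schrodinger W (fun i => β i + ε / 2) f = schrodinger W β f + ε • f := by
  funext i
  simp only [schrodinger, Pi.add_apply, Pi.smul_apply]
  rw [show 2 * (β i + ε / 2) = 2 * β i + ε by ring, add_smul]
  abel

/-- By Green's representation the error only involves f outside Λ n, through edges leaving Λ n. It
is at most the supremum of |f| there times the boundary sum at i, which is ψ of the set and bounded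
by assumption. -/
theorem IsGreen.tendsto_sum_schrodinger {E : Type*} [NormedAddCommGroup E] [NormedSpace ℝ E]
    {Λ : ℕ → Finset V} {β : V → ℝ} {g : ℕ → V → V → ℝ} (hΛ : IsExhaustion G Λ)
    (hg : ∀ n, IsGreen W (Λ n) β (g n)) {i : V} {C : ℝ}
    (hC : ∀ n, ∑ k ∈ Λ n, g n i k * boundaryWeight W (Λ n) k ≤ C) {f : V → E}
    (hf : Tendsto f cofinite (𝓝 0)) :
    Tendsto (fun n => ∑ k ∈ Λ n, g n k i • schrodinger W β f k) atTop (𝓝 (f i)) := by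
  classical
  obtain ⟨N, hN⟩ := hΛ.exhausts i
  have hC0 : 0 ≤ C := le_trans (Finset.sum_nonneg fun k _ =>
    mul_nonneg ((hg 0).nonneg _ _) (boundaryWeight_nonneg W _ _)) (hC 0)
  rw [Metric.tendsto_atTop]
  intro δ hδ
  set δ' : ℝ := δ / (C + 1) with hδ'
  have hδ'0 : 0 < δ' := by positivity
  have hfin : {v | ¬ ‖f v‖ < δ'}.Finite := by
    have := (Metric.tendsto_nhds.1 hf) δ' hδ'0
    simpa [Filter.eventually_cofinite] using this
  have hsub : ∃ M, hfin.toFinset ⊆ Λ M := by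
    choose m hm using hΛ.exhausts
    refine ⟨hfin.toFinset.sup m, fun v hv => hΛ.mono (Finset.le_sup hv) (hm v)⟩
  obtain ⟨M, hM⟩ := hsub
  refine ⟨max N M, fun n hn => ?_⟩
  have hi : i ∈ Λ n := hΛ.mono (le_of_max_le_left hn) hN
  have hsmall : ∀ v ∉ Λ n, ‖f v‖ ≤ δ' := fun v hv => by
    by_contra hcon
    exact hv (hΛ.mono (le_of_max_le_right hn) (hM (hfin.mem_toFinset.2 fun h => hcon h.le)))
  have hsplit : ∑ k ∈ Λ n, g n k i • schrodinger W β f k - f i =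
      -∑ k ∈ Λ n, g n k i • ∑ l ∈ G.neighborFinset k with l ∉ Λ n, W.weight k l • f l := by
    rw [← (hg n).sum_smul f hi, ← Finset.sum_sub_distrib, ← Finset.sum_neg_distrib]
    refine Finset.sum_congr rfl fun k _ => ?_
    rw [schrodinger_eq_weight, sum_neighborFinset_split W (Λ n) f k, ← smul_sub, ← smul_neg]
    congr 1
    abel
  rw [dist_eq_norm, hsplit, norm_neg]
  calc ‖∑ k ∈ Λ n, g n k i • ∑ l ∈ G.neighborFinset k with l ∉ Λ n, W.weight k l • f l‖
      ≤ ∑ k ∈ Λ n, g n i k * boundaryWeight W (Λ n) k * δ' := by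
        refine (norm_sum_le _ _).trans (Finset.sum_le_sum fun k _ => ?_)
        rw [norm_smul, Real.norm_of_nonneg ((hg n).nonneg _ _), (hg n).symm k i, mul_assoc]
        refine mul_le_mul_of_nonneg_left ?_ ((hg n).nonneg _ _)
        rw [boundaryWeight, Finset.sum_mul]
        refine (norm_sum_le _ _).trans (Finset.sum_le_sum fun l hl => ?_)
        rw [norm_smul, Real.norm_of_nonneg (W.weight_nonneg _ _)]
        exact mul_le_mul_of_nonneg_left (hsmall l (Finset.mem_filter.1 hl).2) (W.weight_nonneg _ _)
    _ ≤ C * δ' := by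
        rw [← Finset.sum_mul]
        exact mul_le_mul_of_nonneg_right (hC n) hδ'0.le
    _ < δ := by
        rw [hδ', mul_div_assoc', div_lt_iff₀ (by positivity)]
        nlinarith

theorem tendsto_cofinite_L2 (f : L2 V) : Tendsto (f : V → ℂ) cofinite (𝓝 0) := by
  have h := (lp.memℓp f).summable (by norm_num)
  have h1 := h.tendsto_cofinite_zero
  rw [tendsto_zero_iff_norm_tendsto_zero]
  have h2 : Tendsto (fun i => Real.sqrt (‖(f : V → ℂ) i‖ ^ 2)) cofinite (𝓝 (Real.sqrt 0)) := by
    refine (Real.continuous_sqrt.tendsto _).comp ?_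
    simpa using h1
  simpa [Real.sqrt_sq (norm_nonneg _)] using h2

theorem schrodinger_finite_support (W : Conductances G) (β : V → ℝ) (F : V →₀ ℂ) :
    (Function.support (schrodinger W β (F : V → ℂ))).Finite := by
  classical
  refine ((F.support ∪ F.support.biUnion fun v => G.neighborFinset v).finite_toSet).subset ?_
  intro i hi
  by_contra hcon
  simp only [Finset.coe_union, Finset.coe_biUnion, Set.mem_union, Finset.mem_coe, not_or,
    Finsupp.mem_support_iff, not_not, Set.mem_iUnion, not_exists,
    SimpleGraph.mem_neighborFinset] at hcon
  refine hi ?_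
  rw [schrodinger, hcon.1, smul_zero, zero_sub, neg_eq_zero]
  refine Finset.sum_eq_zero fun j hj => ?_
  by_cases hFj : F j = 0
  · rw [hFj, smul_zero]
  · exact absurd ((G.mem_neighborFinset i j).1 hj).symm (hcon.2 j hFj)

theorem memℓp_of_finite_support {f : V → ℂ} (hf : (Function.support f).Finite) : Memℓp f 2 := by
  refine (memℓp_zero ?_).of_exponent_ge zero_le
  exact hf

/-- Finitely supported functions as elements of `ℓ²(V)`. -/
def finsuppToL2 : (V →₀ ℂ) →ₗ[ℂ] L2 V where
  toFun F := ⟨(F : V → ℂ), memℓp_of_finite_support F.hasFiniteSupport⟩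
  map_add' _ _ := rfl
  map_smul' _ _ := rfl

/-- `H_β` on finitely supported functions. -/
def schrodingerFinsupp (W : Conductances G) (β : V → ℝ) : (V →₀ ℂ) →ₗ[ℂ] L2 V where
  toFun F := ⟨schrodinger W β (F : V → ℂ),
    memℓp_of_finite_support (schrodinger_finite_support W β F)⟩
  map_add' F F' := Subtype.ext (schrodinger_add W β (F : V → ℂ) (F' : V → ℂ))
  map_smul' c F := Subtype.ext (schrodinger_smul W β c (F : V → ℂ))

theorem inner_real_smul_left_eq (r : ℝ) (x y : ℂ) : inner ℂ (r • x) y = inner ℂ x (r • y) := by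
  simp only [RCLike.inner_apply, Complex.real_smul, map_mul, Complex.conj_ofReal]
  ring

/-- Summation by parts, legitimate against any u in ℓ², whether or not H_β u is in ℓ²: only the
finite neighbourhood B of the support of F contributes. -/
theorem inner_schrodingerFinsupp (W : Conductances G) (β : V → ℝ) (F : V →₀ ℂ) (u : L2 V) :
    inner ℂ (schrodingerFinsupp W β F) u =
      ∑ a ∈ F.support, inner ℂ (F a) (schrodinger W β (u : V → ℂ) a) := by
  classical
  set S := F.support with hS
  set B := S ∪ S.biUnion fun v => G.neighborFinset v with hB
  have hSB : S ⊆ B := Finset.subset_union_left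
  have hNB : ∀ a ∈ S, G.neighborFinset a ⊆ B := fun a ha =>
    (Finset.subset_biUnion_of_mem (fun v => G.neighborFinset v) ha).trans Finset.subset_union_right
  have hF0 : ∀ a ∉ S, F a = 0 := fun a ha => Finsupp.notMem_support_iff.1 ha
  have hval : ∀ a, (schrodingerFinsupp W β F : V → ℂ) a =
      (2 * β a) • F a - ∑ j ∈ S, W.weight a j • F j := fun a => by
    rw [← sum_neighborFinset_eq_of_support W S (F : V → ℂ) a hF0, ← schrodinger_eq_weight]
    rfl
  have hzero : ∀ a ∉ B, (schrodingerFinsupp W β F : V → ℂ) a = 0 := fun a ha => by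
    rw [hval, hF0 a fun h => ha (hSB h), smul_zero, zero_sub, neg_eq_zero]
    refine Finset.sum_eq_zero fun j hj => ?_
    rw [W.weight_of_not_adj, zero_smul]
    exact fun h => ha (hNB j hj ((G.mem_neighborFinset j a).2 h.symm))
  rw [lp.inner_eq_tsum, tsum_eq_sum (s := B) fun a ha => by rw [hzero a ha, inner_zero_left]]
  have hu : ∀ a ∈ S, schrodinger W β (u : V → ℂ) a =
      (2 * β a) • (u : V → ℂ) a - ∑ b ∈ B, W.weight a b • (u : V → ℂ) b := fun a ha => by
    rw [schrodinger_eq_weight]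
    congr 1
    refine Finset.sum_subset (hNB a ha) fun b _ hb => ?_
    rw [W.weight_of_not_adj fun h => hb ((G.mem_neighborFinset a b).2 h), zero_smul]
  have h1 : ∑ a ∈ B, inner ℂ ((2 * β a) • F a) ((u : V → ℂ) a) =
      ∑ a ∈ S, inner ℂ (F a) ((2 * β a) • (u : V → ℂ) a) := by
    rw [← Finset.sum_subset hSB fun a _ ha => by rw [hF0 a ha, smul_zero, inner_zero_left]]
    exact Finset.sum_congr rfl fun a _ => inner_real_smul_left_eq _ _ _
  have h2 : ∑ a ∈ B, inner ℂ (∑ j ∈ S, W.weight a j • F j) ((u : V → ℂ) a) =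
      ∑ j ∈ S, inner ℂ (F j) (∑ a ∈ B, W.weight j a • (u : V → ℂ) a) := by
    simp_rw [sum_inner, inner_sum]
    rw [Finset.sum_comm]
    refine Finset.sum_congr rfl fun j _ => Finset.sum_congr rfl fun a _ => ?_
    rw [W.weight_symm a j]
    exact inner_real_smul_left_eq _ _ _
  rw [Finset.sum_congr rfl fun a _ => by rw [hval a, inner_sub_left], Finset.sum_sub_distrib, h1,
    h2, ← Finset.sum_sub_distrib]
  refine Finset.sum_congr rfl fun a ha => ?_
  rw [hu a ha, inner_sub_right]

theorem inner_finsuppToL2 (F : V →₀ ℂ) (u : L2 V) :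
    inner ℂ (finsuppToL2 F) u = ∑ a ∈ F.support, inner ℂ (F a) ((u : V → ℂ) a) := by
  rw [lp.inner_eq_tsum]
  refine tsum_eq_sum fun a ha => ?_
  have : (finsuppToL2 F : V → ℂ) a = 0 := Finsupp.notMem_support_iff.1 ha
  rw [this, inner_zero_left]

/-- The support lies in some Λ M, and the form is the sum of the forms of the real and imaginary
parts, each nonnegative by `IsGreen.form_nonneg`. -/
theorem re_inner_schrodingerFinsupp_nonneg {β : V → ℝ} {Λ : ℕ → Finset V} (hΛ : IsExhaustion G Λ)
    {g : ℕ → V → V → ℝ} (hg : ∀ n, IsGreen W (Λ n) β (g n)) (F : V →₀ ℂ) :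
    0 ≤ (inner ℂ (schrodingerFinsupp W β F) (finsuppToL2 F)).re := by
  classical
  have hsub : ∃ M, F.support ⊆ Λ M := by
    choose m hm using hΛ.exhausts
    exact ⟨F.support.sup m, fun v hv => hΛ.mono (Finset.le_sup hv) (hm v)⟩
  obtain ⟨M, hM⟩ := hsub
  have hF0 : ∀ a ∉ Λ M, F a = 0 := fun a ha => Finsupp.notMem_support_iff.1 fun h => ha (hM h)
  have h1 := (hg M).form_nonneg fun a => (F a).re
  have h2 := (hg M).form_nonneg fun a => (F a).im
  rw [inner_schrodingerFinsupp, Finset.sum_subset hM fun a _ ha => by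
    rw [Finsupp.notMem_support_iff.1 ha, inner_zero_left]]
  have h3 : (∑ a ∈ Λ M, inner ℂ (F a) (schrodinger W β (finsuppToL2 F : V → ℂ) a)).re =
      (∑ a ∈ Λ M, 2 * β a * (F a).re ^ 2 -
        ∑ a ∈ Λ M, ∑ b ∈ Λ M, W.weight a b * ((F a).re * (F b).re)) +
      (∑ a ∈ Λ M, 2 * β a * (F a).im ^ 2 -
        ∑ a ∈ Λ M, ∑ b ∈ Λ M, W.weight a b * ((F a).im * (F b).im)) := by
    rw [Complex.re_sum, ← Finset.sum_sub_distrib, ← Finset.sum_sub_distrib,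
      ← Finset.sum_add_distrib]
    refine Finset.sum_congr rfl fun a _ => ?_
    have h4 : schrodinger W β (finsuppToL2 F : V → ℂ) a =
        (2 * β a) • F a - ∑ b ∈ Λ M, W.weight a b • F b := by
      rw [← sum_neighborFinset_eq_of_support W (Λ M) (F : V → ℂ) a hF0, ← schrodinger_eq_weight]
      rfl
    have h5 : ∑ b ∈ Λ M, W.weight a b * ((F a).re * (F b).re) =
      (F a).re * ∑ b ∈ Λ M, W.weight a b * (F b).re := by
      rw [Finset.mul_sum]; exact Finset.sum_congr rfl fun b _ => by ring
    have h6 : ∑ b ∈ Λ M, W.weight a b * ((F a).im * (F b).im) =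
      (F a).im * ∑ b ∈ Λ M, W.weight a b * (F b).im := by
      rw [Finset.mul_sum]; exact Finset.sum_congr rfl fun b _ => by ring
    rw [h4, h5, h6]
    simp only [RCLike.inner_apply, Complex.mul_re, Complex.sub_re, Complex.sub_im, Complex.re_sum,
      Complex.im_sum, Complex.real_smul, Complex.ofReal_re, Complex.ofReal_im, Complex.mul_im,
      Complex.conj_re, Complex.conj_im, zero_mul, sub_zero, add_zero]
    ring
  rw [h3]
  linarith

end Spectrum

/-! ### The resolvent, the spectrum and the limit of the entries -/

section Resolvent
set_option linter.unusedSectionVars false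
variable {V : Type*} {G : SimpleGraph V} [G.LocallyFinite] {W : Conductances G}

theorem continuous_coe_L2 (i : V) : Continuous fun f : L2 V => (f : V → ℂ) i :=
  (continuous_apply i).comp lp.uniformContinuous_coe.continuous

theorem schrodingerFinsupp_shift (W : Conductances G) (β : V → ℝ) (ε : ℝ) (F : V →₀ ℂ) :
    schrodingerFinsupp W (fun i => β i + ε / 2) F =
      schrodingerFinsupp W β F + (ε : ℂ) • finsuppToL2 F := by
  refine Subtype.ext ?_
  refine (schrodinger_shift W β ε (F : V → ℂ)).trans ?_
  funext i
  change _ + ε • F i = _ + (ε : ℂ) * F i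
  rw [Complex.real_smul]
  rfl

/-- `(f, g)` is in the closure of the graph of `H_β` on finitely supported functions. -/
def IsLimitPair (W : Conductances G) (β : V → ℝ) (f g : L2 V) : Prop :=
  ∃ F : ℕ → V →₀ ℂ, Tendsto (fun n => finsuppToL2 (F n)) atTop (𝓝 f) ∧
    Tendsto (fun n => schrodingerFinsupp W β (F n)) atTop (𝓝 g)

variable {β : V → ℝ} {f g f' g' : L2 V}

theorem IsLimitPair.schrodinger_eq (h : IsLimitPair W β f g) :
    schrodinger W β (f : V → ℂ) = g := by
  obtain ⟨F, h1, h2⟩ := h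
  have hc : ∀ i, Tendsto (fun n => F n i) atTop (𝓝 ((f : V → ℂ) i)) := fun i =>
    ((continuous_coe_L2 i).tendsto f).comp h1
  funext i
  refine tendsto_nhds_unique (f := fun n => schrodinger W β (F n : V → ℂ) i) ?_
    (((continuous_coe_L2 i).tendsto g).comp h2)
  exact ((hc i).const_smul _).sub (tendsto_finsetSum _ fun j _ => (hc j).const_smul _)

theorem IsLimitPair.add (h : IsLimitPair W β f g) (h' : IsLimitPair W β f' g') :
    IsLimitPair W β (f + f') (g + g') := by
  obtain ⟨F, h1, h2⟩ := h
  obtain ⟨F', h1', h2'⟩ := h'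
  refine ⟨fun n => F n + F' n, ?_, ?_⟩
  · simpa only [map_add] using h1.add h1'
  · simpa only [map_add] using h2.add h2'

theorem IsLimitPair.smul (c : ℂ) (h : IsLimitPair W β f g) :
    IsLimitPair W β (c • f) (c • g) := by
  obtain ⟨F, h1, h2⟩ := h
  refine ⟨fun n => c • F n, ?_, ?_⟩
  · simpa only [map_smul] using h1.const_smul c
  · simpa only [map_smul] using h2.const_smul c

theorem IsLimitPair.inner_eq (h : IsLimitPair W β f g) (h' : IsLimitPair W β f' g') :
    inner ℂ f g' = inner ℂ g f' := by
  obtain ⟨F, h1, h2⟩ := h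
  obtain ⟨F', h1', h2'⟩ := h'
  refine tendsto_nhds_unique (h1.inner h2') ((h2.inner h1').congr fun n => ?_)
  rw [inner_schrodingerFinsupp, inner_finsuppToL2]
  rfl

theorem inner_schrodingerFinsupp_ge (h : ∀ F, 0 ≤ (inner ℂ (schrodingerFinsupp W β F)
    (finsuppToL2 F)).re) (ε : ℝ) (F : V →₀ ℂ) :
    ε * ‖finsuppToL2 F‖ ^ 2 ≤
      (inner ℂ (schrodingerFinsupp W (fun i => β i + ε / 2) F) (finsuppToL2 F)).re := by
  rw [schrodingerFinsupp_shift, inner_add_left, inner_smul_left, Complex.add_re,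
    inner_self_eq_norm_sq_to_K, Complex.conj_ofReal]
  have h1 := h F
  have h2 : ((ε : ℂ) * ((‖finsuppToL2 F‖ : ℝ) : ℂ) ^ 2).re = ε * ‖finsuppToL2 F‖ ^ 2 := by
    norm_cast
  change _ ≤ _ + ((ε : ℂ) * ((‖finsuppToL2 F‖ : ℝ) : ℂ) ^ 2).re
  rw [h2]
  linarith

variable {ε : ℝ}

theorem IsLimitPair.inner_ge (h0 : ∀ F, 0 ≤ (inner ℂ (schrodingerFinsupp W β F)
    (finsuppToL2 F)).re) (h : IsLimitPair W (fun i => β i + ε / 2) f g) :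
    ε * ‖f‖ ^ 2 ≤ (inner ℂ g f).re := by
  obtain ⟨F, h1, h2⟩ := h
  exact le_of_tendsto_of_tendsto' ((h1.norm.pow 2).const_mul ε)
    ((Complex.continuous_re.tendsto _).comp (h2.inner h1))
    fun n => inner_schrodingerFinsupp_ge h0 ε (F n)

theorem norm_finsuppToL2_le (h0 : ∀ F, 0 ≤ (inner ℂ (schrodingerFinsupp W β F)
    (finsuppToL2 F)).re) (F : V →₀ ℂ) :
    ε * ‖finsuppToL2 F‖ ≤ ‖schrodingerFinsupp W (fun i => β i + ε / 2) F‖ := by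
  have h1 := inner_schrodingerFinsupp_ge h0 ε F
  have h2 := (Complex.re_le_norm _).trans
    (norm_inner_le_norm (𝕜 := ℂ) (schrodingerFinsupp W (fun i => β i + ε / 2) F) (finsuppToL2 F))
  rcases (norm_nonneg (finsuppToL2 F)).eq_or_lt with h3 | h3
  · rw [← h3, mul_zero]; exact norm_nonneg _
  · refine le_of_mul_le_mul_right ?_ h3
    linarith [h1.trans h2, sq (‖finsuppToL2 F‖)]

/-- Testing orthogonality against the images of point masses shows that a vector orthogonal to the
range is an ℓ² solution of H_β u = 0. -/
theorem dense_range_schrodingerFinsupp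
    (hinj : ∀ u : L2 V, schrodinger W β (u : V → ℂ) = 0 → u = 0) :
    Dense (LinearMap.range (schrodingerFinsupp W β) : Set (L2 V)) := by
  rw [Submodule.dense_iff_topologicalClosure_eq_top, Submodule.topologicalClosure_eq_top_iff,
    Submodule.eq_bot_iff]
  intro u hu
  refine hinj u (funext fun i => ?_)
  have h1 : inner ℂ (schrodingerFinsupp W β (Finsupp.single i 1)) u = 0 :=
    Submodule.inner_right_of_mem_orthogonal (LinearMap.mem_range_self _ _) hu
  rw [inner_schrodingerFinsupp, Finsupp.support_single i one_ne_zero, Finset.sum_singleton,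
    Finsupp.single_eq_same] at h1
  simpa using h1

/-- The range is dense, and the lower bound ε‖F‖ ≤ ‖(H_β + ε)F‖ makes preimages of a convergent
sequence Cauchy. -/
theorem exists_isLimitPair (hε : 0 < ε) (h0 : ∀ F, 0 ≤ (inner ℂ (schrodingerFinsupp W β F)
    (finsuppToL2 F)).re)
    (hinj : ∀ u : L2 V, schrodinger W (fun i => β i + ε / 2) (u : V → ℂ) = 0 → u = 0)
    (g : L2 V) : ∃ f, IsLimitPair W (fun i => β i + ε / 2) f g := by
  have hmem : g ∈ closure (LinearMap.range (schrodingerFinsupp W fun i => β i + ε / 2) :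
      Set (L2 V)) := dense_range_schrodingerFinsupp hinj g
  obtain ⟨y, hy, hlim⟩ := mem_closure_iff_seq_limit.1 hmem
  choose F hF using hy
  have hlim' : Tendsto (fun n => schrodingerFinsupp W (fun i => β i + ε / 2) (F n)) atTop
      (𝓝 g) := by simpa only [hF] using hlim
  have hcauchy : CauchySeq fun n => finsuppToL2 (F n) := by
    rw [Metric.cauchySeq_iff]
    intro δ hδ
    obtain ⟨N, hN⟩ := Metric.cauchySeq_iff.1 hlim'.cauchySeq (ε * δ) (by positivity)
    refine ⟨N, fun m hm n hn => ?_⟩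
    have h1 := hN m hm n hn
    rw [dist_eq_norm, ← map_sub] at h1 ⊢
    have h2 := norm_finsuppToL2_le (ε := ε) h0 (F m - F n)
    exact lt_of_mul_lt_mul_left (h2.trans_lt h1) hε.le
  obtain ⟨f, hf⟩ := cauchySeq_tendsto_of_complete hcauchy
  exact ⟨f, F, hf, hlim'⟩

theorem exists_resolvent (hε : 0 < ε) (h0 : ∀ F, 0 ≤ (inner ℂ (schrodingerFinsupp W β F)
    (finsuppToL2 F)).re)
    (hinj : ∀ u : L2 V, schrodinger W (fun i => β i + ε / 2) (u : V → ℂ) = 0 → u = 0) :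
    ∃ R : L2 V →L[ℂ] L2 V, ∀ g, IsLimitPair W (fun i => β i + ε / 2) (R g) g := by
  -- Uniqueness comes from injectivity on all of ℓ², and makes the chosen preimage linear in g.
  have huniq : ∀ {f f' g : L2 V}, IsLimitPair W (fun i => β i + ε / 2) f g →
      IsLimitPair W (fun i => β i + ε / 2) f' g → f = f' := fun {f f' g} h h' => by
    have h1 := (h.add (h'.smul (-1))).schrodinger_eq
    rw [neg_one_smul, neg_one_smul, add_neg_cancel, ← sub_eq_add_neg] at h1
    exact sub_eq_zero.1 (hinj _ h1)
  choose R hR using exists_isLimitPair hε h0 hinj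
  refine ⟨LinearMap.mkContinuous
    { toFun := R
      map_add' := fun g g' => huniq (hR _) ((hR g).add (hR g'))
      map_smul' := fun c g => huniq (hR _) ((hR g).smul c) } ε⁻¹ fun g => ?_, hR⟩
  have h1 := (hR g).inner_ge h0
  have h2 := (Complex.re_le_norm _).trans (norm_inner_le_norm (𝕜 := ℂ) g (R g))
  change ‖R g‖ ≤ ε⁻¹ * ‖g‖
  rw [inv_mul_eq_div, le_div_iff₀' hε]
  rcases (norm_nonneg (R g)).eq_or_lt with h3 | h3
  · rw [← h3, mul_zero]; exact norm_nonneg _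
  · refine le_of_mul_le_mul_right ?_ h3
    linarith [h1.trans h2, sq (‖R g‖)]

/-- The inverse was built from finitely supported functions, while the operator has its maximal
domain. Injectivity on ℓ² identifies the two, which is the essential self-adjointness at work here.
-/
theorem isResolventAt_of_isLimitPair {R : L2 V →L[ℂ] L2 V}
    (hinj : ∀ u : L2 V, schrodinger W (fun i => β i + ε / 2) (u : V → ℂ) = 0 → u = 0)
    (hR : ∀ g, IsLimitPair W (fun i => β i + ε / 2) (R g) g) :
    IsResolventAt (schrodingerOp W β) (-(ε : ℂ)) R := by
  have key : ∀ u : L2 V, schrodinger W (fun i => β i + ε / 2) (u : V → ℂ) =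
      schrodinger W β (u : V → ℂ) + ((ε : ℂ) • u : L2 V) := fun u => by
    rw [schrodinger_shift]
    rfl
  constructor
  · intro g
    have h1 := (hR g).schrodinger_eq
    rw [key] at h1
    have h2 : schrodinger W β (R g : V → ℂ) = (g - (ε : ℂ) • R g : L2 V) :=
      eq_sub_of_add_eq h1
    refine ⟨?_, ?_⟩
    · change Memℓp (schrodinger W β (R g : V → ℂ)) 2
      rw [h2]
      exact lp.memℓp _
    · refine Subtype.ext ?_
      change schrodinger W β (R g : V → ℂ) - ((-(ε : ℂ) • R g : L2 V) : V → ℂ) = g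
      rw [h2, neg_smul]
      change ((g - (ε : ℂ) • R g - -((ε : ℂ) • R g) : L2 V) : V → ℂ) = g
      rw [sub_neg_eq_add, sub_add_cancel]
  · intro f
    have h1 := (hR (schrodingerOp W β f - (-(ε : ℂ)) • (f : L2 V))).schrodinger_eq
    refine sub_eq_zero.1 (hinj _ ?_)
    have h2 : schrodinger W (fun i => β i + ε / 2) ((f : L2 V) : V → ℂ) =
        (schrodingerOp W β f - (-(ε : ℂ)) • (f : L2 V) : L2 V) := by
      rw [key, neg_smul, sub_neg_eq_add]
      rfl
    have h3 : ((R (schrodingerOp W β f - (-(ε : ℂ)) • (f : L2 V)) - f : L2 V) : V → ℂ) =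
        (R (schrodingerOp W β f - (-(ε : ℂ)) • (f : L2 V)) : V → ℂ) +
          (-1 : ℂ) • ((f : L2 V) : V → ℂ) := by
      rw [neg_one_smul, ← sub_eq_add_neg]
      rfl
    rw [h3, schrodinger_add, schrodinger_smul, h1, h2, neg_one_smul, add_neg_cancel]

theorem IsResolventAt.eq {E : Type*} [NormedAddCommGroup E] [NormedSpace ℂ E] {T : E →ₗ.[ℂ] E}
    {z : ℂ} {R R' : E →L[ℂ] E} (h : IsResolventAt T z R) (h' : IsResolventAt T z R') : R = R' := by
  ext g
  obtain ⟨h1, h2⟩ := h'.1 g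
  have h3 := h.2 ⟨R' g, h1⟩
  rw [h2] at h3
  exact h3

theorem IsResolventAt.resolventOf_eq {E : Type*} [NormedAddCommGroup E] [NormedSpace ℂ E]
    {T : E →ₗ.[ℂ] E} {z : ℂ} {R : E →L[ℂ] E} (h : IsResolventAt T z R) : resolventOf T z = R := by
  have h1 : ∃ R : E →L[ℂ] E, IsResolventAt T z R := ⟨R, h⟩
  rw [resolventOf, dif_pos h1]
  exact h1.choose_spec.eq h

/-- The resolvent identity: the inverse at z' is R(1 - (z' - z)R)⁻¹. -/
theorem IsResolventAt.of_isUnit {E : Type*} [NormedAddCommGroup E] [NormedSpace ℂ E]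
    {T : E →ₗ.[ℂ] E} {z z' : ℂ} {R : E →L[ℂ] E} (h : IsResolventAt T z R)
    (hu : IsUnit (1 - (z' - z) • R)) : ∃ R', IsResolventAt T z' R' := by
  obtain ⟨U, hU1, hU2⟩ : ∃ U : E →L[ℂ] E, (1 - (z' - z) • R) * U = 1 ∧
      U * (1 - (z' - z) • R) = 1 := by
    obtain ⟨u, hu⟩ := hu
    exact ⟨↑u⁻¹, by rw [← hu, Units.mul_inv], by rw [← hu, Units.inv_mul]⟩
  -- R commutes with 1 - (z' - z)R, hence with its inverse; this gives the left-inverse property on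
  -- the domain.
  have hcomm : R * U = U * R := by
    have h1 : R * (1 - (z' - z) • R) = (1 - (z' - z) • R) * R := by
      simp [mul_sub, sub_mul]
    calc R * U = U * (1 - (z' - z) • R) * (R * U) := by rw [hU2, one_mul]
      _ = U * ((1 - (z' - z) • R) * R) * U := by simp only [mul_assoc]
      _ = U * R * ((1 - (z' - z) • R) * U) := by rw [← h1]; simp only [mul_assoc]
      _ = U * R := by rw [hU1, mul_one]
  refine ⟨R * U, fun g => ?_, fun f => ?_⟩
  · obtain ⟨h1, h2⟩ := h.1 (U g)
    refine ⟨h1, ?_⟩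
    have h3 : U g - (z' - z) • R (U g) = g := by
      simpa using congrArg (fun A : E →L[ℂ] E => A g) hU1
    change T ⟨R (U g), h1⟩ - z' • R (U g) = g
    have h4 : T ⟨R (U g), h1⟩ - z' • R (U g) =
        (T ⟨R (U g), h1⟩ - z • R (U g)) - (z' - z) • R (U g) := by
      rw [sub_smul]; abel
    rw [h4, h2, h3]
  · have h1 := h.2 f
    have h3 : U ((f : E) - (z' - z) • R f) = f := by
      simpa using congrArg (fun A : E →L[ℂ] E => A f) hU2
    rw [hcomm]
    change U (R (T f - z' • (f : E))) = f
    have h4 : T f - z' • (f : E) = (T f - z • (f : E)) - (z' - z) • (f : E) := by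
      rw [sub_smul]; abel
    rw [h4, map_sub, h1, map_smul, h3]

variable {Λ : ℕ → Finset V}

theorem IsRegular.isGreen_add (h : IsRegular W Λ β) {ε : ℝ} (hε : 0 ≤ ε) (S : Finset V) :
    IsGreen W S (fun i => β i + ε) fun i j => (greenFin W S (fun i => β i + ε) i j).toReal :=
  isGreen_toReal_greenFin (fun i => by linarith [h.pos i]) fun i j =>
    ne_top_of_le_ne_top (h.ne_top S i j) (greenFin_anti W S h.pos (fun i => by linarith) i j)

/-- For i in Λ n the sum is the function ψ of Λ n at the potential β + ε; it is at most the one at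
β, which converges in n and so is bounded. -/
theorem IsRegular.exists_boundary_sum_le (h : IsRegular W Λ β) {ε : ℝ}
    (hε : 0 ≤ ε) (i : V) : ∃ C : ℝ, ∀ n, ∑ k ∈ Λ n,
      (greenFin W (Λ n) (fun i => β i + ε) i k).toReal * boundaryWeight W (Λ n) k ≤ C := by
  obtain ⟨x, hx, hlim⟩ := h.psi_tendsto i
  have hreal : Tendsto (fun n => (psiFin W (Λ n) β i).toReal) atTop (𝓝 x) := by
    have := (ENNReal.tendsto_toReal ENNReal.ofReal_ne_top).comp hlim
    rwa [ENNReal.toReal_ofReal hx] at this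
  obtain ⟨C, hC⟩ := hreal.bddAbove_range
  refine ⟨C, fun n => le_trans ?_ (hC ⟨n, rfl⟩)⟩
  have hpos : ∀ i, 0 < β i + ε := fun i => by linarith [h.pos i]
  have h1 := (h.isGreen_add hε (Λ n)).psiFin_eq hpos i
  have h2 : psiFin W (Λ n) β i ≠ ∞ := by
    rw [(h.isGreen (Λ n)).psiFin_eq h.pos i]
    exact ENNReal.ofReal_ne_top
  have h3 := ENNReal.toReal_mono h2 (psiFin_anti W (Λ n) h.pos
    (fun i => le_add_of_nonneg_right hε : ∀ i, β i ≤ β i + ε) i)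
  rw [h1, ENNReal.toReal_ofReal ((h.isGreen_add hε (Λ n)).psiOf_nonneg i), psiOf] at h3
  refine le_trans ?_ h3
  split_ifs with hi
  · exact le_rfl
  · refine (Finset.sum_eq_zero fun k _ => ?_).trans_le zero_le_one
    rw [(h.isGreen_add hε (Λ n)).support i k fun hk => hi hk.1, zero_mul]

/-- Elements of ℓ² tend to 0 along the cofinite filter, so u is recovered from H u = 0 and vanishes.
-/
theorem IsRegular.eq_zero_of_schrodinger (h : IsRegular W Λ β) (hΛ : IsExhaustion G Λ) {ε : ℝ}
    (hε : 0 ≤ ε) (u : L2 V) (hu : schrodinger W (fun i => β i + ε) (u : V → ℂ) = 0) : u = 0 := by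
  refine Subtype.ext (funext fun i => ?_)
  obtain ⟨C, hC⟩ := h.exists_boundary_sum_le hε i
  have h1 := IsGreen.tendsto_sum_schrodinger hΛ (fun n => h.isGreen_add hε (Λ n)) hC
    (tendsto_cofinite_L2 u)
  simp only [hu, Pi.zero_apply, smul_zero, Finset.sum_const_zero] at h1
  exact tendsto_nhds_unique h1 tendsto_const_nhds

theorem IsRegular.exists_resolvent (h : IsRegular W Λ β) (hΛ : IsExhaustion G Λ) {ε : ℝ}
    (hε : 0 < ε) : ∃ R : L2 V →L[ℂ] L2 V,
      (∀ g, IsLimitPair W (fun i => β i + ε / 2) (R g) g) ∧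
        IsResolventAt (schrodingerOp W β) (-(ε : ℂ)) R := by
  have hinj := h.eq_zero_of_schrodinger hΛ (half_pos hε).le
  obtain ⟨R, hR⟩ := VRJP.exists_resolvent hε
    (re_inner_schrodingerFinsupp_nonneg hΛ fun n => h.isGreen (Λ n)) hinj
  exact ⟨R, hR, isResolventAt_of_isLimitPair hinj hR⟩

/-- R = (H_β + 1)⁻¹ is a positive contraction, so its spectrum lies in [0,1]. For z outside [0,∞)
the number (z + 1)⁻¹ is not in it, which makes 1 - (z + 1)R invertible and yields a resolvent at z.
-/
theorem IsRegular.spectrumOf_subset (h : IsRegular W Λ β) (hΛ : IsExhaustion G Λ) :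
    spectrumOf (schrodingerOp W β) ⊆ {z : ℂ | 0 ≤ z.re ∧ z.im = 0} := by
  intro z hz
  by_contra hcon
  refine hz ?_
  have h0 := re_inner_schrodingerFinsupp_nonneg hΛ fun n => h.isGreen (Λ n)
  obtain ⟨R, hR, hres⟩ := h.exists_resolvent hΛ one_pos
  have hin : ∀ g, ‖R g‖ ^ 2 ≤ (inner ℂ g (R g)).re := fun g => by
    simpa using (hR g).inner_ge h0
  have hRpos : R.IsPositive := by
    refine ⟨fun g g' => (hR g).inner_eq (hR g'), fun g => ?_⟩
    refine (sq_nonneg ‖R g‖).trans ((hin g).trans_eq ?_)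
    rw [ContinuousLinearMap.reApplyInnerSelf_apply, ← inner_conj_symm]
    exact (Complex.conj_re _).symm
  have hnorm : ‖R‖ ≤ 1 := by
    refine R.opNorm_le_bound zero_le_one fun g => ?_
    rw [one_mul]
    have h2 := (hin g).trans ((Complex.re_le_norm _).trans (norm_inner_le_norm (𝕜 := ℂ) g (R g)))
    rcases (norm_nonneg (R g)).eq_or_lt with h3 | h3
    · rw [← h3]; exact norm_nonneg _
    · refine le_of_mul_le_mul_right ?_ h3
      linarith [sq (‖R g‖)]
  refine hres.of_isUnit ?_
  have hz1 : z - -((1 : ℝ) : ℂ) = z + 1 := by push_cast; ring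
  rw [hz1]
  -- At z = -1 the inverse of z + 1 is meaningless, but R itself is the resolvent.
  by_cases hz0 : z + 1 = 0
  · rw [hz0, zero_smul, sub_zero]
    exact isUnit_one
  have hmem : (z + 1)⁻¹ ∉ spectrum ℂ R := by
    intro hm
    have hre := hRpos.isSelfAdjoint.mem_spectrum_eq_re hm
    have hm' := hm
    rw [hre] at hm'
    have hm2 : ((z + 1)⁻¹).re ∈ spectrum ℝ R := spectrum.of_algebraMap_mem ℂ hm'
    have hnn : 0 ≤ ((z + 1)⁻¹).re :=
      spectrum_nonneg_of_nonneg (ContinuousLinearMap.nonneg_iff_isPositive R |>.2 hRpos) hm2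
    have hle : ‖(z + 1)⁻¹‖ ≤ 1 := by
      refine (spectrum.norm_le_norm_mul_of_mem hm).trans ?_
      exact mul_le_one₀ hnorm (norm_nonneg _) ContinuousLinearMap.norm_id_le
    set r := ((z + 1)⁻¹).re with hr
    have hz2 : z + 1 = ((r⁻¹ : ℝ) : ℂ) := by
      rw [Complex.ofReal_inv, ← hre, inv_inv]
    have hr0 : r ≠ 0 := by
      intro h
      rw [h, inv_zero] at hz2
      exact hz0 (by simpa using hz2)
    have hrpos : 0 < r := lt_of_le_of_ne hnn hr0.symm
    have hr1 : r ≤ 1 := by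
      rw [hre, Complex.norm_real, Real.norm_of_nonneg hnn] at hle
      exact hle
    have hz3 : z = ((r⁻¹ - 1 : ℝ) : ℂ) := by
      push_cast at hz2 ⊢
      linear_combination hz2
    refine hcon ?_
    have hinv := (one_le_inv₀ hrpos).2 hr1
    rw [hz3]
    refine ⟨?_, Complex.ofReal_im _⟩
    rw [Complex.ofReal_re]
    linarith
  have h1 := spectrum.notMem_iff.1 hmem
  have h2 : (1 : L2 V →L[ℂ] L2 V) - (z + 1) • R =
      (z + 1) • (algebraMap ℂ (L2 V →L[ℂ] L2 V) (z + 1)⁻¹ - R) := by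
    rw [smul_sub, Algebra.algebraMap_eq_smul_one, smul_smul, mul_inv_cancel₀ hz0, one_smul]
  rw [h2]
  exact (h1.smul (Units.mk0 (z + 1) hz0))

theorem IsRegular.tendsto_greenFin_toReal (h : IsRegular W Λ β) (hΛ : IsExhaustion G Λ) (i j : V) :
    Tendsto (fun n => (greenFin W (Λ n) β i j).toReal) atTop (𝓝 (green W Λ β i j)) := by
  have := (ENNReal.tendsto_toReal ENNReal.ofReal_ne_top).comp (h.tendsto_green hΛ.mono i j)
  rwa [ENNReal.toReal_ofReal (green_nonneg W Λ β i j)] at this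

/-- The recovery of decaying functions is applied to f = R δ_j, for which (H_β + ε)f = δ_j: the sum
collapses to the finite Green function at (j,i), which is symmetric. -/
theorem IsRegular.tendsto_entry (h : IsRegular W Λ β) (hΛ : IsExhaustion G Λ) {ε : ℝ}
    (hε : 0 < ε) (i j : V) :
    Tendsto (fun n => ((greenFin W (Λ n) (fun i => β i + ε / 2) i j).toReal : ℂ)) atTop
      (𝓝 (entry (resolventOf (schrodingerOp W β) (-(ε : ℂ))) i j)) := by
  classical
  obtain ⟨R, hR, hres⟩ := h.exists_resolvent hΛ hε
  rw [hres.resolventOf_eq, entry]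
  have he := (hR (lp.single 2 j (1 : ℂ))).schrodinger_eq
  obtain ⟨C, hC⟩ := h.exists_boundary_sum_le (half_pos hε).le i
  have h1 := IsGreen.tendsto_sum_schrodinger hΛ (fun n => h.isGreen_add (half_pos hε).le (Λ n)) hC
    (tendsto_cofinite_L2 (R (lp.single 2 j (1 : ℂ))))
  have hcongr : ∀ f : L2 V, (lp.single 2 j (1 : ℂ) : L2 V) = f → ∀ k, (f : V → ℂ) k =
      if k = j then 1 else 0 := by
    rintro _ rfl k
    rw [lp.single_apply]
    simp [Pi.single_apply]
  have hS : ∀ k, schrodinger W (fun i => β i + ε / 2) (R (lp.single 2 j (1 : ℂ)) : V → ℂ) k =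
      if k = j then 1 else 0 := fun k => by
    rw [he]
    exact hcongr _ rfl k
  have h2 : Tendsto (fun n => ((greenFin W (Λ n) (fun i => β i + ε / 2) i j).toReal : ℂ)) atTop
      (𝓝 ((R (lp.single 2 j (1 : ℂ)) : V → ℂ) i)) := by
    refine h1.congr' ?_
    obtain ⟨N, hN⟩ := hΛ.exhausts j
    filter_upwards [eventually_ge_atTop N] with n hn
    simp only [hS, smul_ite, smul_zero]
    rw [Finset.sum_ite_eq' (Λ n) j, if_pos (hΛ.mono hn hN),
      (h.isGreen_add (half_pos hε).le (Λ n)).symm j i, Complex.real_smul, mul_one]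
  convert h2

theorem IsGreen.sub_eq {S : Finset V} {β : V → ℝ} {ε : ℝ} {g g' : V → V → ℝ}
    (h : IsGreen W S β g) (h' : IsGreen W S (fun i => β i + ε / 2) g') {i j : V}
    (hi : i ∈ S) (hj : j ∈ S) : g i j - g' i j = ε * ∑ k ∈ S, g k i * g' k j := by
  classical
  have h1 := h.sum_smul (fun k => g' k j) hi
  have h2 : ∀ k ∈ S, g k i • ((2 * β k) • g' k j - ∑ l ∈ S, W.weight k l • g' l j) =
      g k i * (if k = j then 1 else 0) - ε * (g k i * g' k j) := fun k hk => by
    simp only [smul_eq_mul]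
    linear_combination (g k i) * h'.eqn k hk j hj
  rw [Finset.sum_congr rfl h2, Finset.sum_sub_distrib, ← Finset.mul_sum] at h1
  simp only [mul_ite, mul_one, mul_zero, Finset.sum_ite_eq', hj, if_true] at h1
  rw [h.symm i j]
  linarith

/-- An exchange of the limits in n and ε. The finite Green functions increase in n and decrease in
ε, so the resolvent entries are at most Ĝ and at least every finite Green function at ε; at fixed n
the latter is continuous as ε tends to 0. -/
theorem IsRegular.tendsto_resolvent (h : IsRegular W Λ β) (hΛ : IsExhaustion G Λ) (i j : V) :
    Tendsto (fun ε : ℝ => entry (resolventOf (schrodingerOp W β) (-(ε : ℂ))) i j)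
      (𝓝[>] 0) (𝓝 (green W Λ β i j : ℂ)) := by
  set a : ℝ → ℝ := fun ε => (entry (resolventOf (schrodingerOp W β) (-(ε : ℂ))) i j).re with ha
  have hlim : ∀ ε : ℝ, 0 < ε → Tendsto
      (fun n => (greenFin W (Λ n) (fun i => β i + ε / 2) i j).toReal) atTop (𝓝 (a ε)) :=
    fun ε hε => (Complex.continuous_re.tendsto _).comp (h.tendsto_entry hΛ hε i j)
  have hval : ∀ ε : ℝ, 0 < ε →
      entry (resolventOf (schrodingerOp W β) (-(ε : ℂ))) i j = (a ε : ℂ) := fun ε hε =>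
    tendsto_nhds_unique (h.tendsto_entry hΛ hε i j)
      ((Complex.continuous_ofReal.tendsto _).comp (hlim ε hε))
  have hanti : ∀ ε : ℝ, 0 < ε → ∀ n (i j : V),
      (greenFin W (Λ n) (fun i => β i + ε / 2) i j).toReal ≤ (greenFin W (Λ n) β i j).toReal :=
    fun ε hε n i j => ENNReal.toReal_mono (h.ne_top _ _ _)
      (greenFin_anti W (Λ n) h.pos (fun i => by linarith) i j)
  have hupper : ∀ ε : ℝ, 0 < ε → a ε ≤ green W Λ β i j := fun ε hε =>
    le_of_tendsto_of_tendsto' (hlim ε hε) (h.tendsto_greenFin_toReal hΛ i j)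
      fun n => hanti ε hε n i j
  have hlower : ∀ ε : ℝ, 0 < ε → ∀ n,
      (greenFin W (Λ n) (fun i => β i + ε / 2) i j).toReal ≤ a ε := fun ε hε n => by
    refine ge_of_tendsto (hlim ε hε) ?_
    filter_upwards [eventually_ge_atTop n] with m hm
    exact ENNReal.toReal_mono (ne_top_of_le_ne_top (h.ne_top _ _ _)
      (greenFin_anti W (Λ m) h.pos (fun i => by linarith) i j)) (greenFin_mono W (hΛ.mono hm) _ i j)
  obtain ⟨N₁, hN₁⟩ := hΛ.exhausts i
  obtain ⟨N₂, hN₂⟩ := hΛ.exhausts j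
  -- The finite resolvent identity and monotonicity give g - εK ≤ g_ε ≤ g, with K the sum of
  -- products of entries of g.
  have hcont : ∀ n, i ∈ Λ n → j ∈ Λ n → Tendsto
      (fun ε : ℝ => (greenFin W (Λ n) (fun i => β i + ε / 2) i j).toReal) (𝓝[>] 0)
      (𝓝 (greenFin W (Λ n) β i j).toReal) := fun n hi hj => by
    set K := ∑ k ∈ Λ n, (greenFin W (Λ n) β k i).toReal * (greenFin W (Λ n) β k j).toReal with hK
    have hl : Tendsto (fun ε : ℝ => (greenFin W (Λ n) β i j).toReal - ε * K) (𝓝[>] 0)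
        (𝓝 ((greenFin W (Λ n) β i j).toReal - 0 * K)) :=
      (tendsto_const_nhds.sub (tendsto_id.mul_const K)).mono_left nhdsWithin_le_nhds
    rw [zero_mul, sub_zero] at hl
    refine tendsto_of_tendsto_of_tendsto_of_le_of_le' hl tendsto_const_nhds ?_ ?_
    · filter_upwards [self_mem_nhdsWithin] with ε hε
      have hε' : (0 : ℝ) < ε := hε
      have h1 := (h.isGreen (Λ n)).sub_eq (h.isGreen_add (half_pos hε').le (Λ n)) hi hj
      have h2 : ∑ k ∈ Λ n, (greenFin W (Λ n) β k i).toReal *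
          (greenFin W (Λ n) (fun i => β i + ε / 2) k j).toReal ≤ K :=
        Finset.sum_le_sum fun k _ => mul_le_mul_of_nonneg_left (hanti ε hε' n k j)
          ENNReal.toReal_nonneg
      have h3 := mul_le_mul_of_nonneg_left h2 hε'.le
      linarith
    · filter_upwards [self_mem_nhdsWithin] with ε hε
      exact hanti ε hε n i j
  have hreal : Tendsto a (𝓝[>] 0) (𝓝 (green W Λ β i j)) := by
    refine tendsto_order.2 ⟨fun b hb => ?_, fun b hb => ?_⟩
    · obtain ⟨n, hn, hn'⟩ := (((h.tendsto_greenFin_toReal hΛ i j).eventually_const_lt hb).and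
        (eventually_ge_atTop (max N₁ N₂))).exists
      have hi := hΛ.mono (le_of_max_le_left hn') hN₁
      have hj := hΛ.mono (le_of_max_le_right hn') hN₂
      filter_upwards [(hcont n hi hj).eventually_const_lt hn, self_mem_nhdsWithin] with ε h1 hε
      exact h1.trans_le (hlower ε hε n)
    · filter_upwards [self_mem_nhdsWithin] with ε hε
      exact (hupper ε hε).trans_lt hb
  refine ((Complex.continuous_ofReal.tendsto _).comp hreal).congr' ?_
  filter_upwards [self_mem_nhdsWithin] with ε hε
  exact (hval ε hε).symm

end Resolvent

/-! ### Symmetries of the graph and independence of the exhaustion -/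

section Symmetry
set_option linter.unusedSectionVars false
variable {V : Type*} {G : SimpleGraph V} [G.LocallyFinite] {W : Conductances G}
  {ν : Measure (V → ℝ)}

theorem IsPotentialLaw.unique {ν' : Measure (V → ℝ)} (hν : IsPotentialLaw W ν)
    (hν' : IsPotentialLaw W ν') : ν = ν' := by
  have := hν.isProbabilityMeasure
  have := hν'.isProbabilityMeasure
  refine IsProjectiveLimit.unique (P := fun U : Finset V => ν.map U.restrict) (fun U => rfl)
    fun U => ?_
  refine map_restrict_eq_of_laplace U ?_ ?_ fun l hl => ?_
  · filter_upwards [hν'.pos] with β hβ i _ using (hβ i).le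
  · filter_upwards [hν.pos] with β hβ i _ using (hβ i).le
  · rw [hν.lintegral_exp _ hl, hν'.lintegral_exp _ hl]

/-- A bijection of the vertices that preserves the conductances. -/
def IsSymmetry (W : Conductances G) (τ : V ≃ V) : Prop :=
  ∀ i j, W.weight (τ i) (τ j) = W.weight i j

variable {τ : V ≃ V}

theorem adj_iff_weight_pos (W : Conductances G) (i j : V) : G.Adj i j ↔ 0 < W.weight i j := by
  refine ⟨fun h => W.weight_pos h, fun h => ?_⟩
  by_contra hcon
  rw [W.weight_of_not_adj hcon] at h
  exact lt_irrefl _ h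

theorem IsSymmetry.adj_iff (h : IsSymmetry W τ) (i j : V) : G.Adj (τ i) (τ j) ↔ G.Adj i j := by
  rw [adj_iff_weight_pos W, adj_iff_weight_pos W, h]

theorem IsSymmetry.neighborFinset (h : IsSymmetry W τ) (i : V) :
    G.neighborFinset (τ i) = (G.neighborFinset i).map τ.toEmbedding := by
  ext k
  simp only [SimpleGraph.mem_neighborFinset, Finset.mem_map_equiv]
  rw [← h.adj_iff i, Equiv.apply_symm_apply]

theorem IsSymmetry.boundaryWeight (h : IsSymmetry W τ) (S : Finset V) (i : V) :
    boundaryWeight W (S.map τ.toEmbedding) (τ i) = boundaryWeight W S i := by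
  classical
  simp only [VRJP.boundaryWeight, Finset.sum_filter]
  rw [h.neighborFinset, Finset.sum_map]
  refine Finset.sum_congr rfl fun k _ => ?_
  simp [h i k]

theorem IsSymmetry.lap (h : IsSymmetry W τ) (S : Finset V) (a : V → ℝ) :
    lap W (S.map τ.toEmbedding) a = lap W S fun i => a (τ i) := by
  simp only [VRJP.lap, Finset.sum_map, Finset.prod_map, Equiv.coe_toEmbedding, h.boundaryWeight,
    h _ _]

theorem measurable_comp_equiv (τ : V ≃ V) : Measurable fun β : V → ℝ => fun i => β (τ i) :=
  measurable_pi_lambda _ fun _ => measurable_pi_apply _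

theorem IsSymmetry.isPotentialLaw [Countable V] (h : IsSymmetry W τ) (hν : IsPotentialLaw W ν) :
    IsPotentialLaw W (ν.map fun β i => β (τ i)) := by
  have := hν.isProbabilityMeasure
  have hm := measurable_comp_equiv τ
  refine ⟨Measure.isProbabilityMeasure_map hm.aemeasurable, ?_, fun U l hl => ?_⟩
  · have hs : MeasurableSet {β : V → ℝ | ∀ i, 0 < β i} := by
      rw [Set.ofPred_forall]
      exact MeasurableSet.iInter fun i => measurableSet_lt measurable_const (measurable_pi_apply i)
    refine (ae_map_iff hm.aemeasurable hs).2 ?_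
    filter_upwards [hν.pos] with β hβ i using hβ _
  · rw [integral_map hm.aemeasurable (Measurable.aestronglyMeasurable (by fun_prop))]
    have h1 := hν.laplace (U.map τ.toEmbedding) (fun i => l (τ.symm i)) fun i hi => by
      obtain ⟨j, hj, rfl⟩ := Finset.mem_map.1 hi
      simpa using hl j hj
    rw [laplaceFormula_eq_lap W _ _ fun i hi => by
      obtain ⟨j, hj, rfl⟩ := Finset.mem_map.1 hi
      simpa using hl j hj, h.lap] at h1
    simp only [Finset.sum_map, Equiv.coe_toEmbedding, Equiv.symm_apply_apply] at h1
    rw [laplaceFormula_eq_lap W U l hl, h1]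

theorem IsSymmetry.measurePreserving [Countable V] (h : IsSymmetry W τ) (hν : IsPotentialLaw W ν) :
    MeasurePreserving (fun (β : V → ℝ) i => β (τ i)) ν ν :=
  ⟨measurable_comp_equiv τ, (h.isPotentialLaw hν).unique hν⟩

variable {β : V → ℝ} {g : V → V → ℝ} {S : Finset V}

theorem IsGreen.comp_symmetry (h : IsSymmetry W τ) (hg : IsGreen W (S.map τ.toEmbedding) β g) :
    IsGreen W S (fun i => β (τ i)) fun i j => g (τ i) (τ j) where
  nonneg _ _ := hg.nonneg _ _
  support i j hij := hg.support _ _ fun h => hij (by simpa using h)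
  eqn i hi j hj := by
    have := hg.eqn (τ i) (by simpa using hi) (τ j) (by simpa using hj)
    rw [Finset.sum_map] at this
    classical
    simpa [h _ _, τ.injective.eq_iff] using this

theorem IsSymmetry.greenFin_eq (h : IsSymmetry W τ) (hβ : ∀ i, 0 < β i)
    (hg : IsGreen W (S.map τ.toEmbedding) β g) (i j : V) :
    greenFin W S (fun i => β (τ i)) i j = greenFin W (S.map τ.toEmbedding) β (τ i) (τ j) := by
  rw [hg.greenFin_eq hβ, (hg.comp_symmetry h).greenFin_eq fun i => hβ (τ i)]

theorem IsSymmetry.psiFin_eq (h : IsSymmetry W τ) (hβ : ∀ i, 0 < β i)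
    (hg : IsGreen W (S.map τ.toEmbedding) β g) (i : V) :
    psiFin W S (fun i => β (τ i)) i = psiFin W (S.map τ.toEmbedding) β (τ i) := by
  rw [hg.psiFin_eq hβ, (hg.comp_symmetry h).psiFin_eq fun i => hβ (τ i)]
  congr 1
  have h1 : τ i ∈ S.map τ.toEmbedding ↔ i ∈ S := by simp
  by_cases hi : i ∈ S
  · simp [psiOf, h.boundaryWeight, hi]
  · rw [psiOf, psiOf, if_neg hi, if_neg fun h => hi (h1.1 h)]

theorem IsExhaustion.map (h : IsSymmetry W τ) {Λ : ℕ → Finset V} (hΛ : IsExhaustion G Λ) :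
    IsExhaustion G fun n => (Λ n).map τ.toEmbedding where
  mono m n hmn := Finset.map_subset_map.2 (hΛ.mono hmn)
  connected n := by
    let f : G.induce (Λ n : Set V) →g G.induce ((Λ n).map τ.toEmbedding : Set V) :=
      { toFun := fun v => ⟨τ v, by simp⟩
        map_rel' := fun {v w} hvw => (h.adj_iff v w).2 hvw }
    refine (hΛ.connected n).map f fun v => ?_
    obtain ⟨u, hu, huv⟩ := Finset.mem_map.1 (Finset.mem_coe.1 v.2)
    exact ⟨⟨u, hu⟩, Subtype.ext huv⟩
  exhausts v := by
    obtain ⟨n, hn⟩ := hΛ.exhausts (τ.symm v)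
    exact ⟨n, by simpa using hn⟩

theorem IsExhaustion.exists_subset {Λ : ℕ → Finset V} (hΛ : IsExhaustion G Λ) (S : Finset V)
    (m : ℕ) : ∃ n, m ≤ n ∧ S ⊆ Λ n := by
  choose N hN using hΛ.exhausts
  exact ⟨max m (S.sup N), le_max_left _ _, fun v hv =>
    hΛ.mono ((Finset.le_sup hv).trans (le_max_right _ _)) (hN v)⟩

theorem IsExhaustion.graph_connected {Λ : ℕ → Finset V} (hΛ : IsExhaustion G Λ) : G.Connected := by
  classical
  have hne : Nonempty V := (hΛ.connected 0).nonempty.map Subtype.val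
  refine ⟨fun u v => ?_⟩
  obtain ⟨n, -, hn⟩ := hΛ.exists_subset {u, v} 0
  have h1 := (hΛ.connected n).preconnected ⟨u, hn (by simp)⟩ ⟨v, hn (by simp)⟩
  exact h1.map (SimpleGraph.Embedding.induce _).toHom

/-- Two exhaustions can be interlaced. -/
theorem IsExhaustion.exists_interlaced {Λ Λ' : ℕ → Finset V} (hΛ : IsExhaustion G Λ)
    (hΛ' : IsExhaustion G Λ') : ∃ (T : ℕ → Finset V) (c c' : ℕ → ℕ), Monotone T ∧
      Tendsto c atTop atTop ∧ Tendsto c' atTop atTop ∧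
      (∀ k, T (2 * k) = Λ (c k)) ∧ (∀ k, T (2 * k + 1) = Λ' (c' k)) := by
  choose a ha ha' using fun n => hΛ'.exists_subset (Λ n) n
  -- The inclusions alternate: Λ(c k) ⊆ Λ'(a (c k)) ⊆ Λ(c (k+1)). Asking for n + 1 instead of n
  -- forces c to tend to infinity.
  choose b hb hb' using fun n => hΛ.exists_subset (Λ' n) (n + 1)
  set c : ℕ → ℕ := fun k => (fun n => b (a n))^[k] 0 with hc
  have hstep : ∀ k, c (k + 1) = b (a (c k)) := fun k => Function.iterate_succ_apply' _ _ _
  have hge : ∀ k, k ≤ c k := fun k => by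
    induction k with
    | zero => exact Nat.zero_le _
    | succ k ih =>
      rw [hstep]
      have h1 := hb (a (c k))
      have h2 := ha (c k)
      omega
  refine ⟨fun k => if Even k then Λ (c (k / 2)) else Λ' (a (c (k / 2))), c, fun k => a (c k), ?_,
    tendsto_atTop_mono hge tendsto_id, tendsto_atTop_mono (fun k => (hge k).trans (ha _))
      tendsto_id, fun k => ?_, fun k => ?_⟩
  · refine monotone_nat_of_le_succ fun k => ?_
    rcases Nat.even_or_odd' k with ⟨m, rfl | rfl⟩
    · have h1 : ¬ Even (2 * m + 1) := by simp
      have h2 : (2 * m + 1) / 2 = m := by omega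
      simp only [even_two_mul, if_true, h1, if_false, h2]
      rw [Nat.mul_div_cancel_left m two_pos]
      exact ha' _
    · have h1 : ¬ Even (2 * m + 1) := by simp
      have h2 : (2 * m + 1) / 2 = m := by omega
      have h3 : Even (2 * m + 1 + 1) := ⟨m + 1, by ring⟩
      have h4 : (2 * m + 1 + 1) / 2 = m + 1 := by omega
      simp only [h1, if_false, h2, h3, if_true, h4, hstep]
      exact hb' _
  · simp
  · have h1 : ¬ Even (2 * k + 1) := by simp
    have h2 : (2 * k + 1) / 2 = k := by omega
    simp only [h1, if_false, h2]

/-- Both limits are suprema, and each exhaustion is cofinal in the other; this holds for every β. -/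
theorem green_eq_green {Λ Λ' : ℕ → Finset V} (hΛ : IsExhaustion G Λ) (hΛ' : IsExhaustion G Λ')
    (β : V → ℝ) : green W Λ β = green W Λ' β := by
  funext i j
  have h1 : ∀ {Λ : ℕ → Finset V}, IsExhaustion G Λ →
      limUnder atTop (fun n => greenFin W (Λ n) β i j) = ⨆ n, greenFin W (Λ n) β i j :=
    fun h => (tendsto_atTop_iSup fun m n hmn => greenFin_mono W (h.mono hmn) β i j).limUnder_eq
  have h2 : ∀ {Λ Λ' : ℕ → Finset V}, IsExhaustion G Λ → IsExhaustion G Λ' →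
      (⨆ n, greenFin W (Λ n) β i j) ≤ ⨆ n, greenFin W (Λ' n) β i j := fun {Λ Λ'} _ h' =>
    iSup_le fun n => by
      obtain ⟨m, -, hm⟩ := h'.exists_subset (Λ n) 0
      exact (greenFin_mono W hm β i j).trans (le_iSup (fun n => greenFin W (Λ' n) β i j) m)
  rw [green, green, h1 hΛ, h1 hΛ', le_antisymm (h2 hΛ hΛ') (h2 hΛ' hΛ)]

/-- ψ is not monotone in the set, so a third sequence is used: along the interlaced one the
martingale converges almost surely, and it shares a subsequence with each of the two exhaustions. -/
theorem ae_psi_eq_psi [Infinite V] (hν : IsPotentialLaw W ν) {Λ Λ' : ℕ → Finset V}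
    (hΛ : IsExhaustion G Λ) (hΛ' : IsExhaustion G Λ') : ∀ᵐ β ∂ν, psi W Λ β = psi W Λ' β := by
  have := hΛ.countable
  have hG := hΛ.graph_connected
  obtain ⟨T, c, c', hT, hc, hc', hTc, hTc'⟩ := hΛ.exists_interlaced hΛ'
  have hwired : ∀ n, IsWired W (T n) := fun n => by
    rcases Nat.even_or_odd' n with ⟨m, rfl | rfl⟩
    · rw [hTc]
      exact hΛ.isWired hG (fun n => Infinite.exists_notMem_finset _) _
    · rw [hTc']
      exact hΛ'.isWired hG (fun n => Infinite.exists_notMem_finset _) _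
  filter_upwards [ae_all_iff.2 fun k => ae_exists_tendsto_psiVersion hν hT hwired k,
    ae_isRegular hG hν hΛ, ae_isRegular hG hν hΛ', ae_isGreen hν] with β h1 h2 h3 hg
  funext i
  obtain ⟨x, hx⟩ := h1 i
  have hx0 : 0 ≤ x := ge_of_tendsto' hx fun n => (hg _).psiOf_nonneg i
  have hx' : Tendsto (fun n => psiFin W (T n) β i) atTop (𝓝 (ENNReal.ofReal x)) :=
    (ENNReal.tendsto_ofReal hx).congr fun n => ((hg (T n)).psiFin_eq h2.pos i).symm
  have h4 : Tendsto (fun k => psiFin W (Λ (c k)) β i) atTop (𝓝 (ENNReal.ofReal x)) := by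
    refine (hx'.comp (tendsto_id.const_mul_atTop' two_pos)).congr fun k => ?_
    simp only [Function.comp_apply, id_eq, hTc]
  have h5 : Tendsto (fun k => psiFin W (Λ' (c' k)) β i) atTop (𝓝 (ENNReal.ofReal x)) := by
    refine (hx'.comp (tendsto_atTop_mono (fun k => (by omega : k ≤ 2 * k + 1))
      tendsto_id)).congr fun k => ?_
    simp only [Function.comp_apply, hTc']
  have h6 := tendsto_nhds_unique ((h2.tendsto_psi i).comp hc) h4
  have h7 := tendsto_nhds_unique ((h3.tendsto_psi i).comp hc') h5
  rw [← h7, ENNReal.ofReal_eq_ofReal_iff (psi_nonneg _ _ _ _) (psi_nonneg _ _ _ _)] at h6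
  exact h6

/-- The Green function and the function `ψ` are equivariant. -/
theorem IsSymmetry.ae_equivariant [Infinite V] (h : IsSymmetry W τ) (hν : IsPotentialLaw W ν)
    {Λ : ℕ → Finset V} (hΛ : IsExhaustion G Λ) : ∀ᵐ β ∂ν,
      (∀ i j, green W Λ (fun i => β (τ i)) i j = green W Λ β (τ i) (τ j)) ∧
        ∀ i, psi W Λ (fun i => β (τ i)) i = psi W Λ β (τ i) := by
  have := hΛ.countable
  -- Relabelling the potential replaces Λ by its image under the symmetry, which is another
  -- exhaustion.
  filter_upwards [ae_psi_eq_psi hν hΛ (hΛ.map h), ae_isGreen hν, hν.pos] with β h1 hg hpos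
  constructor
  · intro i j
    rw [green_eq_green hΛ (hΛ.map h) β]
    simp only [green, h.greenFin_eq hpos (hg _)]
  · intro i
    rw [h1]
    simp only [psi, h.psiFin_eq hpos (hg _)]

theorem aemeasurable_green (hν : IsPotentialLaw W ν) (hG : G.Connected) {Λ : ℕ → Finset V}
    (hΛ : IsExhaustion G Λ) (i j : V) : AEMeasurable (fun β => green W Λ β i j) ν := by
  have := hΛ.countable
  refine aemeasurable_of_tendsto_metrizable_ae atTop
    (fun n => ((isTiltedGreen_greenVersion hν (Λ n)).measurable i j).aemeasurable) ?_
  filter_upwards [ae_isRegular hG hν hΛ, ae_isGreen hν] with β h hg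
  refine (h.tendsto_greenFin_toReal hΛ i j).congr fun n => ?_
  rw [(hg (Λ n)).greenFin_eq h.pos, ENNReal.toReal_ofReal ((hg _).nonneg _ _)]

theorem tendsto_psiVersion (hν : IsPotentialLaw W ν) (hG : G.Connected) {Λ : ℕ → Finset V}
    (hΛ : IsExhaustion G Λ) : ∀ᵐ β ∂ν, ∀ i,
      Tendsto (fun n => psiVersion hν (Λ n) i β) atTop (𝓝 (psi W Λ β i)) := by
  have := hΛ.countable
  filter_upwards [ae_isRegular hG hν hΛ, ae_isGreen hν] with β h hg i
  have h1 := (ENNReal.tendsto_toReal ENNReal.ofReal_ne_top).comp (h.tendsto_psi i)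
  rw [ENNReal.toReal_ofReal (psi_nonneg _ _ _ _)] at h1
  refine h1.congr fun n => ?_
  rw [Function.comp_apply, (hg (Λ n)).psiFin_eq h.pos,
    ENNReal.toReal_ofReal ((hg _).psiOf_nonneg _)]
  rfl

theorem aemeasurable_psi (hν : IsPotentialLaw W ν) (hG : G.Connected) {Λ : ℕ → Finset V}
    (hΛ : IsExhaustion G Λ) (i : V) : AEMeasurable (fun β => psi W Λ β i) ν := by
  refine aemeasurable_of_tendsto_metrizable_ae atTop
    (fun n => (measurable_psiVersion hν (Λ n) i).aemeasurable) ?_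
  filter_upwards [tendsto_psiVersion hν hG hΛ] with β h using h i

end Symmetry

/-! ### Independence at distance two and the zero-one law -/

section Mixing
set_option linter.unusedSectionVars false
variable {V : Type*} {G : SimpleGraph V} [G.LocallyFinite] {W : Conductances G}
  {ν : Measure (V → ℝ)}

theorem lap_congr (W : Conductances G) {S : Finset V} {a b : V → ℝ} (h : ∀ i ∈ S, a i = b i) :
    lap W S a = lap W S b := by
  rw [lap, lap, Finset.prod_congr rfl h]
  congr 3
  · congr 2
    exact Finset.sum_congr rfl fun i hi => Finset.sum_congr rfl fun j hj => by rw [h i hi, h j hj]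
  · exact Finset.sum_congr rfl fun i hi => by rw [h i hi]

theorem boundaryWeight_union [DecidableEq V] (W : Conductances G) {S T : Finset V}
    (hna : ∀ i ∈ S, ∀ j ∈ T, ¬ G.Adj i j) {i : V} (hi : i ∈ S) :
    boundaryWeight W (S ∪ T) i = boundaryWeight W S i := by
  simp only [boundaryWeight, Finset.sum_filter]
  refine Finset.sum_congr rfl fun k hk => ?_
  have : k ∉ T := fun hT => hna i hi k hT ((G.mem_neighborFinset i k).1 hk)
  simp [this]

/-- Without edges between S and T the interaction terms vanish and the boundary weights are
unchanged. -/
theorem lap_union [DecidableEq V] (W : Conductances G) {S T : Finset V} (hd : Disjoint S T)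
    (hna : ∀ i ∈ S, ∀ j ∈ T, ¬ G.Adj i j) (a : V → ℝ) :
    lap W (S ∪ T) a = lap W S a * lap W T a := by
  have hna' : ∀ i ∈ T, ∀ j ∈ S, ¬ G.Adj i j := fun i hi j hj h => hna j hj i hi h.symm
  have h1 : ∀ i ∈ S, ∑ j ∈ S ∪ T, W.weight i j * (a i * a j - 1) =
      ∑ j ∈ S, W.weight i j * (a i * a j - 1) := fun i hi => by
    rw [Finset.sum_union hd, add_eq_left]
    exact Finset.sum_eq_zero fun j hj => by rw [W.weight_of_not_adj (hna i hi j hj), zero_mul]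
  have h2 : ∀ i ∈ T, ∑ j ∈ S ∪ T, W.weight i j * (a i * a j - 1) =
      ∑ j ∈ T, W.weight i j * (a i * a j - 1) := fun i hi => by
    rw [Finset.sum_union hd, add_eq_right]
    exact Finset.sum_eq_zero fun j hj => by rw [W.weight_of_not_adj (hna' i hi j hj), zero_mul]
  rw [lap, lap, lap, div_mul_div_comm, ← Real.exp_add, Finset.prod_union hd, Finset.sum_union hd,
    Finset.sum_union hd, Finset.sum_congr rfl h1, Finset.sum_congr rfl h2]
  congr 2
  have h3 : ∀ i ∈ S, boundaryWeight W (S ∪ T) i * (a i - 1) = boundaryWeight W S i * (a i - 1) :=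
    fun i hi => by rw [boundaryWeight_union W hna hi]
  have h4 : ∀ i ∈ T, boundaryWeight W (S ∪ T) i * (a i - 1) = boundaryWeight W T i * (a i - 1) :=
    fun i hi => by rw [Finset.union_comm, boundaryWeight_union W hna' hi]
  rw [Finset.sum_congr rfl h3, Finset.sum_congr rfl h4]
  ring

/-- A set of fields depends only on the values in `S`. -/
def DependsOn (S : Finset V) (A : Set (V → ℝ)) : Prop :=
  ∀ β β' : V → ℝ, (∀ i ∈ S, β i = β' i) → (β ∈ A ↔ β' ∈ A)

theorem measure_eq_of_map_restrict_eq {μ ν : Measure (V → ℝ)} {U : Finset V}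
    (h : μ.map U.restrict = ν.map U.restrict) {A : Set (V → ℝ)} (hA : MeasurableSet A)
    (hdep : DependsOn U A) : μ A = ν A := by
  rw [← lintegral_indicator_one hA, ← lintegral_indicator_one hA]
  refine lintegral_eq_of_map_restrict_eq h (measurable_one.indicator hA) fun β β' hb => ?_
  by_cases hβ : β ∈ A
  · rw [Set.indicator_of_mem hβ, Set.indicator_of_mem ((hdep β β' hb).1 hβ)]
    rfl
  · rw [Set.indicator_of_notMem hβ, Set.indicator_of_notMem fun h => hβ ((hdep β β' hb).2 h)]

/-- Factorisation of the Laplace transform yields independence by two uses of uniqueness: first for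
ν weighted by an exponential in T, compared on events of S; then for ν restricted to A, compared on
events of T. -/
theorem IsPotentialLaw.measure_inter (hν : IsPotentialLaw W ν) {S T : Finset V}
    (hd : Disjoint S T) (hna : ∀ i ∈ S, ∀ j ∈ T, ¬ G.Adj i j) {A B : Set (V → ℝ)}
    (hA : MeasurableSet A) (hB : MeasurableSet B) (hAS : DependsOn S A) (hBT : DependsOn T B) :
    ν (A ∩ B) = ν A * ν B := by
  classical
  have := hν.isProbabilityMeasure
  have hpos : ∀ (U : Finset V), ∀ᵐ β ∂ν, ∀ i ∈ U, 0 ≤ β i := fun U => by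
    filter_upwards [hν.pos] with β hβ i _ using (hβ i).le
  set e : Finset V → (V → ℝ) → (V → ℝ) → ℝ≥0∞ := fun U l β =>
    ENNReal.ofReal (Real.exp (-∑ i ∈ U, l i * β i)) with he
  have hem : ∀ U l, Measurable (e U l) := fun U l => by
    simp only [he]
    fun_prop
  have hmul : ∀ l l' : V → ℝ, (∀ i, 0 ≤ l i) → (∀ i, 0 ≤ l' i) →
      ∫⁻ β, e T l' β * e S l β ∂ν = (∫⁻ β, e T l' β ∂ν) * ∫⁻ β, e S l β ∂ν := by
    intro l l' hl hl'
    set m : V → ℝ := fun i => if i ∈ S then l i else l' i with hm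
    have hmS : ∀ i ∈ S, m i = l i := fun i hi => if_pos hi
    have hmT : ∀ i ∈ T, m i = l' i := fun i hi => if_neg (Finset.disjoint_right.1 hd hi)
    have hm0 : ∀ i, 0 ≤ m i := fun i => by
      simp only [hm]
      split_ifs
      exacts [hl i, hl' i]
    have h1 : ∀ β, e T l' β * e S l β = e (S ∪ T) m β := fun β => by
      have k1 : ∀ i ∈ S, m i * β i = l i * β i := fun i hi => by rw [hmS i hi]
      have k2 : ∀ i ∈ T, m i * β i = l' i * β i := fun i hi => by rw [hmT i hi]
      simp only [he]
      rw [← ENNReal.ofReal_mul (Real.exp_pos _).le, ← Real.exp_add, Finset.sum_union hd,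
        Finset.sum_congr rfl k1, Finset.sum_congr rfl k2]
      congr 2
      ring
    simp_rw [h1]
    simp only [he]
    rw [hν.lintegral_exp _ hm0, hν.lintegral_exp _ hl, hν.lintegral_exp _ hl', lap_union W hd hna,
      mul_comm (lap W S _), ENNReal.ofReal_mul]
    · have k1 : lap W S (fun i => √(1 + m i)) = lap W S fun i => √(1 + l i) :=
        lap_congr W fun i hi => by rw [hmS i hi]
      have k2 : lap W T (fun i => √(1 + m i)) = lap W T fun i => √(1 + l' i) :=
        lap_congr W fun i hi => by rw [hmT i hi]
      rw [k1, k2]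
    · exact (lap_pos W T (sqrt_one_add_pos hm0)).le
  have hone : ∀ l : V → ℝ, (∀ i, 0 ≤ l i) → ∫⁻ β, e T l β ∂ν ≠ ∞ := fun l hl => by
    simp only [he]
    rw [hν.lintegral_exp _ hl]
    exact ENNReal.ofReal_ne_top
  have step1 : ∀ l' : V → ℝ, (∀ i, 0 ≤ l' i) →
      ∫⁻ β in A, e T l' β ∂ν = (∫⁻ β, e T l' β ∂ν) * ν A := by
    intro l' hl'
    have : IsFiniteMeasure (ν.withDensity (e T l')) :=
      isFiniteMeasure_withDensity (hone l' hl')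
    have : IsFiniteMeasure ((∫⁻ β, e T l' β ∂ν) • ν) := ν.smul_finite (hone l' hl')
    have h1 := map_restrict_eq_of_laplace (μ := ν.withDensity (e T l'))
      (ν := (∫⁻ β, e T l' β ∂ν) • ν) S
      ((withDensity_absolutelyContinuous _ _).ae_le (hpos S))
      (Measure.ae_smul_measure (hpos S) _) fun l hl => by
        rw [lintegral_withDensity_eq_lintegral_mul _ (hem T l') (hem S l), lintegral_smul_measure]
        exact hmul l l' hl hl'
    have h2 := measure_eq_of_map_restrict_eq h1 hA hAS
    rw [withDensity_apply _ hA] at h2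
    exact h2
  have : IsFiniteMeasure (ν A • ν) := ν.smul_finite (measure_ne_top ν A)
  have h1 := map_restrict_eq_of_laplace (μ := ν.restrict A) (ν := ν A • ν) T
    (ae_restrict_of_ae (hpos T)) (Measure.ae_smul_measure (hpos T) _) fun l hl => by
      rw [lintegral_smul_measure, smul_eq_mul, mul_comm]
      exact step1 l hl
  have h2 := measure_eq_of_map_restrict_eq h1 hB hBT
  rw [Measure.restrict_apply hB, Set.inter_comm] at h2
  exact h2

theorem dependsOn_cylinder (S : Finset V) (t : Set (S → ℝ)) :
    DependsOn S (cylinder S t : Set (V → ℝ)) := by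
  intro β β' h
  have : S.restrict β = S.restrict β' := funext fun i => h i i.2
  rw [mem_cylinder, mem_cylinder, this]

theorem DependsOn.preimage {S : Finset V} {A : Set (V → ℝ)} (h : DependsOn S A) (τ : V ≃ V) :
    DependsOn (S.map τ.toEmbedding) ((fun (β : V → ℝ) i => β (τ i)) ⁻¹' A) := fun β β' hb =>
  h _ _ fun i hi => hb (τ i) (by simpa using hi)

open scoped symmDiff in
-- Approximate A by a cylinder C up to δ. A far translate of C is independent of C, so with x, c the
-- measures of A, C one has |x - c| ≤ δ and, by invariance, |x - c²| ≤ 2δ. Hence |x - x²| ≤ 4δ for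
-- all δ > 0.
theorem IsPotentialLaw.zero_one_of_invariant [Countable V] (hν : IsPotentialLaw W ν) {ι : Type*}
    {τ : ι → V ≃ V} (hτ : ∀ a, IsSymmetry W (τ a))
    (hfar : ∀ S : Finset V, ∃ a, Disjoint S (S.map (τ a).toEmbedding) ∧
      ∀ i ∈ S, ∀ j ∈ S.map (τ a).toEmbedding, ¬ G.Adj i j)
    {A : Set (V → ℝ)} (hA : MeasurableSet A)
    (hinv : ∀ a, (fun (β : V → ℝ) i => β (τ a i)) ⁻¹' A =ᵐ[ν] A) : ν A = 0 ∨ ν Aᶜ = 0 := by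
  have := hν.isProbabilityMeasure
  have hdense : ν.MeasureDense (measurableCylinders fun _ : V => ℝ) :=
    Measure.MeasureDense.of_generateFrom_isSetAlgebra_finite ν isSetAlgebra_measurableCylinders
      generateFrom_measurableCylinders.symm
  set x := ν.real A with hx
  have key : ∀ δ : ℝ, 0 < δ → |x - x ^ 2| ≤ 4 * δ := by
    intro δ hδ
    obtain ⟨C, hC, hAC⟩ := hdense.approx A hA (measure_ne_top _ _) δ hδ
    obtain ⟨S, t, ht, rfl⟩ := (mem_measurableCylinders _).1 hC
    set C : Set (V → ℝ) := cylinder S t with hCdef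
    have hCm : MeasurableSet C := ht.cylinder S
    have hAC' : ν.real (A ∆ C) ≤ δ :=
      (ENNReal.toReal_mono ENNReal.ofReal_ne_top hAC.le).trans (ENNReal.toReal_ofReal hδ.le).le
    obtain ⟨a, hd, hna⟩ := hfar S
    set θ : (V → ℝ) → (V → ℝ) := fun β i => β (τ a i) with hθ
    have hmp : MeasurePreserving θ ν ν := (hτ a).measurePreserving hν
    have hc := hν.measure_inter hd hna hCm (hmp.measurable hCm) (dependsOn_cylinder S t)
      ((dependsOn_cylinder S t).preimage (τ a))
    rw [hmp.measure_preimage hCm.nullMeasurableSet] at hc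
    set c := ν.real C with hcdef
    have hc' : ν.real (C ∩ θ ⁻¹' C) = c ^ 2 := by
      rw [Measure.real, hc, ENNReal.toReal_mul, sq]
      rfl
    have hxx : ν.real (A ∩ θ ⁻¹' A) = x := by
      refine measureReal_congr ?_
      filter_upwards [hinv a] with β hβ
      have hβ' : (β ∈ θ ⁻¹' A) = (β ∈ A) := hβ
      change (β ∈ A ∧ β ∈ θ ⁻¹' A) = (β ∈ A)
      rw [hβ', and_self]
    have h1 : |x - c| ≤ δ := (abs_measureReal_sub_le_measureReal_symmDiff hA.nullMeasurableSet
      hCm.nullMeasurableSet).trans hAC'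
    have h2 : |x - c ^ 2| ≤ 2 * δ := by
      rw [← hxx, ← hc']
      refine (abs_measureReal_sub_le_measureReal_symmDiff
        (hA.inter (hmp.measurable hA)).nullMeasurableSet
        (hCm.inter (hmp.measurable hCm)).nullMeasurableSet).trans ?_
      have h3 : (A ∩ θ ⁻¹' A) ∆ (C ∩ θ ⁻¹' C) ⊆ (A ∆ C) ∪ θ ⁻¹' (A ∆ C) := by
        intro β hβ
        simp only [Set.mem_symmDiff, Set.mem_inter_iff, Set.mem_preimage, Set.mem_union] at hβ ⊢
        tauto
      refine (measureReal_mono h3).trans ((measureReal_union_le _ _).trans ?_)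
      have h4 : ν.real (θ ⁻¹' (A ∆ C)) = ν.real (A ∆ C) := by
        rw [Measure.real, hmp.measure_preimage (hA.symmDiff hCm).nullMeasurableSet]
        rfl
      linarith
    have hx1 : |x + c| ≤ 2 := by
      rw [abs_of_nonneg (add_nonneg measureReal_nonneg measureReal_nonneg)]
      have h5 : x ≤ 1 := measureReal_le_one
      have h6 : c ≤ 1 := measureReal_le_one
      linarith
    have h7 : |c ^ 2 - x ^ 2| ≤ 2 * δ := by
      rw [show c ^ 2 - x ^ 2 = -((x + c) * (x - c)) by ring, abs_neg, abs_mul]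
      exact mul_le_mul hx1 h1 (abs_nonneg _) zero_le_two
    calc |x - x ^ 2| ≤ |x - c ^ 2| + |c ^ 2 - x ^ 2| := abs_sub_le _ _ _
      _ ≤ 4 * δ := by linarith
  have h0 : x - x ^ 2 = 0 := by
    by_contra hne
    have h1 := abs_pos.2 hne
    have h2 := key (|x - x ^ 2| / 8) (by positivity)
    linarith
  have h1 : x * (1 - x) = 0 := by linear_combination h0
  rcases mul_eq_zero.1 h1 with h2 | h2
  · exact Or.inl ((measureReal_eq_zero_iff (measure_ne_top _ _)).1 h2)
  · refine Or.inr ((prob_compl_eq_zero_iff hA).2 ?_)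
    have h3 : ν.real A = 1 := by linarith
    rw [Measure.real, ENNReal.toReal_eq_one_iff] at h3
    exact h3

end Mixing

/-! ### Stationarity and ergodicity on the grid -/

section Grid
set_option linter.unusedSectionVars false
variable {d : ℕ} {w : ℝ} {hw : 0 < w} {ν : Measure ((Fin d → ℤ) → ℝ)}

theorem isSymmetry_addRight (a : Fin d → ℤ) : IsSymmetry (gridConst d w hw) (Equiv.addRight a) := by
  intro i j
  have h : (grid d).Adj (i + a) (j + a) ↔ (grid d).Adj i j := by
    simp [grid]
  by_cases hij : (grid d).Adj i j
  · rw [(gridConst d w hw).weight_of_adj hij]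
    exact (gridConst d w hw).weight_of_adj (h.2 hij)
  · rw [(gridConst d w hw).weight_of_not_adj hij]
    exact (gridConst d w hw).weight_of_not_adj fun h' => hij (h.1 h')

theorem exists_far_translate (hd : 0 < d) (S : Finset (Fin d → ℤ)) : ∃ a : Fin d → ℤ,
    Disjoint S (S.map (Equiv.addRight a).toEmbedding) ∧
      ∀ i ∈ S, ∀ j ∈ S.map (Equiv.addRight a).toEmbedding, ¬ (grid d).Adj i j := by
  set k : Fin d := ⟨0, hd⟩
  set B : ℕ := S.sup fun i => (i k).natAbs with hB
  have hle : ∀ i ∈ S, |i k| ≤ B := fun i hi => by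
    rw [Int.abs_eq_natAbs]
    exact_mod_cast Finset.le_sup (f := fun i : Fin d → ℤ => (i k).natAbs) hi
  -- Coordinates in direction k lie in [-B, B], so a shift by 2B + 2 separates them by at least 2,
  -- beyond adjacency.
  have hfar : ∀ i ∈ S, ∀ j ∈ S.map (Equiv.addRight
      (Pi.single k (2 * (B : ℤ) + 2) : Fin d → ℤ)).toEmbedding, 2 ≤ |i k - j k| := by
    intro i hi j hj
    obtain ⟨m, hm, rfl⟩ := Finset.mem_map.1 hj
    have h1 := abs_le.1 (hle i hi)
    have h2 := abs_le.1 (hle m hm)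
    simp only [Equiv.coe_toEmbedding, Equiv.coe_addRight, Pi.add_apply, Pi.single_eq_same]
    rw [abs_of_nonpos (by omega)]
    omega
  refine ⟨Pi.single k (2 * (B : ℤ) + 2), Finset.disjoint_left.2 fun i hi hi' => ?_,
    fun i hi j hj hadj => ?_⟩
  · have := hfar i hi i hi'
    simp at this
  · have h1 := hfar i hi j hj
    have h2 : ∑ k, |i k - j k| = 1 := hadj
    have h3 := Finset.single_le_sum (f := fun k => |i k - j k|) (fun _ _ => abs_nonneg _)
      (Finset.mem_univ k)
    omega

theorem infinite_grid (hd : 0 < d) : Infinite (Fin d → ℤ) := by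
  have : Nonempty (Fin d) := ⟨⟨0, hd⟩⟩
  infer_instance

theorem measurable_shift (a : Fin d → ℤ) : Measurable (shift a) := by
  unfold shift
  refine Measurable.prodMk ?_ ?_
  · exact measurable_pi_lambda _ fun i => measurable_pi_lambda _ fun j =>
      (measurable_pi_apply _).comp ((measurable_pi_apply _).comp measurable_fst)
  · exact measurable_pi_lambda _ fun i => (measurable_pi_apply _).comp measurable_snd

/-- The pair (Ĝ, ψ) is an equivariant factor of the potential, so it inherits invariance and the
zero-one law. It is only almost everywhere measurable, hence the passage to a measurable version for
the invariant event. -/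
theorem isStationaryErgodic_green_psi (hd : 0 < d) (hν : IsPotentialLaw (gridConst d w hw) ν)
    {Λ : ℕ → Finset (Fin d → ℤ)} (hΛ : IsExhaustion (grid d) Λ) :
    IsStationaryErgodic ν
      (fun β => (green (gridConst d w hw) Λ β, psi (gridConst d w hw) Λ β)) (shift (d := d)) := by
  have := hν.isProbabilityMeasure
  have := infinite_grid hd
  have hG := hΛ.graph_connected
  set F : ((Fin d → ℤ) → ℝ) → ((Fin d → ℤ) → (Fin d → ℤ) → ℝ) × ((Fin d → ℤ) → ℝ) :=
    fun β => (green (gridConst d w hw) Λ β, psi (gridConst d w hw) Λ β) with hF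
  have hFm : AEMeasurable F ν :=
    (aemeasurable_pi_lambda _ fun i => aemeasurable_pi_lambda _ fun j =>
      aemeasurable_green hν hG hΛ i j).prodMk
      (aemeasurable_pi_lambda _ fun i => aemeasurable_psi hν hG hΛ i)
  set θ : (Fin d → ℤ) → ((Fin d → ℤ) → ℝ) → ((Fin d → ℤ) → ℝ) := fun a β i => β (i + a) with hθ
  have hmp : ∀ a, MeasurePreserving (θ a) ν ν := fun a =>
    (isSymmetry_addRight (w := w) (hw := hw) a).measurePreserving hν
  have heq : ∀ a, ∀ᵐ β ∂ν, F (θ a β) = shift a (F β) := fun a => by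
    filter_upwards [(isSymmetry_addRight (w := w) (hw := hw) a).ae_equivariant hν hΛ] with β hβ
    exact Prod.ext (funext fun i => funext fun j => hβ.1 i j) (funext fun i => hβ.2 i)
  refine ⟨hFm, fun a => ⟨measurable_shift a, ?_⟩, fun s hs hinv => ?_⟩
  · rw [AEMeasurable.map_map_of_aemeasurable (measurable_shift a).aemeasurable hFm]
    have h1 : shift a ∘ F =ᵐ[ν] F ∘ θ a := by
      filter_upwards [heq a] with β hβ using hβ.symm
    have hFm' : AEMeasurable F (ν.map (θ a)) := by rwa [(hmp a).map_eq]
    rw [Measure.map_congr h1, ← AEMeasurable.map_map_of_aemeasurable hFm' (hmp a).aemeasurable,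
      (hmp a).map_eq]
  · have hmk := hFm.measurable_mk
    have hA : MeasurableSet (hFm.mk F ⁻¹' s) := hmk hs
    have hae : hFm.mk F ⁻¹' s =ᵐ[ν] F ⁻¹' s := by
      filter_upwards [hFm.ae_eq_mk] with β hβ
      change (hFm.mk F β ∈ s) = (F β ∈ s)
      rw [hβ]
    have h1 := hν.zero_one_of_invariant (fun a => isSymmetry_addRight a)
      (exists_far_translate hd) hA fun a => by
        have h2 : ∀ᵐ β ∂ν, (shift a (F β) ∈ s) = (F β ∈ s) := ae_of_ae_map hFm (hinv a)
        filter_upwards [h2, hFm.ae_eq_mk, (hmp a).quasiMeasurePreserving.ae_eq_comp hFm.ae_eq_mk,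
          heq a] with β k1 k2 k3 k4
        have k5 : F (θ a β) = hFm.mk F (θ a β) := k3
        change (hFm.mk F (θ a β) ∈ s) = (hFm.mk F β ∈ s)
        rw [← k5, k4, k1, k2]
    rw [Measure.map_apply_of_aemeasurable hFm hs, Measure.map_apply_of_aemeasurable hFm hs.compl,
      ← measure_congr hae, Set.preimage_compl, ← measure_congr hae.compl]
    exact h1

end Grid

/-! ### Polynomial growth and the dichotomy for ψ -/

section Growth
set_option linter.unusedSectionVars false

/-- Fatou's lemma along the martingale. Equality is not claimed: the limit may lose mass, and may
even vanish. -/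
theorem lintegral_psi_le {V : Type*} {G : SimpleGraph V} [G.LocallyFinite] {W : Conductances G}
    {ν : Measure (V → ℝ)} [Infinite V] (hν : IsPotentialLaw W ν) {Λ : ℕ → Finset V}
    (hΛ : IsExhaustion G Λ) (i : V) : ∫⁻ β, ENNReal.ofReal (psi W Λ β i) ∂ν ≤ 1 := by
  have hG := hΛ.graph_connected
  calc ∫⁻ β, ENNReal.ofReal (psi W Λ β i) ∂ν
      = ∫⁻ β, liminf (fun n => ENNReal.ofReal (psiVersion hν (Λ n) i β)) atTop ∂ν := by
        refine lintegral_congr_ae ?_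
        filter_upwards [tendsto_psiVersion hν hG hΛ] with β h
        exact (ENNReal.tendsto_ofReal (h i)).liminf_eq.symm
    _ ≤ liminf (fun n => ∫⁻ β, ENNReal.ofReal (psiVersion hν (Λ n) i β) ∂ν) atTop :=
        lintegral_liminf_le fun n => (measurable_psiVersion hν (Λ n) i).ennreal_ofReal
    _ = 1 := by
        simp_rw [fun n => lintegral_psiVersion hν
          (hΛ.isWired hG (fun n => Infinite.exists_notMem_finset _) n) i]
        exact liminf_const 1

/-- A field with bounded mean on the grid grows at most polynomially. -/
theorem ae_exists_le_norm_pow {Ω : Type*} [MeasurableSpace Ω] {μ : Measure Ω} {d : ℕ}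
    {f : Ω → (Fin d → ℤ) → ℝ} (hf : ∀ i, AEMeasurable (fun ω => f ω i) μ)
    (hmean : ∀ i, ∫⁻ ω, ENNReal.ofReal (f ω i) ∂μ ≤ 1) :
    ∀ᵐ ω ∂μ, ∃ C : ℝ, 0 < C ∧ ∀ i : Fin d → ℤ, i ≠ 0 → f ω i ≤ C * ‖i‖ ^ (d + 2) := by
  set B : ℕ → Finset (Fin d → ℤ) := fun n => Finset.Icc (fun _ => -(n : ℤ)) (fun _ => (n : ℤ))
  have hcard : ∀ n, (B n).card = (2 * n + 1) ^ d := fun n => by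
    simp only [B, Pi.card_Icc, Int.card_Icc, Finset.prod_const, Finset.card_univ, Fintype.card_fin]
    congr 1
    omega
  set c : ℕ → ℝ := fun n => 1 / (n : ℝ) ^ 2 with hc
  -- The n-th cube is normalised by its cardinality and weighted by 1/n², so X has finite mean; the
  -- term n = 0 has weight 1/0 = 0 and is harmless.
  set X : Ω → ℝ≥0∞ := fun ω => ∑' n : ℕ, ENNReal.ofReal (c n / (2 * n + 1) ^ d) *
    ∑ i ∈ B n, ENNReal.ofReal (f ω i) with hX
  have hXm : ∀ n, AEMeasurable (fun ω => ENNReal.ofReal (c n / (2 * n + 1) ^ d) *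
      ∑ i ∈ B n, ENNReal.ofReal (f ω i)) μ := fun n =>
    (Finset.aemeasurable_fun_sum _ fun i _ => (hf i).ennreal_ofReal).const_mul _
  have hXint : ∫⁻ ω, X ω ∂μ ≠ ∞ := by
    rw [hX, lintegral_tsum hXm]
    refine ne_top_of_le_ne_top
      (b := ∑' n : ℕ, ENNReal.ofReal (c n)) ?_ (ENNReal.tsum_le_tsum fun n => ?_)
    · rw [← ENNReal.ofReal_tsum_of_nonneg (fun n => by positivity)
        (Real.summable_one_div_nat_pow.2 one_lt_two)]
      exact ENNReal.ofReal_ne_top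
    · rw [lintegral_const_mul' _ _ ENNReal.ofReal_ne_top,
        lintegral_finsetSum' _ fun i _ => (hf i).ennreal_ofReal]
      calc ENNReal.ofReal (c n / (2 * n + 1) ^ d) *
            ∑ i ∈ B n, ∫⁻ ω, ENNReal.ofReal (f ω i) ∂μ
          ≤ ENNReal.ofReal (c n / (2 * n + 1) ^ d) * ∑ i ∈ B n, 1 := by
            gcongr with i
            exact hmean i
        _ = ENNReal.ofReal (c n) := by
            rw [Finset.sum_const, hcard, nsmul_eq_mul, mul_one,
              ← ENNReal.ofReal_natCast, ← ENNReal.ofReal_mul (by positivity)]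
            congr 1
            push_cast
            field_simp
  filter_upwards [ae_lt_top' (AEMeasurable.tsum hXm) hXint] with ω hω
  set C := (X ω).toReal with hC
  have hC0 : 0 ≤ C := ENNReal.toReal_nonneg
  -- With n the ceiling of ‖i‖ ≥ 1 one has n ≤ 2‖i‖, so both n and 2n + 1 are at most 6‖i‖. The
  -- additional 1 makes the constant positive.
  refine ⟨C * 6 ^ (d + 2) + 1, by positivity, fun i hi => ?_⟩
  set n := ⌈‖i‖⌉₊ with hn
  have hnorm : ∀ k, |i k| ≤ ‖i‖ := fun k => by
    have := norm_le_pi_norm i k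
    rwa [Int.norm_eq_abs, ← Int.cast_abs] at this
  have h1 : 1 ≤ ‖i‖ := by
    obtain ⟨k, hk⟩ := Function.ne_iff.1 hi
    refine le_trans ?_ (hnorm k)
    exact_mod_cast Int.one_le_abs hk
  have hn1 : ‖i‖ ≤ n := Nat.le_ceil _
  have hn2 : (n : ℝ) ≤ 2 * ‖i‖ := by
    have := (Nat.ceil_lt_add_one (norm_nonneg i)).le
    linarith
  have hnpos : (1 : ℝ) ≤ n := h1.trans hn1
  have hmem : i ∈ B n := by
    refine Finset.mem_Icc.2 ⟨fun k => ?_, fun k => ?_⟩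
    · have h2 : (|i k| : ℤ) ≤ (n : ℤ) := by exact_mod_cast (hnorm k).trans hn1
      exact (abs_le.1 h2).1
    · have h2 : (|i k| : ℤ) ≤ (n : ℤ) := by exact_mod_cast (hnorm k).trans hn1
      exact (abs_le.1 h2).2
  have h2 : ENNReal.ofReal (c n / (2 * n + 1) ^ d) * ENNReal.ofReal (f ω i) ≤
      ENNReal.ofReal C := by
    rw [hC, ENNReal.ofReal_toReal hω.ne]
    refine le_trans ?_ (ENNReal.le_tsum n)
    gcongr
    exact Finset.single_le_sum (f := fun i => ENNReal.ofReal (f ω i)) (fun _ _ => zero_le) hmem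
  rw [← ENNReal.ofReal_mul (by positivity), ENNReal.ofReal_le_ofReal_iff hC0] at h2
  have h3 : f ω i ≤ C * ((n : ℝ) ^ 2 * (2 * n + 1) ^ d) := by
    have h4 : (0 : ℝ) < (n : ℝ) ^ 2 * (2 * n + 1) ^ d := by positivity
    calc f ω i = (c n / (2 * n + 1) ^ d * f ω i) * ((n : ℝ) ^ 2 * (2 * n + 1) ^ d) := by
          simp only [hc]
          field_simp
      _ ≤ _ := mul_le_mul_of_nonneg_right h2 h4.le
  refine h3.trans ?_
  have h5 : (n : ℝ) ^ 2 * (2 * n + 1) ^ d ≤ (6 * ‖i‖) ^ (d + 2) := by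
    rw [pow_add, mul_comm]
    gcongr
    · linarith
    · linarith
  calc C * ((n : ℝ) ^ 2 * (2 * n + 1) ^ d) ≤ C * (6 * ‖i‖) ^ (d + 2) :=
        mul_le_mul_of_nonneg_left h5 hC0
    _ ≤ (C * 6 ^ (d + 2) + 1) * ‖i‖ ^ (d + 2) := by
        rw [mul_pow, ← mul_assoc]
        exact mul_le_mul_of_nonneg_right (by linarith) (by positivity)

variable {d : ℕ} {w : ℝ} {hw : 0 < w} {ν : Measure ((Fin d → ℤ) → ℝ)}

/-- A minimum principle: at a zero of ψ the equation makes a sum of nonnegative terms vanish, so all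
neighbours are zeros, and connectedness concludes. -/
theorem IsRegular.psi_eq_zero {V : Type*} {G : SimpleGraph V} [G.LocallyFinite]
    {W : Conductances G} {Λ : ℕ → Finset V} {β : V → ℝ} (h : IsRegular W Λ β)
    (hΛ : IsExhaustion G Λ) {i : V} (hi : psi W Λ β i = 0) (j : V) : psi W Λ β j = 0 := by
  obtain ⟨p⟩ := hΛ.graph_connected.preconnected i j
  induction p with
  | nil => exact hi
  | @cons u v _ hadj _ ih =>
    refine ih ?_
    have h1 := h.schrodinger_psi hΛ u
    rw [schrodinger_eq_weight, hi, smul_zero, zero_sub, neg_eq_zero,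
      Finset.sum_eq_zero_iff_of_nonneg fun k _ =>
        smul_nonneg (W.weight_nonneg _ _) (psi_nonneg _ _ _ _)] at h1
    have h2 := h1 v ((G.mem_neighborFinset u v).2 hadj)
    exact (smul_eq_zero.1 h2).resolve_left (W.weight_pos hadj).ne'

/-- Vanishing identically is a shift-invariant event, so it has probability 0 or 1. Outside it the
minimum principle gives strict positivity everywhere. -/
theorem ae_psi_pos_of_not_ae_eq_zero (hd : 0 < d) (hν : IsPotentialLaw (gridConst d w hw) ν)
    {Λ : ℕ → Finset (Fin d → ℤ)} (hΛ : IsExhaustion (grid d) Λ) {i₀ : Fin d → ℤ}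
    (h : ¬ ∀ᵐ β ∂ν, psi (gridConst d w hw) Λ β i₀ = 0) :
    ∀ᵐ β ∂ν, ∀ i, 0 < psi (gridConst d w hw) Λ β i := by
  have hse := isStationaryErgodic_green_psi hd hν hΛ
  set s : Set (((Fin d → ℤ) → (Fin d → ℤ) → ℝ) × ((Fin d → ℤ) → ℝ)) := {p | ∀ i, p.2 i = 0}
    with hs
  have hsm : MeasurableSet s := by
    rw [hs, Set.ofPred_forall]
    exact MeasurableSet.iInter fun i =>
      measurableSet_eq_fun ((measurable_pi_apply i).comp measurable_snd) measurable_const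
  have hinv : ∀ a, shift a ⁻¹' s = s := fun a => by
    ext p
    refine ⟨fun hp i => ?_, fun hp i => hp _⟩
    have := hp (i - a)
    simpa [shift] using this
  have hreg := ae_isRegular hΛ.graph_connected hν hΛ
  rcases hse.ergodic s hsm fun a => (hinv a).eventuallyEq with h0 | h0
  · have h1 : ∀ᵐ β ∂ν, ¬ ∀ i, psi (gridConst d w hw) Λ β i = 0 :=
      ae_of_ae_map hse.aemeasurable (measure_eq_zero_iff_ae_notMem.1 h0)
    filter_upwards [h1, hreg] with β h2 h3 i
    refine lt_of_le_of_ne (psi_nonneg _ _ _ _) fun h4 => h2 fun j => ?_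
    exact h3.psi_eq_zero hΛ h4.symm j
  · refine absurd ?_ h
    have h1 : ∀ᵐ β ∂ν, ∀ i, psi (gridConst d w hw) Λ β i = 0 := by
      have h2 := ae_of_ae_map hse.aemeasurable (measure_eq_zero_iff_ae_notMem.1 h0)
      filter_upwards [h2] with β hβ
      exact not_not.1 hβ
    filter_upwards [h1] with β hβ using hβ i₀

end Growth

/-! ### One jump of the reinforced process against the potential -/

section StepIdentity
set_option linter.unusedSectionVars false
variable {V : Type*} {G : SimpleGraph V} [G.LocallyFinite] {W : Conductances G}

/-- The integrand is an exact derivative. Here originates the factor 1/(2β_x): it is what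
integration over the holding time at x leaves. -/
theorem lintegral_mul_exp_sq_sub {b c : ℝ} (hb : 0 < b) (hc : 0 ≤ c) :
    ∫⁻ t in Set.Ioi (0 : ℝ), ENNReal.ofReal ((c + t) * Real.exp (-(((c + t) ^ 2 - c ^ 2) * b))) =
      ENNReal.ofReal (1 / (2 * b)) := by
  set F : ℝ → ℝ := fun t => -(Real.exp (-(((c + t) ^ 2 - c ^ 2) * b)) / (2 * b)) with hF
  have hderiv : ∀ t ∈ Set.Ici (0 : ℝ),
      HasDerivAt F ((c + t) * Real.exp (-(((c + t) ^ 2 - c ^ 2) * b))) t := by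
    intro t _
    have h1 : HasDerivAt (fun t : ℝ => -(((c + t) ^ 2 - c ^ 2) * b)) (-(2 * (c + t) * b)) t := by
      have h2 := (((((hasDerivAt_id t).const_add c).pow 2).sub_const (c ^ 2)).mul_const b).neg
      refine h2.congr_deriv ?_
      simp
    refine ((h1.exp.div_const (2 * b)).neg).congr_deriv ?_
    field_simp
  have hnn : ∀ t ∈ Set.Ioi (0 : ℝ),
      0 ≤ (c + t) * Real.exp (-(((c + t) ^ 2 - c ^ 2) * b)) := fun t ht =>
    mul_nonneg (add_nonneg hc (le_of_lt ht)) (Real.exp_pos _).le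
  have hlim : Tendsto F atTop (𝓝 (-(0 / (2 * b)))) := by
    refine ((Real.tendsto_exp_atBot.comp ?_).div_const _).neg
    refine tendsto_neg_atTop_atBot.comp ?_
    refine Tendsto.atTop_mul_const hb ?_
    refine tendsto_atTop_mono' _ ?_ tendsto_id
    filter_upwards [eventually_ge_atTop 1] with t ht
    change t ≤ (c + t) ^ 2 - c ^ 2
    nlinarith
  have hint := integrableOn_Ioi_deriv_of_nonneg' hderiv hnn hlim
  rw [← ofReal_integral_eq_lintegral_ofReal hint
    ((ae_restrict_iff' measurableSet_Ioi).2 (ae_of_all _ hnn)),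
    integral_Ioi_of_hasDerivAt_of_nonneg' hderiv hnn hlim]
  congr 1
  simp [hF]

/-- The local times after a stay of length `t` at `x`. -/
def bump [DecidableEq V] (L : V → ℝ) (x : V) (t : ℝ) : V → ℝ :=
  fun j => L j + if x = j then t else 0

/-- Only the terms of x change, and they are affine in its local time with slope the total jump rate
from x. Thus the normalisation of `laplaceMean` produces exactly the survival factor of the
exponential holding time. -/
theorem lap_bump [DecidableEq V] {S : Finset V} {L : V → ℝ} (hL : ∀ i, 0 < L i)
    (hoff : ∀ j ∉ S, L j = 1) {x : V} (hx : x ∈ S) {t : ℝ} (ht : 0 ≤ t) :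
    lap W S (bump L x t) * (L x + t) =
      lap W S L * L x * Real.exp (-(∑ j ∈ G.neighborFinset x, W.weight x j * L j) * t) := by
  set S' := S.erase x with hS'
  have hxS' : x ∉ S' := Finset.notMem_erase x S
  have hS : insert x S' = S := Finset.insert_erase hx
  have hne : ∀ j ∈ S', bump L x t j = L j := fun j hj => by
    simp [bump, (Finset.ne_of_mem_erase hj).symm]
  have hbx : bump L x t x = L x + t := by simp [bump]
  have hR : ∑ j ∈ G.neighborFinset x, W.weight x j * L j =
      ∑ j ∈ S', W.weight j x * L j + boundaryWeight W S x := by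
    rw [sum_weight_eq_of_eq_one W S L x hoff]
    conv_lhs => rw [← hS]
    rw [Finset.sum_insert hxS', W.weight_self, zero_mul, zero_add]
    congr 1
    · exact Finset.sum_congr rfl fun j _ => by rw [W.weight_symm]
    · rw [hS]
  have h1 := lap_insert (W := W) hxS' (bump L x t)
  have h2 := lap_insert (W := W) hxS' L
  rw [hS] at h1 h2
  have h3 : ∑ j ∈ S', W.weight j x * bump L x t j = ∑ j ∈ S', W.weight j x * L j :=
    Finset.sum_congr rfl fun j hj => by rw [hne j hj]
  rw [h1, h2, lap_congr W hne, h3, hbx, hR]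
  have hLx := hL x
  have hLt : 0 < L x + t := by linarith
  set A := ∑ j ∈ S', W.weight j x * L j
  set η := boundaryWeight W S x
  have h4 : Real.exp (-((L x + t - 1) * A) - η * (L x + t - 1)) =
      Real.exp (-((L x - 1) * A) - η * (L x - 1)) * Real.exp (-(A + η) * t) := by
    rw [← Real.exp_add]
    congr 1
    ring
  rw [h4]
  field_simp

/-- The integral, against the Laplace weight of the local times `L`, of a function of the
potential and of the position. -/
def laplaceMean (W : Conductances G) (S : Finset V) (Q : Measure (V → ℝ))
    (q : (V → ℝ) → V → ℝ≥0∞) (L : V → ℝ) (x : V) : ℝ≥0∞ :=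
  (∫⁻ β, q β x * ENNReal.ofReal (Real.exp (-∑ i ∈ S, (L i ^ 2 - 1) * β i)) ∂Q) *
    ENNReal.ofReal (1 / (lap W S L * L x))

open Classical in
/-- The transition operator of the random walk in the potential `β`, killed outside `S`. -/
def walkStep (W : Conductances G) (S : Finset V) (q : (V → ℝ) → V → ℝ≥0∞) (β : V → ℝ) (x : V) :
    ℝ≥0∞ :=
  if x ∈ S then
    ∑ y ∈ G.neighborFinset x, ENNReal.ofReal (W.weight x y / (2 * β x)) * q β y
  else 0

theorem measurable_walkStep (W : Conductances G) (S : Finset V) {q : (V → ℝ) → V → ℝ≥0∞}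
    (hq : ∀ y, Measurable fun β => q β y) (x : V) : Measurable fun β => walkStep W S q β x := by
  unfold walkStep
  split_ifs
  · refine Finset.measurable_sum _ fun y _ => Measurable.mul ?_ (hq y)
    have : Measurable fun β : V → ℝ => β x := measurable_pi_apply x
    fun_prop
  · exact measurable_const

/-- The survival factor of the jump cancels against `lap_bump`, and L_y against the normalisation at
y. After exchanging the integrals, the one over t is explicit and leaves W_{x,y}/(2β_x). -/
theorem lintegral_laplaceMean_bump [DecidableEq V] {S : Finset V} {Q : Measure (V → ℝ)}
    [SFinite Q] (hQ : ∀ᵐ β ∂Q, ∀ i, 0 < β i) {q : (V → ℝ) → V → ℝ≥0∞}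
    (hq : ∀ y, Measurable fun β => q β y) {L : V → ℝ} (hL : ∀ i, 0 < L i)
    (hoff : ∀ j ∉ S, L j = 1) {x : V} (hx : x ∈ S) {y : V} (hy : y ≠ x) :
    ∫⁻ t in Set.Ioi (0 : ℝ), ENNReal.ofReal (W.weight x y * L y *
        Real.exp (-((∑ j ∈ G.neighborFinset x, W.weight x j * L j) * t))) *
        laplaceMean W S Q q (bump L x t) y =
      (∫⁻ β, ENNReal.ofReal (W.weight x y / (2 * β x)) * q β y *
        ENNReal.ofReal (Real.exp (-∑ i ∈ S, (L i ^ 2 - 1) * β i)) ∂Q) *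
        ENNReal.ofReal (1 / (lap W S L * L x)) := by
  set R := ∑ j ∈ G.neighborFinset x, W.weight x j * L j with hR
  have hlap := lap_pos W S hL
  have hLx := hL x
  have hLy := hL y
  have hw := W.weight_nonneg x y
  have hK : 0 ≤ W.weight x y / (lap W S L * L x) := by positivity
  have hexp : ∀ (β : V → ℝ) (t : ℝ), ∑ i ∈ S, (bump L x t i ^ 2 - 1) * β i =
      ∑ i ∈ S, (L i ^ 2 - 1) * β i + ((L x + t) ^ 2 - L x ^ 2) * β x := by
    intro β t
    have h1 : ((L x + t) ^ 2 - L x ^ 2) * β x =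
        ∑ i ∈ S, if i = x then ((L x + t) ^ 2 - L x ^ 2) * β x else 0 := by
      rw [Finset.sum_ite_eq' S x, if_pos hx]
    rw [h1, ← Finset.sum_add_distrib]
    refine Finset.sum_congr rfl fun i _ => ?_
    by_cases hi : i = x
    · subst hi
      simp [bump]
      ring
    · simp [bump, hi, Ne.symm hi]
  have hpt : ∀ t ∈ Set.Ioi (0 : ℝ), ENNReal.ofReal (W.weight x y * L y * Real.exp (-(R * t))) *
      laplaceMean W S Q q (bump L x t) y =
      ∫⁻ β, ENNReal.ofReal (W.weight x y / (lap W S L * L x)) * (q β y *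
        ENNReal.ofReal (Real.exp (-∑ i ∈ S, (L i ^ 2 - 1) * β i)) *
        ENNReal.ofReal ((L x + t) * Real.exp (-(((L x + t) ^ 2 - L x ^ 2) * β x)))) ∂Q := by
    intro t ht
    have ht0 : 0 < t := ht
    have hLt : 0 < L x + t := by linarith
    have hbump := lap_bump (W := W) hL hoff hx ht0.le
    have hby : bump L x t y = L y := by simp [bump, hy.symm]
    have hbpos : 0 < lap W S (bump L x t) := lap_pos W S fun i => by
      simp only [bump]
      split_ifs
      · linarith [hL i]
      · linarith [hL i]
    rw [laplaceMean, hby, mul_left_comm, ← ENNReal.ofReal_mul (by positivity), mul_comm,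
      ← lintegral_const_mul' _ _ ENNReal.ofReal_ne_top]
    refine lintegral_congr fun β => ?_
    have h2 : W.weight x y * L y * Real.exp (-(R * t)) * (1 / (lap W S (bump L x t) * L y)) =
        W.weight x y / (lap W S L * L x) * (L x + t) := by
      have h3 : lap W S (bump L x t) = lap W S L * L x * Real.exp (-R * t) / (L x + t) := by
        rw [eq_div_iff hLt.ne', hbump]
      rw [h3, neg_mul]
      have := Real.exp_pos (-(R * t))
      field_simp
    rw [h2, hexp β t, neg_add, Real.exp_add, ENNReal.ofReal_mul hK, ENNReal.ofReal_mul
      (Real.exp_pos _).le, ENNReal.ofReal_mul hLt.le]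
    ring
  rw [setLIntegral_congr_fun measurableSet_Ioi hpt]
  have hm1 : Measurable fun p : ℝ × (V → ℝ) => p.2 x := (measurable_pi_apply x).comp measurable_snd
  have hm2 : Measurable fun p : ℝ × (V → ℝ) => q p.2 y := (hq y).comp measurable_snd
  have hm3 : Measurable fun p : ℝ × (V → ℝ) => Real.exp (-∑ i ∈ S, (L i ^ 2 - 1) * p.2 i) :=
    (measurable_exp_neg_sum S fun i => L i ^ 2 - 1).comp measurable_snd
  rw [lintegral_lintegral_swap (by
    refine Measurable.aemeasurable ?_
    simp only [Function.uncurry_def]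
    fun_prop), ← lintegral_mul_const' _ _ ENNReal.ofReal_ne_top]
  refine lintegral_congr_ae ?_
  filter_upwards [hQ] with β hβ
  have hβx := hβ x
  rw [lintegral_const_mul' _ _ ENNReal.ofReal_ne_top]
  simp only [mul_assoc]
  have hm4 : Measurable fun t : ℝ => ENNReal.ofReal
      ((L x + t) * Real.exp (-(((L x + t) ^ 2 - L x ^ 2) * β x))) := by fun_prop
  rw [lintegral_const_mul _ (hm4.const_mul _), lintegral_const_mul _ hm4,
    lintegral_mul_exp_sq_sub hβx hLx.le]
  have h5 : ENNReal.ofReal (W.weight x y / (lap W S L * L x)) * ENNReal.ofReal (1 / (2 * β x)) =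
      ENNReal.ofReal (W.weight x y / (2 * β x)) * ENNReal.ofReal (1 / (lap W S L * L x)) := by
    rw [← ENNReal.ofReal_mul hK, ← ENNReal.ofReal_mul (by positivity)]
    congr 1
    field_simp
  calc _ = (ENNReal.ofReal (W.weight x y / (lap W S L * L x)) * ENNReal.ofReal (1 / (2 * β x))) *
        (q β y * ENNReal.ofReal (Real.exp (-∑ i ∈ S, (L i ^ 2 - 1) * β i))) := by ring
    _ = _ := by rw [h5]; ring

theorem sum_lintegral_laplaceMean_bump [DecidableEq V] {S : Finset V} {Q : Measure (V → ℝ)}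
    [SFinite Q] (hQ : ∀ᵐ β ∂Q, ∀ i, 0 < β i) {q : (V → ℝ) → V → ℝ≥0∞}
    (hq : ∀ y, Measurable fun β => q β y) {L : V → ℝ} (hL : ∀ i, 0 < L i)
    (hoff : ∀ j ∉ S, L j = 1) {x : V} (hx : x ∈ S) :
    ∑ y ∈ G.neighborFinset x, ∫⁻ t in Set.Ioi (0 : ℝ), ENNReal.ofReal (W.weight x y * L y *
        Real.exp (-((∑ j ∈ G.neighborFinset x, W.weight x j * L j) * t))) *
        laplaceMean W S Q q (bump L x t) y = laplaceMean W S Q (walkStep W S q) L x := by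
  have h1 : ∀ y ∈ G.neighborFinset x, y ≠ x := fun y hy =>
    ((G.mem_neighborFinset x y).1 hy).ne'
  rw [Finset.sum_congr rfl fun y hy =>
    lintegral_laplaceMean_bump (W := W) hQ hq hL hoff hx (h1 y hy), ← Finset.sum_mul,
    laplaceMean, ← lintegral_finsetSum]
  · congr 1
    refine lintegral_congr fun β => ?_
    rw [walkStep, if_pos hx, Finset.sum_mul]
  · intro y _
    have h2 : Measurable fun β : V → ℝ => β x := measurable_pi_apply x
    have h3 := hq y
    have h4 := measurable_exp_neg_sum S fun i => L i ^ 2 - 1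
    fun_prop

end StepIdentity

/-! ### Return weights of the walk in the potential -/

section HittingFunction
set_option linter.unusedSectionVars false
variable {V : Type*} {G : SimpleGraph V} [G.LocallyFinite] {W : Conductances G} {S : Finset V}

theorem walkStep_mono {q q' : (V → ℝ) → V → ℝ≥0∞} {β : V → ℝ} (h : ∀ y, q β y ≤ q' β y) (x : V) :
    walkStep W S q β x ≤ walkStep W S q' β x := by
  unfold walkStep
  split_ifs
  · exact Finset.sum_le_sum fun y _ => by gcongr; exact h y
  · exact le_rfl

theorem walkStep_of_notMem (q : (V → ℝ) → V → ℝ≥0∞) (β : V → ℝ) {x : V} (hx : x ∉ S) :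
    walkStep W S q β x = 0 := if_neg hx

theorem walkStep_const_mul (q : (V → ℝ) → V → ℝ≥0∞) (r : (V → ℝ) → ℝ≥0∞) (β : V → ℝ) (x : V) :
    walkStep W S (fun β y => r β * q β y) β x = r β * walkStep W S q β x := by
  unfold walkStep
  split_ifs
  · rw [Finset.mul_sum]
    exact Finset.sum_congr rfl fun y _ => mul_left_comm _ _ _
  · rw [mul_zero]

theorem walkStep_iSup {q : ℕ → (V → ℝ) → V → ℝ≥0∞} {β : V → ℝ}
    (hq : ∀ y, Monotone fun n => q n β y) (x : V) :
    walkStep W S (fun β y => ⨆ n, q n β y) β x = ⨆ n, walkStep W S (q n) β x := by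
  unfold walkStep
  split_ifs
  · simp_rw [ENNReal.mul_iSup]
    rw [ENNReal.finsetSum_iSup_of_monotone]
    exact fun y m n hmn => mul_le_mul_right (hq y hmn) _
  · simp

open Classical in
/-- The probability that the walk in the potential `β`, killed outside `S`, started at `x`, hits
`i₀` in at most `M` steps. -/
def hitProb (W : Conductances G) (S : Finset V) (i₀ : V) : ℕ → (V → ℝ) → V → ℝ≥0∞
  | 0, _, x => if x = i₀ then 1 else 0
  | M + 1, β, x => if x = i₀ then 1 else walkStep W S (hitProb W S i₀ M) β x

theorem hitProb_self (i₀ : V) (M : ℕ) (β : V → ℝ) : hitProb W S i₀ M β i₀ = 1 := by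
  cases M <;> simp [hitProb]

theorem hitProb_succ_of_ne {i₀ x : V} (hx : x ≠ i₀) (M : ℕ) (β : V → ℝ) :
    hitProb W S i₀ (M + 1) β x = walkStep W S (hitProb W S i₀ M) β x := by
  simp [hitProb, hx]

theorem hitProb_of_notMem {i₀ : V} (hi₀ : i₀ ∈ S) (M : ℕ) (β : V → ℝ) {x : V} (hx : x ∉ S) :
    hitProb W S i₀ M β x = 0 := by
  have hne : x ≠ i₀ := fun h => hx (h ▸ hi₀)
  cases M with
  | zero => simp [hitProb, hne]
  | succ M => rw [hitProb_succ_of_ne hne, walkStep_of_notMem _ _ hx]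

theorem measurable_hitProb (i₀ : V) (M : ℕ) (x : V) :
    Measurable fun β => hitProb W S i₀ M β x := by
  induction M generalizing x with
  | zero => exact measurable_const
  | succ M ih =>
    unfold hitProb
    split_ifs
    · exact measurable_const
    · exact measurable_walkStep W S ih x

theorem monotone_hitProb (i₀ : V) (β : V → ℝ) (x : V) :
    Monotone fun M => hitProb W S i₀ M β x := by
  refine monotone_nat_of_le_succ fun M => ?_
  induction M generalizing x with
  | zero =>
    by_cases hx : x = i₀
    · subst hx; rw [hitProb_self, hitProb_self]
    · simp [hitProb, hx]
  | succ M ih =>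
    by_cases hx : x = i₀
    · subst hx; rw [hitProb_self, hitProb_self]
    · rw [hitProb_succ_of_ne hx, hitProb_succ_of_ne hx]
      exact walkStep_mono ih x

/-- Let v be the limit of the hitting functions. Away from i₀ it satisfies v = Pv. At i₀ the value
Pv is the return weight, whose relation to the Green function is g = 1/(2β(1 - r)); only the bound
Pv ≥ r is needed and proved. -/
theorem le_walkStep_iSup_hitProb {i₀ : V} (hi₀ : i₀ ∈ S) {β : V → ℝ} (hβ : ∀ i, 0 < β i)
    {g : V → V → ℝ} (hg : IsGreen W S β g) (x : V) :
    ENNReal.ofReal (1 - 1 / (2 * β i₀ * g i₀ i₀)) * ⨆ M, hitProb W S i₀ M β x ≤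
      walkStep W S (fun β y => ⨆ M, hitProb W S i₀ M β y) β x := by
  classical
  have hb := hβ i₀
  set v : (V → ℝ) → V → ℝ≥0∞ := fun β y => ⨆ M, hitProb W S i₀ M β y with hv
  have hvself : v β i₀ = 1 := by simp [hv, hitProb_self]
  have hvoff : ∀ x ∉ S, v β x = 0 := fun x hx => by simp [hv, hitProb_of_notMem hi₀ _ _ hx]
  have hvne : ∀ x, x ≠ i₀ → v β x = walkStep W S v β x := fun x hx => by
    rw [hv, walkStep_iSup fun y => monotone_hitProb i₀ β y]
    have h1 := Monotone.iSup_nat_add (monotone_hitProb (W := W) (S := S) i₀ β x) 1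
    simp only at h1 ⊢
    rw [← h1]
    exact iSup_congr fun M => hitProb_succ_of_ne hx M β
  have hdiag : 1 ≤ 2 * β i₀ * g i₀ i₀ := hg.diag_pos hi₀
  have hg0 : 0 < g i₀ i₀ := by
    by_contra hcon
    push Not at hcon
    nlinarith
  have hr1 : 1 - 1 / (2 * β i₀ * g i₀ i₀) ≤ 1 := by
    have : 0 ≤ 1 / (2 * β i₀ * g i₀ i₀) := by positivity
    linarith
  by_cases hx : x = i₀
  · subst hx
    change _ * v β x ≤ _
    rw [hvself, mul_one]
    by_contra! hcon
    set c := walkStep W S v β x with hc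
    have hctop : c ≠ ∞ := (hcon.trans ENNReal.ofReal_lt_top).ne
    have hcr : c.toReal < 1 - 1 / (2 * β x * g x x) :=
      (ENNReal.lt_ofReal_iff_toReal_lt hctop).1 hcon
    have hc1 : 0 < 1 - c.toReal := by linarith
    -- K is the value the Green function would have with return weight c. The multiple Kv is a
    -- supersolution, so by minimality g ≤ K, which contradicts c < r.
    set K : ℝ := 1 / (2 * β x * (1 - c.toReal)) with hK
    have hK0 : 0 < K := by positivity
    have hsuper := greenFin_le_of_supersolution W S hβ x
      (fun y => ENNReal.ofReal K * v β y) (fun y hy => ?_) x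
    · rw [hg.greenFin_eq hβ, hvself, mul_one, ENNReal.ofReal_le_ofReal_iff hK0.le, hK,
        le_div_iff₀ (by positivity)] at hsuper
      have h2 : 1 / (2 * β x * g x x) < 1 - c.toReal := by linarith
      rw [div_lt_iff₀ (by positivity)] at h2
      nlinarith
    · have h3 : ∑ k ∈ G.neighborFinset y, ENNReal.ofReal (W.weight y k / (2 * β y)) *
          (ENNReal.ofReal K * v β k) = ENNReal.ofReal K * walkStep W S v β y := by
        rw [walkStep, if_pos hy, Finset.mul_sum]
        exact Finset.sum_congr rfl fun k _ => mul_left_comm _ _ _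
      rw [h3]
      by_cases hyx : y = x
      · subst hyx
        rw [if_pos rfl, hvself, mul_one, ← hc, ← ENNReal.ofReal_toReal hctop,
          ← ENNReal.ofReal_mul hK0.le, ← ENNReal.ofReal_add (by positivity)
          (mul_nonneg hK0.le ENNReal.toReal_nonneg)]
        refine le_of_eq ?_
        congr 1
        rw [hK]
        field_simp
        ring
      · rw [if_neg hyx, zero_add, hvne y hyx]
  · change _ * v β x ≤ _
    rw [hvne x hx]
    refine mul_le_of_le_one_left zero_le ?_
    exact ENNReal.ofReal_le_one.2 hr1

theorem walkStep_iterate_iSup_hitProb (i₀ : V) (m : ℕ) (β : V → ℝ) (x : V) :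
    (walkStep W S)^[m] (fun β y => ⨆ M, hitProb W S i₀ M β y) β x =
      ⨆ M, (walkStep W S)^[m] (hitProb W S i₀ M) β x ∧
      Monotone fun M => (walkStep W S)^[m] (hitProb W S i₀ M) β x := by
  induction m generalizing x with
  | zero => exact ⟨rfl, monotone_hitProb i₀ β x⟩
  | succ m ih =>
    simp only [Function.iterate_succ_apply']
    refine ⟨?_, fun M N hMN => walkStep_mono (fun y => (ih y).2 hMN) x⟩
    rw [← walkStep_iSup fun y => (ih y).2]
    exact le_antisymm (walkStep_mono (fun y => (ih y).1.le) x)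
      (walkStep_mono (fun y => (ih y).1.ge) x)

/-- Each application of P costs at most a factor r ≤ 1, even away from i₀, so no counting of returns
is needed to reach r^m. -/
theorem pow_le_walkStep_iterate {i₀ : V} (hi₀ : i₀ ∈ S) {β : V → ℝ} (hβ : ∀ i, 0 < β i)
    {g : V → V → ℝ} (hg : IsGreen W S β g) (m : ℕ) :
    ENNReal.ofReal (1 - 1 / (2 * β i₀ * g i₀ i₀)) ^ m ≤
      ⨆ M, (walkStep W S)^[m] (hitProb W S i₀ M) β i₀ := by
  set v : (V → ℝ) → V → ℝ≥0∞ := fun β y => ⨆ M, hitProb W S i₀ M β y with hv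
  set r := ENNReal.ofReal (1 - 1 / (2 * β i₀ * g i₀ i₀)) with hr
  have h1 : ∀ m x, r ^ m * v β x ≤ (walkStep W S)^[m] v β x := by
    intro m
    induction m with
    | zero => intro x; simp
    | succ m ih =>
      intro x
      rw [Function.iterate_succ_apply', pow_succ, mul_assoc]
      refine (mul_le_mul_right (le_walkStep_iSup_hitProb hi₀ hβ hg x) _).trans ?_
      rw [← walkStep_const_mul v (fun _ => r ^ m) β x]
      exact walkStep_mono ih x
  have h2 := h1 m i₀
  have h3 : v β i₀ = 1 := by simp [hv, hitProb_self]
  rw [h3, mul_one, (walkStep_iterate_iSup_hitProb i₀ m β i₀).1] at h2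
  exact h2

theorem measurable_walkStep_iterate {q : (V → ℝ) → V → ℝ≥0∞}
    (hq : ∀ y, Measurable fun β => q β y) (m : ℕ) (x : V) :
    Measurable fun β => (walkStep W S)^[m] q β x := by
  induction m generalizing x with
  | zero => exact hq x
  | succ m ih =>
    simp only [Function.iterate_succ_apply']
    exact measurable_walkStep W S ih x

end HittingFunction

/-! ### The law of the reinforced process and the transport identity -/

section Trajectories
set_option linter.unusedSectionVars false
variable {V : Type*} {G : SimpleGraph V} [G.LocallyFinite] {W : Conductances G}
  [MeasurableSpace V] [DiscreteMeasurableSpace V] [Countable V]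

/-- The history of a trajectory up to the `m`-th jump. -/
abbrev hist (m : ℕ) (x : ℕ → V × ℝ) : History V m :=
  Preorder.frestrictLe (π := fun _ : ℕ => V × ℝ) m x

theorem measurable_hist (m : ℕ) : Measurable (hist (V := V) m) :=
  Preorder.measurable_frestrictLe m

theorem isProbabilityMeasure_processLaw (hG : ∀ i, (G.neighborFinset i).Nonempty) (i₀ : V) :
    IsProbabilityMeasure (processLaw W hG i₀) := by
  have := isMarkovKernel_stepKernel W hG
  unfold processLaw
  infer_instance

theorem lintegral_processLaw_succ (hG : ∀ i, (G.neighborFinset i).Nonempty) (i₀ : V) (m : ℕ)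
    {F : History V m × (V × ℝ) → ℝ≥0∞} (hF : Measurable F) :
    ∫⁻ x, F (hist m x, x (m + 1)) ∂(processLaw W hG i₀) =
      ∫⁻ x, ∫⁻ p, stepDensity W (hist m x) p * F (hist m x, p)
        ∂((Measure.count : Measure V).prod (volume : Measure ℝ)) ∂(processLaw W hG i₀) := by
  have := isMarkovKernel_stepKernel W hG
  have h := Kernel.map_frestrictLe_trajMeasure_compProd_eq_map_trajMeasure
    (X := fun _ => V × ℝ) (μ₀ := Measure.dirac ((i₀, 0) : V × ℝ)) (κ := fun n => stepKernel W n)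
    (a := m)
  have hP : processLaw W hG i₀ = Kernel.trajMeasure (X := fun _ => V × ℝ)
    (Measure.dirac ((i₀, 0) : V × ℝ)) (fun n => stepKernel W n) := rfl
  rw [← hP] at h
  have hm : Measurable fun x : ℕ → V × ℝ => (hist m x, x (m + 1)) :=
    (measurable_hist m).prodMk (measurable_pi_apply _)
  have h1 : ∫⁻ x, F (hist m x, x (m + 1)) ∂(processLaw W hG i₀) =
      ∫⁻ z, F z ∂((processLaw W hG i₀).map fun x => (hist m x, x (m + 1))) :=
    (lintegral_map hF hm).symm
  have := isProbabilityMeasure_processLaw (W := W) hG i₀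
  have : IsProbabilityMeasure ((processLaw W hG i₀).map (hist m)) :=
    Measure.isProbabilityMeasure_map (measurable_hist m).aemeasurable
  rw [h1]
  refine (congrArg (fun μ => ∫⁻ z, F z ∂μ) h).symm.trans ?_
  rw [Measure.lintegral_compProd hF]
  have h2 : ∀ k : History V m, ∫⁻ p, F (k, p) ∂(stepKernel W m k) =
      ∫⁻ p, stepDensity W k p * F (k, p)
        ∂((Measure.count : Measure V).prod (volume : Measure ℝ)) := fun k => by
    have hd : Measurable fun p => stepDensity W k p :=
      (measurable_stepDensity W m).comp (measurable_const.prodMk measurable_id)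
    have hFk : Measurable fun p => F (k, p) := hF.comp (measurable_const.prodMk measurable_id)
    rw [stepKernel, Kernel.withDensity_apply _ (measurable_stepDensity W m), Kernel.const_apply]
    exact lintegral_withDensity_eq_lintegral_mul _ hd hFk
  simp_rw [h2]
  refine lintegral_map (f := fun k => ∫⁻ p, stepDensity W k p * F (k, p)
        ∂((Measure.count : Measure V).prod (volume : Measure ℝ))) ?_ (measurable_hist m)
  exact Measurable.lintegral_prod_right' (f := fun z : History V m × (V × ℝ) =>
    stepDensity W z.1 z.2 * F z) ((measurable_stepDensity W m).mul hF)

theorem lintegral_stepDensity_mul {m : ℕ} (h : History V m) {f : V × ℝ → ℝ≥0∞}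
    (hf : Measurable f) :
    ∫⁻ p, stepDensity W h p * f p ∂((Measure.count : Measure V).prod (volume : Measure ℝ)) =
      ∑ y ∈ G.neighborFinset (h.pos m le_rfl), ∫⁻ t in Set.Ioi (0 : ℝ),
        ENNReal.ofReal (W.weight (h.pos m le_rfl) y * localTime h y *
          Real.exp (-((∑ j ∈ G.neighborFinset (h.pos m le_rfl),
            W.weight (h.pos m le_rfl) j * localTime h j) * t))) * f (y, t) := by
  set i := h.pos m le_rfl with hi
  have hrate : ∀ y, jumpRate W h i y = W.weight i y * localTime h y := fun y => by
    by_cases hy : G.Adj i y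
    · rw [jumpRate, if_pos hy, W.weight_of_adj hy]
    · rw [jumpRate, if_neg hy, W.weight_of_not_adj hy, zero_mul]
  have htotal : totalRate W h i = ∑ j ∈ G.neighborFinset i, W.weight i j * localTime h j :=
    Finset.sum_congr rfl fun j _ => hrate j
  have hm : Measurable fun p : V × ℝ => stepDensity W h p :=
    (measurable_stepDensity W m).comp (measurable_const.prodMk measurable_id)
  rw [lintegral_prod (fun p => stepDensity W h p * f p) (hm.mul hf).aemeasurable, lintegral_count]
  have h1 : ∀ y, ∫⁻ t, stepDensity W h (y, t) * f (y, t) = ∫⁻ t in Set.Ioi (0 : ℝ),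
        ENNReal.ofReal (W.weight i y * localTime h y *
          Real.exp (-((∑ j ∈ G.neighborFinset i, W.weight i j * localTime h j) * t))) *
            f (y, t) := fun y => by
    -- The density includes t = 0, a null set.
    rw [restrict_Ioi_eq_restrict_Ici, ← lintegral_indicator measurableSet_Ici]
    refine lintegral_congr fun t => ?_
    by_cases ht : 0 ≤ t
    · rw [Set.indicator_of_mem (Set.mem_Ici.2 ht), stepDensity, if_pos ht, ← hi]
      simp only [hrate, htotal]
    · rw [Set.indicator_of_notMem (fun h => ht (Set.mem_Ici.1 h)), stepDensity, if_neg ht, zero_mul]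
  simp_rw [h1]
  refine tsum_eq_sum fun y hy => ?_
  rw [W.weight_of_not_adj fun h => hy ((G.mem_neighborFinset i y).2 h)]
  simp

open Classical in
theorem localTime_hist_succ (m : ℕ) (x : ℕ → V × ℝ) :
    localTime (hist (m + 1) x) = bump (localTime (hist m x)) (x m).1 (max (x (m + 1)).2 0) := by
  funext j
  simp only [localTime, bump, Fin.sum_univ_castSucc, add_assoc]
  rfl

theorem localTime_hist_zero (x : ℕ → V × ℝ) : localTime (hist 0 x) = fun _ => 1 := by
  funext j
  simp [localTime]

theorem localTime_eq_one {m : ℕ} {S : Finset V} {h : History V m}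
    (hS : ∀ k (hk : k ≤ m), h.pos k hk ∈ S) {j : V} (hj : j ∉ S) : localTime h j = 1 := by
  rw [localTime, add_eq_left]
  refine Finset.sum_eq_zero fun k _ => if_neg fun hk => hj ?_
  rw [← hk]
  exact hS k _

theorem measurable_laplaceMean {S : Finset V} {Q : Measure (V → ℝ)} [SFinite Q]
    {q : (V → ℝ) → V → ℝ≥0∞} (hq : ∀ y, Measurable fun β => q β y) {α : Type*} [MeasurableSpace α]
    {L : α → V → ℝ} (hL : ∀ j, Measurable fun a => L a j) {x : α → V} (hx : Measurable x) :
    Measurable fun a => laplaceMean W S Q q (L a) (x a) := by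
  have h1 : ∀ y : V, Measurable fun a => laplaceMean W S Q q (L a) y := fun y => by
    unfold laplaceMean
    refine Measurable.mul ?_ ?_
    · refine Measurable.lintegral_prod_right' (f := fun z : α × (V → ℝ) =>
        q z.2 y * ENNReal.ofReal (Real.exp (-∑ i ∈ S, (L z.1 i ^ 2 - 1) * z.2 i))) ?_
      refine ((hq y).comp measurable_snd).mul ?_
      refine (Measurable.exp (Measurable.neg ?_)).ennreal_ofReal
      exact Finset.measurable_fun_sum _ fun i _ =>
        ((((hL i).comp measurable_fst).pow_const 2).sub_const 1).mul
          ((measurable_pi_apply i).comp measurable_snd)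
    · unfold lap
      fun_prop
  have h2 : Measurable fun p : V × α => laplaceMean W S Q q (L p.2) p.1 :=
    measurable_from_prod_countable_right fun y => h1 y
  exact h2.comp (hx.prodMk measurable_id)

/-- The processes `laplaceMean` are transported by the transition operator of the walk. -/
theorem setLIntegral_laplaceMean_succ (hG : ∀ i, (G.neighborFinset i).Nonempty) (i₀ : V) (m : ℕ)
    {S : Finset V} {Q : Measure (V → ℝ)} [SFinite Q] (hQ : ∀ᵐ β ∂Q, ∀ i, 0 < β i)
    {q : (V → ℝ) → V → ℝ≥0∞} (hq : ∀ y, Measurable fun β => q β y) {B : Set (History V m)}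
    (hB : MeasurableSet B) (hBS : ∀ h ∈ B, ∀ k (hk : k ≤ m), h.pos k hk ∈ S) :
    ∫⁻ x in hist m ⁻¹' B, laplaceMean W S Q q (localTime (hist (m + 1) x)) (x (m + 1)).1
        ∂(processLaw W hG i₀) =
      ∫⁻ x in hist m ⁻¹' B, laplaceMean W S Q (walkStep W S q) (localTime (hist m x)) (x m).1
        ∂(processLaw W hG i₀) := by
  classical
  have hBm := measurable_hist m hB
  -- The integrand after the next jump, written through the old history and the new pair only, so
  -- that the one-step disintegration applies.
  set F : History V m × (V × ℝ) → ℝ≥0∞ := fun z => (Prod.fst ⁻¹' B).indicator (fun z =>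
    laplaceMean W S Q q (bump (localTime z.1) (z.1.pos m le_rfl) (max z.2.2 0)) z.2.1) z with hF
  have hFm : Measurable F := by
    refine Measurable.indicator ?_ (measurable_fst hB)
    refine measurable_laplaceMean hq (fun j => ?_) (measurable_fst.comp measurable_snd)
    refine ((measurable_localTime j).comp measurable_fst).add (Measurable.ite ?_ ?_
      measurable_const)
    · exact ((measurable_pos m le_rfl).comp measurable_fst) (MeasurableSet.of_discrete (s := {j}))
    · exact (measurable_snd.comp measurable_snd).max measurable_const
  rw [← lintegral_indicator hBm, ← lintegral_indicator hBm]
  calc ∫⁻ x, (hist m ⁻¹' B).indicator (fun x =>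
        laplaceMean W S Q q (localTime (hist (m + 1) x)) (x (m + 1)).1) x ∂(processLaw W hG i₀)
      = ∫⁻ x, F (hist m x, x (m + 1)) ∂(processLaw W hG i₀) := by
        refine lintegral_congr fun x => ?_
        by_cases hx : hist m x ∈ B
        · rw [Set.indicator_of_mem (show x ∈ hist m ⁻¹' B from hx), hF]
          simp only
          rw [Set.indicator_of_mem (show (hist m x, x (m + 1)) ∈ Prod.fst ⁻¹' B from hx),
            localTime_hist_succ]
          rfl
        · rw [Set.indicator_of_notMem (show x ∉ hist m ⁻¹' B from hx), hF]
          simp only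
          rw [Set.indicator_of_notMem (show (hist m x, x (m + 1)) ∉ Prod.fst ⁻¹' B from hx)]
    _ = _ := by
        rw [lintegral_processLaw_succ hG i₀ m hFm]
        refine lintegral_congr fun x => ?_
        have hFx : Measurable fun p => F (hist m x, p) :=
          hFm.comp (measurable_const.prodMk measurable_id)
        rw [lintegral_stepDensity_mul (hist m x) hFx]
        by_cases hx : hist m x ∈ B
        · rw [Set.indicator_of_mem (show x ∈ hist m ⁻¹' B from hx)]
          have hpos : (hist m x).pos m le_rfl = (x m).1 := rfl
          have hsum := sum_lintegral_laplaceMean_bump (W := W) hQ hq (L := localTime (hist m x))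
            (x := (x m).1) (fun i => lt_of_lt_of_le one_pos (one_le_localTime _ i))
            (fun j hj => localTime_eq_one (hBS _ hx) hj) (hBS _ hx m le_rfl)
          rw [hpos]
          refine Eq.trans ?_ hsum
          refine Finset.sum_congr rfl fun y _ => setLIntegral_congr_fun measurableSet_Ioi
            fun t ht => ?_
          have ht' : (0 : ℝ) < t := ht
          simp only [hF]
          rw [Set.indicator_of_mem (show (hist m x, (y, t)) ∈ Prod.fst ⁻¹' B from hx)]
          simp only [max_eq_left ht'.le]
          rfl
        · rw [Set.indicator_of_notMem (show x ∉ hist m ⁻¹' B from hx)]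
          refine Finset.sum_eq_zero fun y _ => ?_
          simp only [hF]
          simp_rw [fun t : ℝ => Set.indicator_of_notMem
            (show (hist m x, (y, t)) ∉ Prod.fst ⁻¹' B from hx) (fun z : History V m × (V × ℝ) =>
    laplaceMean W S Q q (bump (localTime z.1) (z.1.pos m le_rfl) (max z.2.2 0)) z.2.1)]
          simp

theorem ae_processLaw_zero (hG : ∀ i, (G.neighborFinset i).Nonempty) (i₀ : V) :
    ∀ᵐ x ∂(processLaw W hG i₀), x 0 = (i₀, 0) := by
  have := isMarkovKernel_stepKernel W hG
  set z : History V 0 := (MeasurableEquiv.piUnique (fun _ : Finset.Iic 0 => V × ℝ)).symm (i₀, 0)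
    with hz
  have h1 : processLaw W hG i₀ = Kernel.traj (X := fun _ => V × ℝ) (fun n => stepKernel W n) 0 z := by
    have h2 : (Measure.dirac ((i₀, 0) : V × ℝ)).map
        (MeasurableEquiv.piUnique (fun _ : Finset.Iic 0 => V × ℝ)).symm = Measure.dirac z :=
      Measure.map_dirac' (MeasurableEquiv.measurable _) _
    have h3 : processLaw W hG i₀ = (Kernel.traj (X := fun _ => V × ℝ) (fun n => stepKernel W n) 0) ∘ₘ
      ((Measure.dirac ((i₀, 0) : V × ℝ)).map
        (MeasurableEquiv.piUnique (fun _ : Finset.Iic 0 => V × ℝ)).symm) := rfl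
    rw [h3, h2, Measure.dirac_bind (Kernel.measurable _)]
  have h4 : (processLaw W hG i₀).map (hist 0) = Measure.dirac z := by
    rw [h1]
    refine (Kernel.traj_map_frestrictLe_apply (X := fun _ => V × ℝ) (κ := fun n => stepKernel W n)
      0 0 z).trans ?_
    rw [Kernel.partialTraj_self, Kernel.id_apply]
  have h5 : ∀ᵐ h ∂((processLaw W hG i₀).map (hist 0)), h = z := by
    rw [h4, ae_dirac_eq]
    exact rfl
  filter_upwards [ae_of_ae_map (measurable_hist 0).aemeasurable h5] with x hx
  exact congrFun hx ⟨0, by simp⟩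

end Trajectories

/-! ### Lower bounds for the probability of late visits -/

section Recurrence
set_option linter.unusedSectionVars false
variable {V : Type*} {G : SimpleGraph V} [G.LocallyFinite] {W : Conductances G}
  [MeasurableSpace V] [DiscreteMeasurableSpace V] [Countable V] {S : Finset V}
  {Q : Measure (V → ℝ)} {q : (V → ℝ) → V → ℝ≥0∞} {i₀ : V}

theorem laplaceMean_eq_zero {x : V} (h : ∀ β, q β x = 0) (L : V → ℝ) :
    laplaceMean W S Q q L x = 0 := by
  simp [laplaceMean, h]

theorem laplaceMean_congr {q' : (V → ℝ) → V → ℝ≥0∞} {x : V} (h : ∀ β, q β x = q' β x)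
    (L : V → ℝ) : laplaceMean W S Q q L x = laplaceMean W S Q q' L x := by
  simp [laplaceMean, h]

/-- The mass of Q against the Laplace weight is lap(L) L_{i₀}, so the normalisation is exact at the
position i₀; elsewhere a function equal to 1 would have mean L_{i₀}/L_x. -/
theorem laplaceMean_one (hq : ∀ β, q β i₀ = 1)
    (hQ : ∀ l : V → ℝ, (∀ i, 0 ≤ l i) → ∫⁻ β, ENNReal.ofReal (Real.exp (-∑ i ∈ S, l i * β i)) ∂Q =
      ENNReal.ofReal (lap W S (fun i => √(1 + l i)) * √(1 + l i₀))) {L : V → ℝ}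
    (hL : ∀ i, 1 ≤ L i) : laplaceMean W S Q q L i₀ = 1 := by
  have h1 : ∀ i, √(1 + (L i ^ 2 - 1)) = L i := fun i => by
    rw [add_sub_cancel, Real.sqrt_sq (zero_le_one.trans (hL i))]
  have h2 := hQ (fun i => L i ^ 2 - 1) fun i => by nlinarith [hL i]
  simp only [h1] at h2
  have h3 : 0 < lap W S (fun i => L i) * L i₀ :=
    mul_pos (lap_pos W S fun i => one_pos.trans_le (hL i)) (one_pos.trans_le (hL i₀))
  simp only [laplaceMean, hq, one_mul]
  rw [h2, ← ENNReal.ofReal_mul h3.le, mul_one_div_cancel h3.ne', ENNReal.ofReal_one]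

/-- The histories that stay in `S`. -/
def stays (S : Finset V) (m : ℕ) : Set (History V m) := {h | ∀ k (hk : k ≤ m), h.pos k hk ∈ S}

theorem measurableSet_stays (S : Finset V) (m : ℕ) : MeasurableSet (stays S m) := by
  have h1 : stays S m = ⋂ (k : ℕ) (hk : k ≤ m), (fun h : History V m => h.pos k hk) ⁻¹' S := by
    ext h
    simp [stays]
  rw [h1]
  exact MeasurableSet.iInter fun k => MeasurableSet.iInter fun hk =>
    measurable_pos k hk (MeasurableSet.of_discrete)

/-- The histories that extend a history in `B` by a jump to a vertex of `S`. -/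
def extendIn (S : Finset V) {m : ℕ} (B : Set (History V m)) : Set (History V (m + 1)) :=
  {h | Preorder.frestrictLe₂ (π := fun _ : ℕ => V × ℝ) m.le_succ h ∈ B ∧ h.pos (m + 1) le_rfl ∈ S}

theorem measurableSet_extendIn {m : ℕ} {B : Set (History V m)} (hB : MeasurableSet B) :
    MeasurableSet (extendIn S B) :=
  MeasurableSet.inter (s₁ := Preorder.frestrictLe₂ (π := fun _ : ℕ => V × ℝ) m.le_succ ⁻¹' B)
    (s₂ := {h : History V (m + 1) | h.pos (m + 1) le_rfl ∈ (S : Set V)})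
    (Preorder.measurable_frestrictLe₂ m.le_succ hB)
    (measurable_pos (m + 1) le_rfl (MeasurableSet.of_discrete (s := (S : Set V))))

theorem extendIn_subset_stays {m : ℕ} {B : Set (History V m)} (hB : B ⊆ stays S m) :
    extendIn S B ⊆ stays S (m + 1) := by
  intro h hh k hk
  rcases Nat.lt_or_ge m k with h1 | h1
  · obtain rfl : k = m + 1 := by omega
    exact hh.2
  · exact hB hh.1 k h1

theorem setLIntegral_laplaceMean_extendIn (hG : ∀ i, (G.neighborFinset i).Nonempty) (m : ℕ)
    [SFinite Q] (hQ : ∀ᵐ β ∂Q, ∀ i, 0 < β i) (hq : ∀ y, Measurable fun β => q β y)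
    (hoff : ∀ β, ∀ x ∉ S, q β x = 0) {B : Set (History V m)} (hB : MeasurableSet B)
    (hBS : B ⊆ stays S m) :
    ∫⁻ x in hist (m + 1) ⁻¹' extendIn S B,
        laplaceMean W S Q q (localTime (hist (m + 1) x)) (x (m + 1)).1 ∂(processLaw W hG i₀) =
      ∫⁻ x in hist m ⁻¹' B, laplaceMean W S Q (walkStep W S q) (localTime (hist m x)) (x m).1
        ∂(processLaw W hG i₀) := by
  rw [← setLIntegral_laplaceMean_succ hG i₀ m hQ hq hB fun h hh => hBS hh,
    ← lintegral_indicator (measurable_hist _ (measurableSet_extendIn hB)),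
    ← lintegral_indicator (measurable_hist _ hB)]
  refine lintegral_congr fun x => ?_
  by_cases h1 : x ∈ hist m ⁻¹' B
  · rw [Set.indicator_of_mem h1]
    by_cases h2 : (x (m + 1)).1 ∈ S
    · rw [Set.indicator_of_mem (show x ∈ hist (m + 1) ⁻¹' extendIn S B from ⟨h1, h2⟩)]
    · rw [Set.indicator_of_notMem (show x ∉ hist (m + 1) ⁻¹' extendIn S B from fun h => h2 h.2),
        laplaceMean_eq_zero fun β => hoff β _ h2]
  · rw [Set.indicator_of_notMem h1, 
      Set.indicator_of_notMem (show x ∉ hist (m + 1) ⁻¹' extendIn S B from fun h => h1 h.1)]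

/-- The transport identity is applied backwards to time 0, where all local times are 1 and the mean
is the plain integral at i₀. Jumps out of S do not contribute because q vanishes there. -/
theorem setLIntegral_laplaceMean_iterate (hG : ∀ i, (G.neighborFinset i).Nonempty) (hi₀ : i₀ ∈ S)
    (m : ℕ) [SFinite Q] (hQ : ∀ᵐ β ∂Q, ∀ i, 0 < β i) (hq : ∀ y, Measurable fun β => q β y)
    (hoff : ∀ β, ∀ x ∉ S, q β x = 0) :
    ∫⁻ x in hist m ⁻¹' stays S m, laplaceMean W S Q q (localTime (hist m x)) (x m).1
        ∂(processLaw W hG i₀) = ∫⁻ β, (walkStep W S)^[m] q β i₀ ∂Q := by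
  induction m generalizing q with
  | zero =>
    have := isProbabilityMeasure_processLaw (W := W) hG i₀
    have h1 : laplaceMean W S Q q (fun _ => 1) i₀ = ∫⁻ β, q β i₀ ∂Q := by
      simp [laplaceMean, lap]
    have h2 := ae_processLaw_zero (W := W) hG i₀
    rw [← lintegral_indicator (measurable_hist _ (measurableSet_stays S 0))]
    have h3 : ∀ᵐ x ∂(processLaw W hG i₀), (hist 0 ⁻¹' stays S 0).indicator
        (fun x => laplaceMean W S Q q (localTime (hist 0 x)) (x 0).1) x = ∫⁻ β, q β i₀ ∂Q := by
      filter_upwards [h2] with x hx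
      have h4 : x ∈ hist 0 ⁻¹' stays S 0 := fun k hk => by
        obtain rfl : k = 0 := by omega
        change (x 0).1 ∈ S
        rw [hx]
        exact hi₀
      rw [Set.indicator_of_mem h4, localTime_hist_zero, hx, h1]
    rw [lintegral_congr_ae h3, lintegral_const, measure_univ, mul_one]
    rfl
  | succ m ih =>
    have h1 : stays S (m + 1) = extendIn S (stays S m) := by
      refine Set.Subset.antisymm (fun h hh => ⟨fun k hk => hh k (hk.trans m.le_succ), hh _ le_rfl⟩)
        (extendIn_subset_stays subset_rfl)
    rw [h1, setLIntegral_laplaceMean_extendIn hG m hQ hq hoff (measurableSet_stays S m) subset_rfl,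
      ih (fun y => measurable_walkStep W S hq y) fun β x hx => walkStep_of_notMem q β hx]
    rfl

/-- The trajectories that are at `i₀` at some time after the `m`-th jump. -/
def visitsAfter (i₀ : V) (m : ℕ) : Set (ℕ → V × ℝ) := {x | ∃ k ≥ m, (x k).1 = i₀}

/-- Induction on the number M of remaining steps: a history at i₀ has mean 1 and already counts as a
visit; otherwise the hitting function is one step of the walk, which the transport identity
exchanges for one jump of the process. -/
theorem setLIntegral_laplaceMean_hitProb_le (hG : ∀ i, (G.neighborFinset i).Nonempty) (hi₀ : i₀ ∈ S)
    [SFinite Q] (hQ : ∀ᵐ β ∂Q, ∀ i, 0 < β i)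
    (hQL : ∀ l : V → ℝ, (∀ i, 0 ≤ l i) →
      ∫⁻ β, ENNReal.ofReal (Real.exp (-∑ i ∈ S, l i * β i)) ∂Q =
        ENNReal.ofReal (lap W S (fun i => √(1 + l i)) * √(1 + l i₀))) (M m : ℕ)
    {B : Set (History V m)} (hB : MeasurableSet B) (hBS : B ⊆ stays S m) :
    ∫⁻ x in hist m ⁻¹' B,
        laplaceMean W S Q (hitProb W S i₀ M) (localTime (hist m x)) (x m).1 ∂(processLaw W hG i₀) ≤
      processLaw W hG i₀ (hist m ⁻¹' B ∩ visitsAfter i₀ m) := by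
  set P := processLaw W hG i₀ with hP
  set A : ∀ m, Set (History V m) := fun m => {h | h.pos m le_rfl = i₀} with hA
  have hAm : ∀ m, MeasurableSet (A m) := fun m =>
    measurable_pos m le_rfl (MeasurableSet.of_discrete (s := {i₀}))
  -- Separates the histories already at i₀, for which the integral equals the probability.
  have key : ∀ (M m : ℕ) (B : Set (History V m)),
      ∫⁻ x in hist m ⁻¹' (B \ A m),
        laplaceMean W S Q (hitProb W S i₀ M) (localTime (hist m x)) (x m).1 ∂P ≤
          P (hist m ⁻¹' (B \ A m) ∩ visitsAfter i₀ m) → MeasurableSet B →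
      ∫⁻ x in hist m ⁻¹' B,
        laplaceMean W S Q (hitProb W S i₀ M) (localTime (hist m x)) (x m).1 ∂P ≤
          P (hist m ⁻¹' B ∩ visitsAfter i₀ m) := by
    intro M m B h1 hB
    have hA' := measurable_hist m (hAm m)
    rw [← lintegral_inter_add_sdiff (μ := P) _ (hist m ⁻¹' B) hA', ← measure_inter_add_sdiff _ hA']
    refine add_le_add ?_ (h1.trans (measure_mono fun x hx => ⟨⟨hx.1.1, hx.2⟩, hx.1.2⟩))
    rw [setLIntegral_congr_fun (g := fun _ => 1) ((measurable_hist m hB).inter hA') fun x hx => by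
      have h2 : (x m).1 = i₀ := hx.2
      simp only [h2]
      exact laplaceMean_one (fun β => hitProb_self i₀ M β) hQL fun i => one_le_localTime _ i,
      setLIntegral_one]
    exact measure_mono fun x hx => ⟨⟨hx.1, m, le_rfl, hx.2⟩, hx.2⟩
  induction M generalizing m with
  | zero =>
    refine key 0 m B ?_ hB
    rw [setLIntegral_congr_fun (g := fun _ => 0) (measurable_hist m (hB.diff (hAm m))) fun x hx =>
      laplaceMean_eq_zero (fun β => by
        have h2 : (x m).1 ≠ i₀ := hx.2
        simp [hitProb, h2]) _, lintegral_zero]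
    exact zero_le
  | succ M ih =>
    refine key (M + 1) m B ?_ hB
    have hD := hB.diff (hAm m)
    have hDS : B \ A m ⊆ stays S m := Set.sdiff_subset.trans hBS
    rw [setLIntegral_congr_fun (measurable_hist m hD) fun x hx =>
      laplaceMean_congr (fun β => hitProb_succ_of_ne (W := W) (S := S) (show (x m).1 ≠ i₀ from hx.2)
        M β) _]
    rw [← setLIntegral_laplaceMean_extendIn hG m hQ (fun y => measurable_hitProb i₀ M y)
      (fun β x hx => hitProb_of_notMem hi₀ M β hx) hD hDS]
    refine (ih (m + 1) (measurableSet_extendIn hD) (extendIn_subset_stays hDS)).trans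
      (measure_mono fun x hx => ⟨hx.1.1, ?_⟩)
    obtain ⟨k, hk, h⟩ := hx.2
    exact ⟨k, m.le_succ.trans hk, h⟩

/-- After m steps of transport, the trajectory still has to reach i₀ within M jumps; M tends to
infinity by monotone convergence, and the power bound is inserted pointwise. -/
theorem lintegral_le_measure_visitsAfter (hG : ∀ i, (G.neighborFinset i).Nonempty) (hi₀ : i₀ ∈ S)
    [SFinite Q] (hQ : ∀ᵐ β ∂Q, ∀ i, 0 < β i)
    (hQL : ∀ l : V → ℝ, (∀ i, 0 ≤ l i) →
      ∫⁻ β, ENNReal.ofReal (Real.exp (-∑ i ∈ S, l i * β i)) ∂Q =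
        ENNReal.ofReal (lap W S (fun i => √(1 + l i)) * √(1 + l i₀)))
    {g : (V → ℝ) → V → V → ℝ} (hg : ∀ᵐ β ∂Q, IsGreen W S β (g β)) (m : ℕ) :
    ∫⁻ β, ENNReal.ofReal (1 - 1 / (2 * β i₀ * g β i₀ i₀)) ^ m ∂Q ≤
      processLaw W hG i₀ (visitsAfter i₀ m) := by
  calc ∫⁻ β, ENNReal.ofReal (1 - 1 / (2 * β i₀ * g β i₀ i₀)) ^ m ∂Q
      ≤ ∫⁻ β, ⨆ M, (walkStep W S)^[m] (hitProb W S i₀ M) β i₀ ∂Q := by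
        refine lintegral_mono_ae ?_
        filter_upwards [hQ, hg] with β hβ hgβ using pow_le_walkStep_iterate hi₀ hβ hgβ m
    _ = ⨆ M, ∫⁻ β, (walkStep W S)^[m] (hitProb W S i₀ M) β i₀ ∂Q :=
        lintegral_iSup (fun M => measurable_walkStep_iterate (fun y => measurable_hitProb i₀ M y) m i₀)
          fun M N hMN β => (walkStep_iterate_iSup_hitProb i₀ m β i₀).2 hMN
    _ ≤ _ := by
        refine iSup_le fun M => ?_
        rw [← setLIntegral_laplaceMean_iterate hG hi₀ m hQ (fun y => measurable_hitProb i₀ M y)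
          fun β x hx => hitProb_of_notMem hi₀ M β hx]
        exact (setLIntegral_laplaceMean_hitProb_le hG hi₀ hQ hQL M m (measurableSet_stays S m)
          subset_rfl).trans (measure_mono Set.inter_subset_right)

/-- The mean of a power of the return probability, under the law of the potential biased by `ψ`,
bounds the probability of a late visit from below. -/
theorem lintegral_psiVersion_mul_le {ν : Measure (V → ℝ)} (hν : IsPotentialLaw W ν)
    (hG : ∀ i, (G.neighborFinset i).Nonempty) (hS : IsWired W S) (hi₀ : i₀ ∈ S) (m : ℕ) :
    ∫⁻ β, ENNReal.ofReal (psiVersion hν S i₀ β) *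
        ENNReal.ofReal (1 - 1 / (2 * β i₀ * greenVersion hν S β i₀ i₀)) ^ m ∂ν ≤
      processLaw W hG i₀ (visitsAfter i₀ m) := by
  have := hν.isProbabilityMeasure
  have hm := (measurable_psiVersion hν S i₀).ennreal_ofReal
  have hac : (ν.withDensity fun β => ENNReal.ofReal (psiVersion hν S i₀ β)) ≪ ν :=
    withDensity_absolutelyContinuous _ _
  have h := isTiltedGreen_greenVersion hν S
  have h1 := lintegral_le_measure_visitsAfter (W := W) (i₀ := i₀)
    (Q := ν.withDensity fun β => ENNReal.ofReal (psiVersion hν S i₀ β)) hG hi₀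
    (hac.ae_le hν.pos) (fun l hl => ?_) (hac.ae_le h.isGreen) m
  · rw [lintegral_withDensity_eq_lintegral_mul _ hm] at h1
    · exact h1
    · have := h.measurable i₀ i₀
      fun_prop
  · rw [lintegral_withDensity_eq_lintegral_mul _ hm (by fun_prop),
      ← h.lintegral_psiOf hν hS.1 hS.2 hl hi₀]
    refine lintegral_congr fun β => ?_
    rw [ENNReal.ofReal_mul' (Real.exp_pos _).le]
    rfl

end Recurrence

/-! ### Transience excludes a vanishing ψ -/

section Transience
set_option linter.unusedSectionVars false
variable {V : Type*} {G : SimpleGraph V} [G.LocallyFinite] {W : Conductances G} {S : Finset V}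
  {ν : Measure (V → ℝ)} {i₀ : V}

theorem IsGreen.one_le_two_mul {β : V → ℝ} {g : V → V → ℝ} (h : IsGreen W S β g) {i : V}
    (hi : i ∈ S) : 1 ≤ 2 * β i * g i i := by
  have h1 := h.eqn i hi i hi
  rw [if_pos rfl] at h1
  have h2 : 0 ≤ ∑ k ∈ S, W.weight i k * g k i :=
    Finset.sum_nonneg fun k _ => mul_nonneg (W.weight_nonneg _ _) (h.nonneg _ _)
  linarith

/-- The tilted inequality at l = 0 and θ = -δ_{i₀}. It controls large values of ψ as long as the
Green function stays bounded. -/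
theorem lintegral_exp_psiVersion_le (hν : IsPotentialLaw W ν) (hi₀ : i₀ ∈ S) :
    ∫⁻ β, ENNReal.ofReal (Real.exp (psiVersion hν S i₀ β - greenVersion hν S β i₀ i₀ / 2)) ∂ν ≤
      ENNReal.ofReal (Real.exp 1) := by
  classical
  have h := (isTiltedGreen_greenVersion hν S).tilt_le (fun _ => 0) (Pi.single i₀ (-1))
    fun _ => le_rfl
  have h1 : lap W S (fun _ => √(1 + 0)) *
      Real.exp (-∑ i ∈ S, (Pi.single i₀ (-1) : V → ℝ) i * √(1 + 0)) = Real.exp 1 := by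
    simp [lap, hi₀]
  rw [h1] at h
  refine le_trans (le_of_eq (lintegral_congr fun β => ?_)) h
  congr 2
  rw [psiVersion, psiOf, if_pos hi₀, tiltExponent, bilin]
  simp only [zero_mul, Finset.sum_const_zero, neg_zero, zero_sub]
  rw [Finset.sum_eq_single_of_mem i₀ hi₀ fun a _ ha => Finset.sum_eq_zero fun b _ => by
    rw [Pi.single_eq_of_ne ha]; ring, Pi.single_eq_same]
  have h2 : ∑ b ∈ S, greenVersion hν S β i₀ b * (Pi.single i₀ (-1) : V → ℝ) b =
      -greenVersion hν S β i₀ i₀ := by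
    rw [Finset.sum_eq_single_of_mem i₀ hi₀ fun b _ hb => by rw [Pi.single_eq_of_ne hb]; ring,
      Pi.single_eq_same]
    ring
  calc _ = ∑ b ∈ S, greenVersion hν S β i₀ b * boundaryWeight W S b +
        1 / 2 * ∑ b ∈ S, greenVersion hν S β i₀ b * (Pi.single i₀ (-1) : V → ℝ) b := by
        rw [h2]; ring
    _ = _ := by
        rw [Finset.mul_sum, ← Finset.sum_add_distrib, ← Finset.sum_neg_distrib]
        exact Finset.sum_congr rfl fun b _ => by ring

/-- Under the law biased by ψ, the potential at i₀ has a Laplace transform that does not depend on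
S. The bound on small values of β_{i₀} is therefore uniform in the exhaustion. -/
theorem lintegral_psiVersion_mul_exp (hν : IsPotentialLaw W ν) (hS : IsWired W S) (hi₀ : i₀ ∈ S)
    {s : ℝ} (hs : 0 ≤ s) :
    ∫⁻ β, ENNReal.ofReal (psiVersion hν S i₀ β * Real.exp (-(s * β i₀))) ∂ν =
      ENNReal.ofReal (Real.exp (-(boundaryWeight W {i₀} i₀ * (√(1 + s) - 1)))) := by
  classical
  set l : V → ℝ := Pi.single i₀ s with hl
  have hl0 : ∀ i, 0 ≤ l i := fun i => by
    by_cases h : i = i₀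
    · subst h; simpa [hl] using hs
    · simp [hl, h]
  have hli : l i₀ = s := by simp [hl]
  have h1 : ∀ β : V → ℝ, ∑ i ∈ S, l i * β i = s * β i₀ := fun β => by
    rw [Finset.sum_eq_single_of_mem i₀ hi₀ fun b _ hb => by rw [hl, Pi.single_eq_of_ne hb, zero_mul],
      hli]
  have h := (isTiltedGreen_greenVersion hν S).lintegral_psiOf_mul hν hS.1 hS.2 hl0 i₀
  have h2 := hν.lintegral_exp {i₀} hl0
  simp only [Finset.sum_singleton, hli] at h2
  simp only [h1] at h
  rw [h2, if_pos hi₀, hli, ← ENNReal.ofReal_mul (lap_pos W _ (sqrt_one_add_pos hl0)).le] at h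
  have h3 : 0 < √(1 + s) := Real.sqrt_pos.2 (by linarith)
  have h4 : lap W {i₀} (fun i => √(1 + l i)) * √(1 + s) =
      Real.exp (-(boundaryWeight W {i₀} i₀ * (√(1 + s) - 1))) := by
    simp only [lap, Finset.sum_singleton, Finset.prod_singleton, W.weight_self, zero_mul, mul_zero,
      neg_zero, zero_sub, hli]
    field_simp
  rw [← h4, ← h]
  exact lintegral_congr fun β => ENNReal.ofReal_mul' (Real.exp_pos _).le

/-- Each region is charged to one term: β small to the exponential in β; β not small and g > K to
the bound 1/(2bg) ≤ s/(2K); g ≤ K to the truncation of ψ at A plus, above A, the estimate ψ ≤ ψ²/A ≤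
(2/A)e^ψ. -/
theorem psi_mul_return_le {ψ b g s K A : ℝ} (hψ : 0 ≤ ψ) (hs : 0 < s)
    (hK : 0 < K) (hA : 0 < A) (hbg : 1 ≤ 2 * b * g) :
    ψ * (1 / (2 * b * g)) ≤ Real.exp 1 * (ψ * Real.exp (-(s * b))) + min ψ A +
      2 / A * Real.exp (K / 2) * Real.exp (ψ - g / 2) + s / (2 * K) * ψ := by
  have h0 : 0 ≤ min ψ A := le_min hψ hA.le
  have h1 : 0 ≤ Real.exp 1 * (ψ * Real.exp (-(s * b))) := by positivity
  have h2 : 0 ≤ 2 / A * Real.exp (K / 2) * Real.exp (ψ - g / 2) := by positivity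
  have h3 : 0 ≤ s / (2 * K) * ψ := by positivity
  have h4 : ψ * (1 / (2 * b * g)) ≤ ψ :=
    mul_le_of_le_one_right hψ ((div_le_one (by linarith)).2 hbg)
  by_cases hsb : s * b ≤ 1
  · have h5 : 1 ≤ Real.exp 1 * Real.exp (-(s * b)) := by
      rw [← Real.exp_add]
      exact Real.one_le_exp (by linarith)
    nlinarith
  by_cases hg : g ≤ K
  · suffices ψ ≤ min ψ A + 2 / A * Real.exp (K / 2) * Real.exp (ψ - g / 2) by linarith
    by_cases hψA : ψ ≤ A
    · rw [min_eq_left hψA]; linarith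
    · push Not at hψA
      have h5 : ψ ^ 2 / 2 ≤ Real.exp ψ := by
        have := Real.quadratic_le_exp_of_nonneg hψ
        linarith
      have h6 : Real.exp ψ ≤ Real.exp (K / 2) * Real.exp (ψ - g / 2) := by
        rw [← Real.exp_add]
        exact Real.exp_le_exp.2 (by linarith)
      have h7 : ψ ≤ 2 / A * (ψ ^ 2 / 2) := by
        rw [show 2 / A * (ψ ^ 2 / 2) = ψ * (ψ / A) by field_simp]
        exact le_mul_of_one_le_right hψ ((one_le_div hA).2 hψA.le)
      have h8 : 2 / A * (ψ ^ 2 / 2) ≤ 2 / A * (Real.exp (K / 2) * Real.exp (ψ - g / 2)) :=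
        mul_le_mul_of_nonneg_left (h5.trans h6) (by positivity)
      rw [← mul_assoc] at h8
      linarith
  · push Not at hsb hg
    suffices ψ * (1 / (2 * b * g)) ≤ s / (2 * K) * ψ by linarith
    rw [mul_comm]
    refine mul_le_mul_of_nonneg_right ?_ hψ
    rw [div_le_div_iff₀ (by linarith) (by linarith)]
    nlinarith [mul_lt_mul'' hsb hg zero_le_one hK.le]

/-- The truncated mean tends to 0 by dominated convergence because ψ does; the other three terms are
at most ε uniformly in n, once s, then K, then A are chosen. -/
theorem eventually_lintegral_psi_mul_return_le [Infinite V] (hν : IsPotentialLaw W ν)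
    {Λ : ℕ → Finset V} (hΛ : IsExhaustion G Λ) (h0 : ∀ᵐ β ∂ν, psi W Λ β i₀ = 0) {ε : ℝ}
    (hε : 0 < ε) : ∀ᶠ n in atTop, ∫⁻ β, ENNReal.ofReal (psiVersion hν (Λ n) i₀ β *
      (1 / (2 * β i₀ * greenVersion hν (Λ n) β i₀ i₀))) ∂ν ≤ ENNReal.ofReal (4 * ε) := by
  have hG := hΛ.graph_connected
  have := hν.isProbabilityMeasure
  have := hΛ.countable
  set η := boundaryWeight W {i₀} i₀ with hη
  have hη0 : 0 < η := by
    obtain ⟨k, hk⟩ := hG.preconnected.exists_adj_of_nontrivial i₀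
    exact boundaryWeight_pos W hk (by simpa using hk.ne')
  -- Here a is √(1 + s), chosen so that η(a - 1) ≥ 1 - log ε, which makes the first term at most ε.
  set a : ℝ := 2 + |1 - Real.log ε| / η with ha
  have ha2 : 2 ≤ a := by rw [ha]; linarith [show 0 ≤ |1 - Real.log ε| / η by positivity]
  set s := a ^ 2 - 1 with hs
  have hs0 : 0 < s := by nlinarith
  have hsa : √(1 + s) = a := by rw [hs, add_sub_cancel, Real.sqrt_sq (by linarith)]
  have hexp : Real.exp 1 * Real.exp (-(η * (√(1 + s) - 1))) ≤ ε := by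
    rw [hsa, ← Real.exp_add, ← Real.le_log_iff_exp_le hε]
    have h1 : η * (a - 1) = η + |1 - Real.log ε| := by rw [ha]; field_simp; ring
    linarith [le_abs_self (1 - Real.log ε)]
  set K := s / (2 * ε) with hK
  have hK0 : 0 < K := by positivity
  have hKs : s / (2 * K) = ε := by rw [hK]; field_simp
  set A := 2 * Real.exp (K / 2) * Real.exp 1 / ε with hA
  have hA0 : 0 < A := by positivity
  have hAε : 2 / A * Real.exp (K / 2) * Real.exp 1 = ε := by rw [hA]; field_simp
  have hmin : Tendsto (fun n => ∫⁻ β, ENNReal.ofReal (min (psiVersion hν (Λ n) i₀ β) A) ∂ν) atTop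
      (𝓝 0) := by
    have h1 := tendsto_lintegral_of_dominated_convergence (μ := ν)
      (F := fun n β => ENNReal.ofReal (min (psiVersion hν (Λ n) i₀ β) A)) (f := fun _ => 0)
      (fun _ => ENNReal.ofReal A)
      (fun n => ((measurable_psiVersion hν (Λ n) i₀).min measurable_const).ennreal_ofReal)
      (fun n => ae_of_all _ fun β => ENNReal.ofReal_le_ofReal (min_le_right _ _))
      (by simp) ?_
    · simpa using h1
    · filter_upwards [h0, tendsto_psiVersion hν hG hΛ] with β h2 h3
      have h4 := ENNReal.tendsto_ofReal ((h3 i₀).min (tendsto_const_nhds (x := A)))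
      rw [h2, min_eq_left hA0.le, ENNReal.ofReal_zero] at h4
      exact h4
  have hmin' := hmin.eventually (ge_mem_nhds (ENNReal.ofReal_pos.2 hε))
  obtain ⟨n₀, hn₀⟩ := hΛ.exhausts i₀
  filter_upwards [hmin', eventually_ge_atTop n₀] with n hn1 hn
  have hi₀ : i₀ ∈ Λ n := hΛ.mono hn hn₀
  have hS : IsWired W (Λ n) := hΛ.isWired hG (fun n => Infinite.exists_notMem_finset _) n
  have hmψ := measurable_psiVersion hν (Λ n) i₀
  have hmg := (isTiltedGreen_greenVersion hν (Λ n)).measurable i₀ i₀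
  have hmβ : Measurable fun β : V → ℝ => β i₀ := measurable_pi_apply i₀
  set ψ := psiVersion hν (Λ n) i₀ with hψ
  set g := fun β => greenVersion hν (Λ n) β i₀ i₀ with hg
  calc ∫⁻ β, ENNReal.ofReal (ψ β * (1 / (2 * β i₀ * g β))) ∂ν
      ≤ ∫⁻ β, (ENNReal.ofReal (Real.exp 1) * ENNReal.ofReal (ψ β * Real.exp (-(s * β i₀))) +
          ENNReal.ofReal (min (ψ β) A) + ENNReal.ofReal (2 / A * Real.exp (K / 2)) *
            ENNReal.ofReal (Real.exp (ψ β - g β / 2)) +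
          ENNReal.ofReal (s / (2 * K)) * ENNReal.ofReal (ψ β)) ∂ν := by
        refine lintegral_mono_ae ?_
        filter_upwards [hν.pos, ae_isGreen hν] with β hβ hgr
        have hψ0 : 0 ≤ ψ β := (hgr (Λ n)).psiOf_nonneg i₀
        have h1 := psi_mul_return_le hψ0 hs0 hK0 hA0 ((hgr (Λ n)).one_le_two_mul hi₀)
        have hm0 : 0 ≤ min (ψ β) A := le_min hψ0 hA0.le
        rw [← ENNReal.ofReal_mul (by positivity), ← ENNReal.ofReal_mul (by positivity),
          ← ENNReal.ofReal_mul (by positivity), ← ENNReal.ofReal_add (by positivity) (by positivity),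
          ← ENNReal.ofReal_add (by positivity) (by positivity),
          ← ENNReal.ofReal_add (by positivity) (by positivity)]
        exact ENNReal.ofReal_le_ofReal h1
    _ = ENNReal.ofReal (Real.exp 1) * ∫⁻ β, ENNReal.ofReal (ψ β * Real.exp (-(s * β i₀))) ∂ν +
          ∫⁻ β, ENNReal.ofReal (min (ψ β) A) ∂ν + ENNReal.ofReal (2 / A * Real.exp (K / 2)) *
            ∫⁻ β, ENNReal.ofReal (Real.exp (ψ β - g β / 2)) ∂ν +
          ENNReal.ofReal (s / (2 * K)) * ∫⁻ β, ENNReal.ofReal (ψ β) ∂ν := by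
        rw [lintegral_add_right _ (by fun_prop), lintegral_add_right _ (by fun_prop),
          lintegral_add_right _ (by fun_prop), lintegral_const_mul _ (by fun_prop),
          lintegral_const_mul _ (by fun_prop), lintegral_const_mul _ (by fun_prop)]
    _ ≤ ENNReal.ofReal ε + ENNReal.ofReal ε + ENNReal.ofReal ε + ENNReal.ofReal ε := by
        refine add_le_add (add_le_add (add_le_add ?_ hn1) ?_) ?_
        · rw [hψ, lintegral_psiVersion_mul_exp hν hS hi₀ hs0.le,
            ← ENNReal.ofReal_mul (Real.exp_pos _).le]
          exact ENNReal.ofReal_le_ofReal hexp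
        · rw [← hAε, ENNReal.ofReal_mul (q := Real.exp 1) (by positivity)]
          exact mul_le_mul_right (lintegral_exp_psiVersion_le hν hi₀) _
        · rw [hψ, lintegral_psiVersion hν hS, mul_one, hKs]
    _ = ENNReal.ofReal (4 * ε) := by
        rw [← ENNReal.ofReal_add hε.le hε.le, ← ENNReal.ofReal_add (by positivity) hε.le,
          ← ENNReal.ofReal_add (by positivity) hε.le]
        congr 1
        ring

/-- If ψ vanished, the walk would return with weight close to 1 under the biased law of total mass
1, so a visit to i₀ after m jumps would be almost sure for every m. -/
theorem IsTransient.not_ae_psi_eq_zero [Infinite V] [MeasurableSpace V] [DiscreteMeasurableSpace V]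
    [Countable V] {hG : ∀ i, (G.neighborFinset i).Nonempty} (h : IsTransient W hG i₀)
    (hν : IsPotentialLaw W ν) {Λ : ℕ → Finset V} (hΛ : IsExhaustion G Λ) :
    ¬ ∀ᵐ β ∂ν, psi W Λ β i₀ = 0 := by
  intro h0
  have := isProbabilityMeasure_processLaw (W := W) hG i₀
  obtain ⟨n₀, hn₀⟩ := hΛ.exhausts i₀
  have key : ∀ m : ℕ, 1 ≤ processLaw W hG i₀ (visitsAfter i₀ m) := by
    intro m
    refine ENNReal.le_of_forall_pos_le_add fun ε hε _ => ?_
    have hε' : (0 : ℝ) < ε / (4 * (m + 1)) := by positivity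
    obtain ⟨n, hn1, hn⟩ := ((eventually_lintegral_psi_mul_return_le hν hΛ h0 hε').and
      (eventually_ge_atTop n₀)).exists
    have hi₀ : i₀ ∈ Λ n := hΛ.mono hn hn₀
    have hS : IsWired W (Λ n) :=
      hΛ.isWired hΛ.graph_connected (fun n => Infinite.exists_notMem_finset _) n
    have hmψ := measurable_psiVersion hν (Λ n) i₀
    have hmg := (isTiltedGreen_greenVersion hν (Λ n)).measurable i₀ i₀
    have hmβ : Measurable fun β : V → ℝ => β i₀ := measurable_pi_apply i₀
    set ψ := psiVersion hν (Λ n) i₀ with hψ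
    set g := fun β => greenVersion hν (Λ n) β i₀ i₀ with hg
    calc (1 : ℝ≥0∞) = ∫⁻ β, ENNReal.ofReal (ψ β) ∂ν := (lintegral_psiVersion hν hS i₀).symm
      _ ≤ ∫⁻ β, (ENNReal.ofReal (ψ β) * ENNReal.ofReal (1 - 1 / (2 * β i₀ * g β)) ^ m +
            ENNReal.ofReal m * ENNReal.ofReal (ψ β * (1 / (2 * β i₀ * g β)))) ∂ν := by
          refine lintegral_mono_ae ?_
          filter_upwards [hν.pos, ae_isGreen hν] with β hβ hgr
          have hψ0 : 0 ≤ ψ β := (hgr (Λ n)).psiOf_nonneg i₀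
          have h1 : 1 ≤ 2 * β i₀ * g β := (hgr (Λ n)).one_le_two_mul hi₀
          have h2 : 1 / (2 * β i₀ * g β) ≤ 1 := (div_le_one (by linarith)).2 h1
          have h3 : 0 ≤ 1 / (2 * β i₀ * g β) := by positivity
          set ρ := 1 / (2 * β i₀ * g β) with hρ
          -- Bernoulli's inequality: (1 - ρ)^m ≥ 1 - mρ, so the loss is m times the small mean of
          -- ψρ.
          have h4 := one_add_mul_le_pow (a := -ρ) (by linarith) m
          rw [← sub_eq_add_neg 1 ρ] at h4
          have h5 : 0 ≤ 1 - ρ := by linarith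
          rw [← ENNReal.ofReal_pow h5, ← ENNReal.ofReal_mul hψ0,
            ← ENNReal.ofReal_mul (by positivity), ← ENNReal.ofReal_add (by positivity)
            (by positivity)]
          refine ENNReal.ofReal_le_ofReal ?_
          nlinarith [mul_le_mul_of_nonneg_left h4 hψ0]
      _ = ∫⁻ β, ENNReal.ofReal (ψ β) * ENNReal.ofReal (1 - 1 / (2 * β i₀ * g β)) ^ m ∂ν +
            ENNReal.ofReal m * ∫⁻ β, ENNReal.ofReal (ψ β * (1 / (2 * β i₀ * g β))) ∂ν := by
          rw [lintegral_add_right _ (by fun_prop), lintegral_const_mul _ (by fun_prop)]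
      _ ≤ _ := by
          refine add_le_add (lintegral_psiVersion_mul_le hν hG hS hi₀ m)
            ((mul_le_mul_right hn1 _).trans ?_)
          rw [← ENNReal.ofReal_mul m.cast_nonneg, ← ENNReal.ofReal_coe_nnreal]
          refine ENNReal.ofReal_le_ofReal ?_
          have h1 : (m : ℝ) * (4 * (ε / (4 * (m + 1)))) = ε * (m / (m + 1)) := by field_simp
          rw [h1]
          exact mul_le_of_le_one_right ε.2 ((div_le_one (by positivity)).2 (by linarith))
  have h1 : ∀ᵐ x ∂(processLaw W hG i₀), ∀ m, x ∈ visitsAfter i₀ m := by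
    refine ae_all_iff.2 fun m => ?_
    have hm : MeasurableSet (visitsAfter (V := V) i₀ m) := by
      have h2 : visitsAfter (V := V) i₀ m =
          ⋃ (k : ℕ) (_ : k ≥ m), (fun x : ℕ → V × ℝ => (x k).1) ⁻¹' {i₀} := by
        ext x
        simp [visitsAfter]
      rw [h2]
      exact MeasurableSet.iUnion fun k => MeasurableSet.iUnion fun _ =>
        (measurable_fst.comp (measurable_pi_apply k)) MeasurableSet.of_discrete
    exact (prob_compl_eq_zero_iff hm).2 (le_antisymm prob_le_one (key m))
  obtain ⟨x, hx1, hx2⟩ := (h1.and h).exists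
  obtain ⟨N, hN⟩ := (hx2 i₀).bddAbove
  obtain ⟨k, hk, hki⟩ := hx1 (N + 1)
  exact absurd (hN hki) (by omega)

end Transience

end VRJP

end

/-! ### Assembly of the general statements and of the case of the grid -/

theorem theorem2 :
    -- the general graph: convergence to finite limits, then (i), (ii), (iii)
    (∀ (V : Type*) (G : SimpleGraph V) [G.LocallyFinite], G.Connected →
      ∀ (W : VRJP.Conductances G) (ν : Measure (V → ℝ)), VRJP.IsPotentialLaw W ν →
      ∀ Λ : ℕ → Finset V, VRJP.IsExhaustion G Λ →
        (∀ᵐ β ∂ν,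
          (∀ i j, Tendsto (fun n => VRJP.greenFin W (Λ n) β i j) atTop
            (𝓝 (ENNReal.ofReal (VRJP.green W Λ β i j)))) ∧
          (∀ i, Tendsto (fun n => VRJP.psiFin W (Λ n) β i) atTop
            (𝓝 (ENNReal.ofReal (VRJP.psi W Λ β i))))) ∧
        (∀ᵐ β ∂ν, VRJP.spectrumOf (VRJP.schrodingerOp W β) ⊆
          {z : ℂ | 0 ≤ z.re ∧ z.im = 0}) ∧
        (∀ i j, ∀ᵐ β ∂ν, Tendsto
          (fun ε : ℝ => VRJP.entry
            (VRJP.resolventOf (VRJP.schrodingerOp W β) (-(ε : ℂ))) i j)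
          (𝓝[>] 0) (𝓝 (VRJP.green W Λ β i j : ℂ))) ∧
        (∀ᵐ β ∂ν, ∀ i, VRJP.schrodinger W β (VRJP.psi W Λ β) i = 0)) ∧
    -- (iv): the grid with constant conductances
    (∀ (d : ℕ) (hd : 0 < d) (w : ℝ) (hw : 0 < w) (ν : Measure ((Fin d → ℤ) → ℝ)),
      VRJP.IsPotentialLaw (VRJP.gridConst d w hw) ν →
      ∀ Λ : ℕ → Finset (Fin d → ℤ), VRJP.IsExhaustion (VRJP.grid d) Λ →
        VRJP.IsStationaryErgodic ν
          (fun β => (VRJP.green (VRJP.gridConst d w hw) Λ β,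
            VRJP.psi (VRJP.gridConst d w hw) Λ β))
          (VRJP.shift (d := d)) ∧
        (∀ i₀ : Fin d → ℤ,
          VRJP.IsTransient (VRJP.gridConst d w hw)
            (VRJP.grid_neighborFinset_nonempty hd) i₀ →
          (∀ᵐ β ∂ν, ∀ i, 0 < VRJP.psi (VRJP.gridConst d w hw) Λ β i) ∧
          (∀ᵐ β ∂ν, ∀ i, VRJP.schrodinger (VRJP.gridConst d w hw) β
            (VRJP.psi (VRJP.gridConst d w hw) Λ β) i = 0) ∧
          (∃ p : ℝ, 0 ≤ p ∧ ∀ᵐ β ∂ν, ∃ C : ℝ, 0 < C ∧ ∀ i : Fin d → ℤ, i ≠ 0 →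
            |VRJP.psi (VRJP.gridConst d w hw) Λ β i| ≤ C * ‖i‖ ^ p))) := by
  refine ⟨fun V G _ hG W ν hν Λ hΛ => ?_, fun d hd w hw ν hν Λ hΛ => ?_⟩
  · have hreg := VRJP.ae_isRegular hG hν hΛ
    refine ⟨?_, ?_, fun i j => ?_, ?_⟩
    · filter_upwards [hreg] with β h
      exact ⟨fun i j => h.tendsto_green hΛ.mono i j, fun i => h.tendsto_psi i⟩
    · filter_upwards [hreg] with β h using h.spectrumOf_subset hΛ
    · filter_upwards [hreg] with β h using h.tendsto_resolvent hΛ i j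
    · filter_upwards [hreg] with β h i using h.schrodinger_psi hΛ i
  · have := VRJP.infinite_grid hd
    have hG := hΛ.graph_connected
    refine ⟨VRJP.isStationaryErgodic_green_psi hd hν hΛ, fun i₀ htr => ⟨?_, ?_, ?_⟩⟩
    · exact VRJP.ae_psi_pos_of_not_ae_eq_zero hd hν hΛ (htr.not_ae_psi_eq_zero hν hΛ)
    · filter_upwards [VRJP.ae_isRegular hG hν hΛ] with β h i using h.schrodinger_psi hΛ i
    -- The exponent is d for the volume of the cubes plus 2 for the summable weights.
    · refine ⟨(d + 2 : ℕ), Nat.cast_nonneg _, ?_⟩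
      filter_upwards [VRJP.ae_exists_le_norm_pow (fun i => VRJP.aemeasurable_psi hν hG hΛ i)
        fun i => VRJP.lintegral_psi_le hν hΛ i] with β h
      obtain ⟨C, hC, h⟩ := h
      refine ⟨C, hC, fun i hi => ?_⟩
      rw [abs_of_nonneg (VRJP.psi_nonneg _ _ _ _), Real.rpow_natCast]
      exact h i hi
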